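/- There is an absolute constant $C$ such that the following holds. Let $m \ge 1$, $n \ge 0$ and $\Delta$ be integers, and let $A \in \mathbb{Z}_{\ge 0}^{m \times n}$ and $b \in \mathbb{Z}_{\ge 1}^m$ have all entries at most $\Delta$. Suppose that the set $S = \{x \in \{0,1\}^n : Ax \ge b\}$ is non-empty. Then $S$ is defined by a monotone formula $\phi$ of size at most $$\Delta^{5.3} \cdot m \cdot n \cdot \big(\log_2 (n+1)\big)^{C}.$$ Here a monotone formula is built from the input variables $x_1, \dots, x_n$ using only $\wedge$ and $\vee$ (no negations and no Boolean constants), its size is the total number of occurrences of input variables, and it defines the set of points of $\{0,1\}^n$ at which its value is $1$. Moreover, such a formula can be constructed in randomized polynomial time: there is a probabilistic algorithm (formally, a program for a random access machine whose unit-cost operations are assignment of a constant, addition, truncated subtraction, comparison, indirect load and store, tossing a fair coin, and writing to the output) which, given $A$ and $b$ as above, always halts after a number of steps that is bounded by a fixed polynomial in $m + n + \Delta$, and which outputs with probability at least $2/3$ (over its coin tosses) a monotone formula that defines $S$ and obeys the above size bound with the same constant $C$. -/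

import Mathlib

/-- Boolean formulas built from the input variables `x₀, …, xₙ₋₁` with `¬`, `∧`, `∨`
(no Boolean constants). -/
inductive BoolFormula (n : ℕ) : Type
  | var (i : Fin n) : BoolFormula n
  | neg (φ : BoolFormula n) : BoolFormula n
  | and (φ ψ : BoolFormula n) : BoolFormula n
  | or (φ ψ : BoolFormula n) : BoolFormula n

namespace BoolFormula

variable {n : ℕ}

/-- The output `φ(x)` on the input `x ∈ {0,1}ⁿ`. -/
def eval : BoolFormula n → (Fin n → Bool) → Bool
  | var i, x => x i
  | neg φ, x => !(φ.eval x)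
  | and φ ψ, x => φ.eval x && ψ.eval x
  | or φ ψ, x => φ.eval x || ψ.eval x

/-- The size `|φ|`: the total number of occurrences of input variables. -/
def size : BoolFormula n → ℕ
  | var _ => 1
  | neg φ => φ.size
  | and φ ψ => φ.size + ψ.size
  | or φ ψ => φ.size + ψ.size

/-- A formula is monotone if it contains no negation. -/
def IsMonotone : BoolFormula n → Prop
  | var _ => True
  | neg _ => False
  | and φ ψ => φ.IsMonotone ∧ ψ.IsMonotone
  | or φ ψ => φ.IsMonotone ∧ ψ.IsMonotone

/-- The set `{x ∈ {0,1}ⁿ : φ(x) = 1}` defined by `φ`. -/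
def definedSet (φ : BoolFormula n) : Set (Fin n → Bool) := {x | φ.eval x = true}

/-- A formula written as a string over the alphabet `ℕ` in prefix (Polish) notation:
`0` stands for `∧`, `1` for `∨`, `2` for `¬`, and `i + 3` for the variable `xᵢ`. -/
def code : BoolFormula n → List ℕ
  | var i => [i.val + 3]
  | neg φ => 2 :: φ.code
  | and φ ψ => 0 :: (φ.code ++ ψ.code)
  | or φ ψ => 1 :: (φ.code ++ ψ.code)

end BoolFormula

/-- The set `{x ∈ {0,1}ⁿ : A x ≥ b}` for a matrix `A` and a vector `b` of nonnegative integers. -/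
def coveringSet {m n : ℕ} (A : Matrix (Fin m) (Fin n) ℕ) (b : Fin m → ℕ) :
    Set (Fin n → Bool) :=
  {x | ∀ i, b i ≤ A.mulVec (fun j => (x j).toNat) i}

/-- `φ` is a monotone formula that defines `{x ∈ {0,1}ⁿ : A x ≥ b}` and has size at most `B`. -/
def IsMonotoneFormulaFor {m n : ℕ} (A : Matrix (Fin m) (Fin n) ℕ) (b : Fin m → ℕ) (B : ℝ)
    (φ : BoolFormula n) : Prop :=
  φ.IsMonotone ∧ φ.definedSet = coveringSet A b ∧ (φ.size : ℝ) ≤ B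

/-- Programs of a probabilistic random access machine. The machine has registers `R 0, R 1, …`
(a program mentions only finitely many), a memory `M 0, M 1, …`, both with entries in `ℕ`,
a tape of random bits, and a write-only output tape. There is no multiplication, so in one step
the largest number stored at most doubles, and with unit cost per
step the model is polynomially equivalent to probabilistic Turing machines. -/
inductive RamProg : Type
  /-- do nothing -/
  | skip : RamProg
  /-- `R d := c` -/
  | const (d c : ℕ) : RamProg
  /-- `R d := R a + R b` -/
  | add (d a b : ℕ) : RamProg
  /-- `R d := max (R a - R b) 0` -/
  | sub (d a b : ℕ) : RamProg
  /-- `R d := M (R a)` -/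
  | load (d a : ℕ) : RamProg
  /-- `M (R a) := R c` -/
  | store (a c : ℕ) : RamProg
  /-- `R d :=` a fresh random bit -/
  | coin (d : ℕ) : RamProg
  /-- append `R a` to the output -/
  | write (a : ℕ) : RamProg
  /-- first `P`, then `Q` -/
  | seq (P Q : RamProg) : RamProg
  /-- if `R a < R b` then `P` else `Q` -/
  | ite (a b : ℕ) (P Q : RamProg) : RamProg
  /-- while `R a < R b` do `P` -/
  | loop (a b : ℕ) (P : RamProg) : RamProg

/-- Configurations of the machine. -/
structure RamState where
  /-- the registers -/
  reg : ℕ → ℕ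
  /-- the memory -/
  mem : ℕ → ℕ
  /-- the number of random bits used so far -/
  pos : ℕ
  /-- the output written so far -/
  out : List ℕ

namespace RamState

/-- `R d := v`. -/
def setReg (s : RamState) (d v : ℕ) : RamState := { s with reg := Function.update s.reg d v }

/-- `M a := v`. -/
def setMem (s : RamState) (a v : ℕ) : RamState := { s with mem := Function.update s.mem a v }

/-- The initial configuration on input `(A, b)`: `R 0 = m`, `R 1 = n`, and all other registers are
`0`; the memory holds the entries of `A`, row by row, then those of `b`, then zeros. -/
def init {m n : ℕ} (A : Matrix (Fin m) (Fin n) ℕ) (b : Fin m → ℕ) : RamState where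
  reg := fun k => if k = 0 then m else if k = 1 then n else 0
  mem := fun k =>
    ((List.ofFn fun i => List.ofFn fun j => A i j).flatten ++ List.ofFn b).getD k 0
  pos := 0
  out := []

end RamState

namespace RamProg

/-- `Exec ω P s s' t`: with the random bits `ω 0, ω 1, …`, the program `P`, started in the
configuration `s`, halts in the configuration `s'` after exactly `t` steps. Every elementary
instruction and every evaluation of the test of `ite` or `loop` is one step. -/
inductive Exec (ω : ℕ → Bool) : RamProg → RamState → RamState → ℕ → Prop
  | skip (s : RamState) : Exec ω skip s s 1
  | const (d c : ℕ) (s : RamState) : Exec ω (const d c) s (s.setReg d c) 1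
  | add (d a b : ℕ) (s : RamState) :
      Exec ω (add d a b) s (s.setReg d (s.reg a + s.reg b)) 1
  | sub (d a b : ℕ) (s : RamState) :
      Exec ω (sub d a b) s (s.setReg d (s.reg a - s.reg b)) 1
  | load (d a : ℕ) (s : RamState) : Exec ω (load d a) s (s.setReg d (s.mem (s.reg a))) 1
  | store (a c : ℕ) (s : RamState) : Exec ω (store a c) s (s.setMem (s.reg a) (s.reg c)) 1
  | coin (d : ℕ) (s : RamState) :
      Exec ω (coin d) s { s.setReg d (ω s.pos).toNat with pos := s.pos + 1 } 1
  | write (a : ℕ) (s : RamState) : Exec ω (write a) s { s with out := s.out ++ [s.reg a] } 1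
  | seq (P Q : RamProg) (s s₁ s₂ : RamState) (t₁ t₂ : ℕ) :
      Exec ω P s s₁ t₁ → Exec ω Q s₁ s₂ t₂ → Exec ω (seq P Q) s s₂ (t₁ + t₂)
  | ite_true (a b : ℕ) (P Q : RamProg) (s s₁ : RamState) (t : ℕ) :
      s.reg a < s.reg b → Exec ω P s s₁ t → Exec ω (ite a b P Q) s s₁ (t + 1)
  | ite_false (a b : ℕ) (P Q : RamProg) (s s₁ : RamState) (t : ℕ) :
      ¬ s.reg a < s.reg b → Exec ω Q s s₁ t → Exec ω (ite a b P Q) s s₁ (t + 1)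
  | loop_stop (a b : ℕ) (P : RamProg) (s : RamState) :
      ¬ s.reg a < s.reg b → Exec ω (loop a b P) s s 1
  | loop_step (a b : ℕ) (P : RamProg) (s s₁ s₂ : RamState) (t₁ t₂ : ℕ) :
      s.reg a < s.reg b → Exec ω P s s₁ t₁ → Exec ω (loop a b P) s₁ s₂ t₂ →
      Exec ω (loop a b P) s s₂ (t₁ + t₂ + 1)

/-- Whatever the random bits are, `P` started in `s` halts after at most `T` steps. -/
def HaltsWithin (P : RamProg) (s : RamState) (T : ℕ) : Prop :=
  ∀ ω : ℕ → Bool, ∃ (s' : RamState) (t : ℕ), Exec ω P s s' t ∧ t ≤ T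

/-- The tape that starts with the `T` bits `r`; a run of at most `T` steps reads no other bit. -/
def tape {T : ℕ} (r : Fin T → Bool) : ℕ → Bool := fun i => if h : i < T then r ⟨i, h⟩ else false

/-- The probability, over independent fair random bits, that `P` started in `s` halts after at most
`T` steps with an output in `good`. -/
noncomputable def successProb (P : RamProg) (s : RamState) (T : ℕ) (good : Set (List ℕ)) : ℝ :=
  ({r : Fin T → Bool | ∃ (s' : RamState) (t : ℕ),
    Exec (tape r) P s s' t ∧ t ≤ T ∧ s'.out ∈ good}.ncard : ℝ) / 2 ^ T

end RamProg

/-!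
Each row `a · x ≥ k` is handled by Valiant's probabilistic amplification, in the form that Boppana
found for threshold functions with a small threshold.

A *group* is a disjunction of variables in which `x j` occurs if one of `2 * a j` independent
draws succeeds. At a point of weight `w = a · x` it is false with probability exactly `h ^ (2 * w)`,
where `h` is the probability that a draw fails. If `h` is the largest available dyadic number with
`h ^ (2 * k - 1) ≤ β`, where `β = (√5 - 1) / 2`, then the weights `≥ k` give a probability
`≤ β - 1 / (12 * Δ)` and the weights `< k` a probability `≥ β + 1 / (12 * Δ)`
(`missRatio_pow_le_sub`, `add_le_missRatio_pow`). A conjunction of two disjunctions of two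
independent copies changes a failure probability `x` into `amp x = 1 - (1 - x ^ 2) ^ 2`, and `β` is
an unstable fixed point of `amp` with derivative `4 * β ^ 2 > 32 / 21`. Hence about
`log Δ / log (32 / 21)` double levels bring the gap to a constant, a constant number brings the
probability near `0` or `1`, and from there on every double level squares the error
(`treeMiss_le`, `one_sub_treeMiss_le`). An error below `(n * Δ) ^ (-O(Δ))` suffices for a union
bound over the minimal and maximal points of all thresholds `k ≤ Δ` (`prob_goodTable`). Each double
level costs a factor of four, and `4 ≤ (32 / 21) ^ 3.295` (`four_le_rpow`), so a tree has
`O(Δ ^ (3.295 + 2) * log (n * Δ) ^ 2)` groups of `O(n)` variables. The remaining factor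
`Δ ^ 0.005` absorbs `log Δ ^ 2`, and the constants disappear in a power of `log (n + 1) ≥ 3 / 2`
(`exists_size_bound`); for `n = 1` the formula `x` is used.

The union bound must not depend on the number of rows, so all rows share one table of random
numbers; its goodness is a statement about thresholds on `n * 2 * Δ` points only (`GoodTable`).
A group may be empty, while constants are not allowed: every group contains the conjunction
of all variables as a further disjunct. It matters only at the all-ones point, which lies in the
covering set as soon as this set is non-empty.

The program `RamProg.coveringProg` computes the parameters, fills the table, finds for every row
the threshold that defines `h` by exact integer arithmetic, and prints the tree with the help
of a stack. Its behaviour is derived in a small time-bounded Hoare calculus (`RamProg.Runs`).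
Existence of the formula follows, since an event of positive probability is not empty.
-/

/-! ### Time-bounded Hoare calculus for the random access machine -/

namespace RamState

@[simp] theorem reg_setReg (s : RamState) (d v r : ℕ) :
    (s.setReg d v).reg r = if r = d then v else s.reg r := by
  simp [setReg, Function.update_apply]

@[simp] theorem mem_setReg (s : RamState) (d v : ℕ) : (s.setReg d v).mem = s.mem := rfl

@[simp] theorem pos_setReg (s : RamState) (d v : ℕ) : (s.setReg d v).pos = s.pos := rfl

@[simp] theorem out_setReg (s : RamState) (d v : ℕ) : (s.setReg d v).out = s.out := rfl

@[simp] theorem reg_setMem (s : RamState) (a v : ℕ) : (s.setMem a v).reg = s.reg := rfl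

@[simp] theorem mem_setMem (s : RamState) (a v r : ℕ) :
    (s.setMem a v).mem r = if r = a then v else s.mem r := by
  simp [setMem, Function.update_apply]

@[simp] theorem pos_setMem (s : RamState) (d v : ℕ) : (s.setMem d v).pos = s.pos := rfl

@[simp] theorem out_setMem (s : RamState) (d v : ℕ) : (s.setMem d v).out = s.out := rfl

end RamState

namespace RamProg

infixr:60 " ;; " => RamProg.seq

/-- The total-correctness judgement: on the tape `ω`, the program `P` started in `s` halts after
at most `T` steps in a configuration that satisfies `R`. -/
def Runs (ω : ℕ → Bool) (P : RamProg) (s : RamState) (T : ℕ) (R : RamState → Prop) : Prop :=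
  ∃ (s' : RamState) (t : ℕ), Exec ω P s s' t ∧ t ≤ T ∧ R s'

variable {ω : ℕ → Bool} {P Q : RamProg} {s : RamState} {T T' T₁ T₂ : ℕ}
  {R R' : RamState → Prop} {a b c d : ℕ}

theorem Runs.mono (h : Runs ω P s T R) (hT : T ≤ T') (hR : ∀ s', R s' → R' s') :
    Runs ω P s T' R' := by
  obtain ⟨s', t, h1, h2, h3⟩ := h
  exact ⟨s', t, h1, h2.trans hT, hR _ h3⟩

theorem Runs.time_le (h : Runs ω P s T R) (hT : T ≤ T') : Runs ω P s T' R :=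
  h.mono hT fun _ h => h

theorem Runs.seq (h : Runs ω P s T₁ R) (h' : ∀ s', R s' → Runs ω Q s' T₂ R') :
    Runs ω (P ;; Q) s (T₁ + T₂) R' := by
  obtain ⟨s₁, t₁, h1, h2, h3⟩ := h
  obtain ⟨s₂, t₂, g1, g2, g3⟩ := h' _ h3
  exact ⟨s₂, _, .seq _ _ _ _ _ _ _ h1 g1, by omega, g3⟩

theorem runs_skip (h : R s) : Runs ω skip s 1 R := ⟨_, _, .skip s, le_rfl, h⟩

theorem runs_const (h : R (s.setReg d c)) : Runs ω (const d c) s 1 R :=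
  ⟨_, _, .const d c s, le_rfl, h⟩

theorem runs_add (h : R (s.setReg d (s.reg a + s.reg b))) : Runs ω (add d a b) s 1 R :=
  ⟨_, _, .add d a b s, le_rfl, h⟩

theorem runs_sub (h : R (s.setReg d (s.reg a - s.reg b))) : Runs ω (sub d a b) s 1 R :=
  ⟨_, _, .sub d a b s, le_rfl, h⟩

theorem runs_load (h : R (s.setReg d (s.mem (s.reg a)))) : Runs ω (load d a) s 1 R :=
  ⟨_, _, .load d a s, le_rfl, h⟩

theorem runs_store (h : R (s.setMem (s.reg a) (s.reg c))) : Runs ω (store a c) s 1 R :=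
  ⟨_, _, .store a c s, le_rfl, h⟩

theorem runs_coin (h : R { s.setReg d (ω s.pos).toNat with pos := s.pos + 1 }) :
    Runs ω (coin d) s 1 R :=
  ⟨_, _, .coin d s, le_rfl, h⟩

theorem runs_write (h : R { s with out := s.out ++ [s.reg a] }) : Runs ω (write a) s 1 R :=
  ⟨_, _, .write a s, le_rfl, h⟩

theorem runs_const_seq (h : Runs ω Q (s.setReg d c) T R) :
    Runs ω (const d c ;; Q) s (T + 1) R :=
  ((runs_const (R := fun s' => Runs ω Q s' T R) h).seq fun _ h => h).time_le (by omega)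

theorem runs_add_seq (h : Runs ω Q (s.setReg d (s.reg a + s.reg b)) T R) :
    Runs ω (add d a b ;; Q) s (T + 1) R :=
  ((runs_add (R := fun s' => Runs ω Q s' T R) h).seq fun _ h => h).time_le (by omega)

theorem runs_sub_seq (h : Runs ω Q (s.setReg d (s.reg a - s.reg b)) T R) :
    Runs ω (sub d a b ;; Q) s (T + 1) R :=
  ((runs_sub (R := fun s' => Runs ω Q s' T R) h).seq fun _ h => h).time_le (by omega)

theorem runs_load_seq (h : Runs ω Q (s.setReg d (s.mem (s.reg a))) T R) :
    Runs ω (load d a ;; Q) s (T + 1) R :=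
  ((runs_load (R := fun s' => Runs ω Q s' T R) h).seq fun _ h => h).time_le (by omega)

theorem runs_store_seq (h : Runs ω Q (s.setMem (s.reg a) (s.reg c)) T R) :
    Runs ω (store a c ;; Q) s (T + 1) R :=
  ((runs_store (R := fun s' => Runs ω Q s' T R) h).seq fun _ h => h).time_le (by omega)

theorem runs_coin_seq
    (h : Runs ω Q { s.setReg d (ω s.pos).toNat with pos := s.pos + 1 } T R) :
    Runs ω (coin d ;; Q) s (T + 1) R :=
  ((runs_coin (R := fun s' => Runs ω Q s' T R) h).seq fun _ h => h).time_le (by omega)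

theorem runs_write_seq (h : Runs ω Q { s with out := s.out ++ [s.reg a] } T R) :
    Runs ω (write a ;; Q) s (T + 1) R :=
  ((runs_write (R := fun s' => Runs ω Q s' T R) h).seq fun _ h => h).time_le (by omega)

theorem runs_ite (ht : s.reg a < s.reg b → Runs ω P s T R)
    (hf : ¬ s.reg a < s.reg b → Runs ω Q s T R) : Runs ω (ite a b P Q) s (T + 1) R := by
  by_cases h : s.reg a < s.reg b
  · obtain ⟨s', t, h1, h2, h3⟩ := ht h
    exact ⟨s', _, .ite_true _ _ _ _ _ _ _ h h1, by omega, h3⟩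
  · obtain ⟨s', t, h1, h2, h3⟩ := hf h
    exact ⟨s', _, .ite_false _ _ _ _ _ _ _ h h1, by omega, h3⟩

theorem runs_loop_stop (h : ¬ s.reg a < s.reg b) (hR : R s) : Runs ω (loop a b P) s 1 R :=
  ⟨s, 1, Exec.loop_stop _ _ _ _ h, le_rfl, hR⟩

theorem runs_loop_step (h : s.reg a < s.reg b)
    (hP : Runs ω P s T₁ fun s' => Runs ω (loop a b P) s' T₂ R) :
    Runs ω (loop a b P) s (T₁ + 1 + T₂) R := by
  obtain ⟨s₁, t₁, h1, h2, s₂, t₂, g1, g2, g3⟩ := hP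
  exact ⟨s₂, _, .loop_step _ _ _ _ _ _ _ _ h h1 g1, by omega, g3⟩

/-- A loop that makes exactly `N` rounds, with an invariant indexed by the number of rounds. -/
theorem runs_loop (I : ℕ → RamState → Prop) (N T : ℕ)
    (hstep : ∀ i s, i < N → I i s → s.reg a < s.reg b ∧ Runs ω P s T (I (i + 1)))
    (hend : ∀ s, I N s → ¬ s.reg a < s.reg b) (h0 : I 0 s) :
    Runs ω (loop a b P) s (N * (T + 1) + 1) (I N) := by
  suffices H : ∀ k i s, i + k = N → I i s →
      Runs ω (loop a b P) s (k * (T + 1) + 1) (I N) from H N 0 s (by omega) h0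
  intro k
  induction k with
  | zero =>
    intro i s hi h
    obtain rfl : i = N := by omega
    simpa using runs_loop_stop (hend s h) h
  | succ k ih =>
    intro i s hi h
    obtain ⟨hlt, hrun⟩ := hstep i s (by omega) h
    refine (runs_loop_step hlt (hrun.mono le_rfl fun s' h' => ih (i + 1) s' (by omega) h')).time_le
      (by rw [Nat.succ_mul]; omega)

/-- `R c := R c * (R a) ^ (R e)`, by repeated addition. -/
def mulPow (c a e : ℕ) : RamProg :=
  const 30 0 ;; loop 30 e (const 31 0 ;; const 32 0 ;;
    loop 32 a (add 31 31 c ;; add 32 32 2) ;; add c 31 10 ;; add 30 30 2)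

theorem runs_mulPow {c a e : ℕ} (hc : c < 30) (ha : a < 30) (he : e < 30) (hca : c ≠ a)
    (hce : c ≠ e) (hc2 : c ≠ 2) (hc10 : c ≠ 10) (h2 : s.reg 2 = 1) (h10 : s.reg 10 = 0) :
    Runs ω (mulPow c a e) s (s.reg e * (s.reg a * 3 + 6) + 2) (fun s' =>
      s'.reg c = s.reg c * s.reg a ^ s.reg e ∧ (∀ r < 30, r ≠ c → s'.reg r = s.reg r) ∧
      s'.mem = s.mem ∧ s'.pos = s.pos ∧ s'.out = s.out) := by
  unfold mulPow
  refine (runs_const_seq ((runs_loop (fun i s' => s'.reg 30 = i ∧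
      s'.reg c = s.reg c * s.reg a ^ i ∧ (∀ r < 30, r ≠ c → s'.reg r = s.reg r) ∧
      s'.mem = s.mem ∧ s'.pos = s.pos ∧ s'.out = s.out) (s.reg e) (s.reg a * 3 + 5) ?_ ?_
      ?_).mono le_rfl ?_)).time_le (Nat.le_of_eq (by ring))
  · rintro i s₁ hi ⟨h30, hv, hf, hm, hp, ho⟩
    refine ⟨by rw [h30, hf e he hce.symm]; exact hi, ?_⟩
    refine Runs.time_le (runs_const_seq (runs_const_seq ((runs_loop (fun j s' =>
      s'.reg 32 = j ∧ s'.reg 31 = j * s₁.reg c ∧ (∀ r < 31, s'.reg r = s₁.reg r) ∧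
      s'.mem = s.mem ∧ s'.pos = s.pos ∧ s'.out = s.out) (s.reg a) 2 ?_ ?_
      ?_).seq fun s₂ hs => runs_add_seq (runs_add ?_)))) ?_
    · rintro j s₂ hj ⟨g32, g31, gf, gm, gp, go⟩
      refine ⟨by rw [g32, gf a (by omega), hf a ha hca.symm]; exact hj, ?_⟩
      refine runs_add_seq (runs_add ?_)
      have := gf c (by omega)
      have h2' := gf 2 (by omega)
      have h2'' := hf 2 (by omega) hc2.symm
      have : c ≠ 31 := by omega
      refine ⟨?_, ?_, ?_, ?_⟩ <;> simp [*, Nat.succ_mul]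
      grind
    · rintro s₂ ⟨g32, g31, gf, gm, gp, go⟩
      rw [g32, gf a (by omega), hf a ha hca.symm]; simp
    · simp [*]; grind
    · obtain ⟨g32, g31, gf, gm, gp, go⟩ := hs
      have : c ≠ 30 := by omega
      have e1 := gf 30 (by omega)
      have h2' := gf 2 (by omega)
      have h2'' := hf 2 (by omega) hc2.symm
      have h10' := gf 10 (by omega)
      have h10'' := hf 10 (by omega) hc10.symm
      refine ⟨?_, ?_, ?_, ?_⟩ 
      · simp [*]; grind
      · simp [*, pow_succ]; ring
      · simp [*]; grind
      · simp [*]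
    · omega
  · rintro s₁ ⟨h30, hv, hf, hm, hp, ho⟩
    rw [h30, hf e he hce.symm]; simp
  · simp; grind
  · tauto

end RamProg

/-! ### Printing the formula of one row -/

/-- Whether one of the first `min w W` table entries from position `p` on is below `τ`. -/
def hit (U : ℕ → ℕ) (τ w W p : ℕ) : Prop := ∃ t < W, U (p + t) < τ ∧ t < w

instance (U : ℕ → ℕ) (τ w W p : ℕ) : Decidable (hit U τ w W p) := by
  unfold hit; infer_instance

/-- The code of a group: the disjunction of the variables that are hit and of the conjunction
of all variables. -/
def groupCode (U : ℕ → ℕ) (row : ℕ → ℕ) (n τ W p : ℕ) : List ℕ :=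
  ((List.range n).flatMap fun j => if hit U τ (2 * row j) W (p + j * W) then [1, j + 3] else []) ++
    (((List.range n).flatMap fun j => [0, j + 3]) ++ [3])

/-- The code of the complete binary tree of height `ℓ` with leaves `g, …, g + 2 ^ ℓ - 1`, whose
odd levels are disjunctions and whose even levels are conjunctions. -/
def treeCode (leaf : ℕ → List ℕ) : ℕ → ℕ → List ℕ
  | 0, g => leaf g
  | ℓ + 1, g => (ℓ + 1) % 2 :: (treeCode leaf ℓ g ++ treeCode leaf ℓ (g + 2 ^ ℓ))

namespace RamProg

variable {ω : ℕ → Bool}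

/-- Sets `R 24` to `1` if variable number `R 21 - 3` is hit, and advances the table pointer. -/
def scanHits : RamProg :=
  load 22 20 ;; add 22 22 22 ;; const 23 0 ;; const 24 0 ;;
    loop 23 7 (load 25 17 ;; ite 25 16 (ite 23 22 (const 24 1) skip) skip ;;
      add 17 17 2 ;; add 23 23 2)

/-- Prints the group that is drawn by the table entries from address `R 17` on, and advances this
pointer. The row starts at address `R 12`, and `R 16` is the threshold. -/
def writeGroup : RamProg :=
  add 20 12 10 ;; const 21 3 ;;
  loop 21 11 (scanHits ;; ite 10 24 (write 2 ;; write 21) skip ;; add 20 20 2 ;; add 21 21 2) ;;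
  const 21 3 ;; loop 21 11 (write 10 ;; write 21 ;; add 21 21 2) ;; const 25 3 ;; write 25

theorem runs_scanHits {s : RamState} {W p : ℕ} (h2 : s.reg 2 = 1) (hW : s.reg 7 = W)
    (hp : s.reg 17 = p) :
    Runs ω scanHits s (W * 7 + 5) (fun s' =>
      s'.reg 24 = (if hit s.mem (s.reg 16) (2 * s.mem (s.reg 20)) W p then 1 else 0) ∧
      s'.reg 17 = p + W ∧ (∀ r < 22, r ≠ 17 → s'.reg r = s.reg r) ∧
      s'.mem = s.mem ∧ s'.pos = s.pos ∧ s'.out = s.out) := by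
  unfold scanHits
  refine Runs.time_le (runs_load_seq (runs_add_seq (runs_const_seq (runs_const_seq ((runs_loop
    (fun i s' => s'.reg 22 = 2 * s.mem (s.reg 20) ∧ s'.reg 23 = i ∧
      s'.reg 24 = (if hit s.mem (s.reg 16) (2 * s.mem (s.reg 20)) i p then 1 else 0) ∧
      s'.reg 17 = p + i ∧ (∀ r < 22, r ≠ 17 → s'.reg r = s.reg r) ∧
      s'.mem = s.mem ∧ s'.pos = s.pos ∧ s'.out = s.out) W 6 ?_ ?_ ?_).mono le_rfl ?_))))) ?_
  · rintro i s₁ hi ⟨h22, h23, h24, h17, hf, hm, hp, ho⟩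
    have e7 := hf 7 (by norm_num) (by norm_num)
    have e2 := hf 2 (by norm_num) (by norm_num)
    have e16 := hf 16 (by norm_num) (by norm_num)
    have key : hit s.mem (s.reg 16) (2 * s.mem (s.reg 20)) (i + 1) p ↔
        hit s.mem (s.reg 16) (2 * s.mem (s.reg 20)) i p ∨
          (s.mem (p + i) < s.reg 16 ∧ i < 2 * s.mem (s.reg 20)) := by
      unfold hit
      simp only [Nat.exists_lt_succ_right]
    refine ⟨by omega, ?_⟩
    refine Runs.time_le (runs_load_seq (Runs.seq (T₁ := 3) (T₂ := 2) (R := fun s' => s'.reg 24 =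
      (if hit s.mem (s.reg 16) (2 * s.mem (s.reg 20)) (i + 1) p then 1 else 0) ∧
      (∀ r < 25, r ≠ 24 → s'.reg r = s₁.reg r) ∧
      s'.mem = s.mem ∧ s'.pos = s.pos ∧ s'.out = s.out) (runs_ite (fun hlt => runs_ite
        (fun hlt2 => runs_const ?_) fun hlt2 => runs_skip ?_)
        fun hlt => Runs.time_le (runs_skip ?_) (by norm_num : 1 ≤ 2)) ?_))
      (by norm_num : 5 + 1 ≤ 6)
    · simp [*] at hlt hlt2 ⊢
      grind
    · simp [*] at hlt hlt2 ⊢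
      grind
    · simp [*] at hlt ⊢
      grind
    · rintro s₂ ⟨g24, gf, gm, gp, go⟩
      refine runs_add_seq (runs_add ?_)
      simp [*]
      grind
  · rintro s₁ ⟨h22, h23, h24, h17, hf, hm, hp, ho⟩
    have e7 := hf 7 (by norm_num) (by norm_num)
    omega
  · simp [*, two_mul, hit]
    grind
  · tauto
  · omega

theorem runs_writeGroup {s : RamState} {W n p : ℕ} (h2 : s.reg 2 = 1) (hW : s.reg 7 = W)
    (h10 : s.reg 10 = 0) (h11 : s.reg 11 = n + 3) (hp : s.reg 17 = p) :
    Runs ω writeGroup s (n * (W * 7 + 15) + 7) (fun s' =>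
      s'.reg 17 = p + n * W ∧ (∀ r < 20, r ≠ 17 → s'.reg r = s.reg r) ∧
      s'.mem = s.mem ∧ s'.pos = s.pos ∧
      s'.out = s.out ++
        groupCode s.mem (fun j => s.mem (s.reg 12 + j)) n (s.reg 16) W p) := by
  unfold writeGroup
  refine Runs.time_le (runs_add_seq (runs_const_seq ((runs_loop
    (fun i s' => s'.reg 21 = i + 3 ∧ s'.reg 20 = s.reg 12 + i ∧
      s'.reg 17 = p + i * W ∧ (∀ r < 20, r ≠ 17 → s'.reg r = s.reg r) ∧
      s'.mem = s.mem ∧ s'.pos = s.pos ∧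
      s'.out = s.out ++ (List.range i).flatMap fun j =>
        if hit s.mem (s.reg 16) (2 * s.mem (s.reg 12 + j)) W (p + j * W) then [1, j + 3] else [])
      n (W * 7 + 10) ?_ ?_ ?_).seq fun s₁ hs => runs_const_seq ((runs_loop
      (fun i s' => s'.reg 21 = i + 3 ∧
      s'.reg 17 = p + n * W ∧ (∀ r < 20, r ≠ 17 → s'.reg r = s.reg r) ∧
      s'.mem = s.mem ∧ s'.pos = s.pos ∧
      s'.out = s.out ++ (((List.range n).flatMap fun j =>
        if hit s.mem (s.reg 16) (2 * s.mem (s.reg 12 + j)) W (p + j * W) then [1, j + 3] else [])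
         ++ (List.range i).flatMap fun j => [0, j + 3]))
      n 3 ?_ ?_ ?_).seq fun s₂ hs₂ => runs_const_seq (runs_write ?_))))) ?_
  · rintro i s₁ hi ⟨h21, h20, h17, hf, hm, hp, ho⟩
    have e7 := hf 7 (by norm_num) (by norm_num)
    have e2 := hf 2 (by norm_num) (by norm_num)
    have e10 := hf 10 (by norm_num) (by norm_num)
    have e11 := hf 11 (by norm_num) (by norm_num)
    have e16 := hf 16 (by norm_num) (by norm_num)
    refine ⟨by omega, ?_⟩
    refine Runs.time_le ((runs_scanHits (W := W) (p := p + i * W) (by omega) (by omega)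
      (by omega)).seq (T₂ := 5) ?_) (by omega)
    rintro s₂ ⟨g24, g17, gf, gm, gp, go⟩
    have i21 := gf 21 (by norm_num) (by norm_num)
    have i2 := gf 2 (by norm_num) (by norm_num)
    have i10 := gf 10 (by norm_num) (by norm_num)
    have i20 := gf 20 (by norm_num) (by norm_num)
    refine Runs.seq (T₁ := 3) (T₂ := 2) (R := fun s' => (∀ r, s'.reg r = s₂.reg r) ∧
      s'.mem = s.mem ∧ s'.pos = s.pos ∧
      s'.out = s.out ++ (List.range (i + 1)).flatMap fun j =>
        if hit s.mem (s.reg 16) (2 * s.mem (s.reg 12 + j)) W (p + j * W) then [1, j + 3] else [])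
      (runs_ite (T := 2) (fun hlt => runs_write_seq (runs_write ?_))
        fun hlt => (runs_skip ?_).time_le (by norm_num)) fun s₃ hs₃ => ?_
    · have : hit s.mem (s.reg 16) (2 * s.mem (s.reg 12 + i)) W (p + i * W) := by
        by_contra hc
        simp [*] at hlt
      simp [*, List.range_succ]
    · have : ¬ hit s.mem (s.reg 16) (2 * s.mem (s.reg 12 + i)) W (p + i * W) := by
        intro hc
        simp [*] at hlt
      simp [*, List.range_succ]
    · obtain ⟨kf, km, kp, ko⟩ := hs₃
      refine runs_add_seq (runs_add ?_)
      simp [*, Nat.succ_mul]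
      grind
  · rintro s₁ ⟨h21, h20, h17, hf, hm, hp, ho⟩
    have e11 := hf 11 (by norm_num) (by norm_num)
    omega
  · simp [*]
    grind
  · rintro i s₂ hi ⟨h21, h17, hf, hm, hp, ho⟩
    have e2 := hf 2 (by norm_num) (by norm_num)
    have e10 := hf 10 (by norm_num) (by norm_num)
    have e11 := hf 11 (by norm_num) (by norm_num)
    refine ⟨by omega, runs_write_seq (runs_write_seq (runs_add ?_))⟩
    simp [*, List.range_succ]
    grind
  · rintro s₁ ⟨h21, h17, hf, hm, hp, ho⟩
    have e11 := hf 11 (by norm_num) (by norm_num)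
    omega
  · obtain ⟨h21, h20, h17, hf, hm, hp, ho⟩ := hs
    simp [*]
    grind
  · obtain ⟨h21, h17, hf, hm, hp, ho⟩ := hs₂
    simp [*, groupCode]
    grind
  · rw [show W * 7 + 10 + 1 = (W * 7 + 15) - 4 by omega, Nat.mul_sub]
    have : n * 4 ≤ n * (W * 7 + 15) := Nat.mul_le_mul le_rfl (by omega)
    omega

end RamProg

namespace RamProg

variable {ω : ℕ → Bool}

/-- Pops the level `ℓ` of the next subtree from the stack; a leaf is printed, an inner node prints
its connective and pushes its two children. -/
def treeStep : RamProg :=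
  sub 18 18 2 ;; load 19 18 ;;
    ite 10 19
      (add 20 19 10 ;; loop 2 20 (sub 20 20 2 ;; sub 20 20 2) ;; write 20 ;; sub 19 19 2 ;;
        store 18 19 ;; add 18 18 2 ;; store 18 19 ;; add 18 18 2)
      writeGroup

theorem runs_parity {s : RamState} (h2 : s.reg 2 = 1) :
    Runs ω (loop 2 20 (sub 20 20 2 ;; sub 20 20 2)) s (3 * s.reg 20 + 1) (fun s' =>
      s'.reg 20 = s.reg 20 % 2 ∧ (∀ r, r ≠ 20 → s'.reg r = s.reg r) ∧
      s'.mem = s.mem ∧ s'.pos = s.pos ∧ s'.out = s.out) := by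
  obtain ⟨q, hq⟩ : ∃ q, q = s.reg 20 / 2 := ⟨_, rfl⟩
  refine Runs.mono (runs_loop (fun i s' => s'.reg 20 + 2 * i = s.reg 20 ∧
    (∀ r, r ≠ 20 → s'.reg r = s.reg r) ∧
      s'.mem = s.mem ∧ s'.pos = s.pos ∧ s'.out = s.out) q 2 ?_ ?_ ?_) (by omega) ?_
  · rintro i s₁ hi ⟨h20, hf, hm, hp, ho⟩
    have e2 := hf 2 (by norm_num)
    refine ⟨by omega, runs_sub_seq (runs_sub ?_)⟩
    simp [*]
    grind
  · rintro s₁ ⟨h20, hf, hm, hp, ho⟩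
    have e2 := hf 2 (by norm_num)
    omega
  · simp
  · rintro s₁ ⟨h20, hf, hm, hp, ho⟩
    exact ⟨by omega, hf, hm, hp, ho⟩

/-- The register contents and the part of the memory on which the printing of a row depends: the
memory agrees with `M` below the stack base `S`. -/
structure RowEnv (M : ℕ → ℕ) (n W S row τ : ℕ) (s : RamState) : Prop where
  one : s.reg 2 = 1
  width : s.reg 7 = W
  base : s.reg 9 = S
  zero : s.reg 10 = 0
  vars : s.reg 11 = n + 3
  row : s.reg 12 = row
  thr : s.reg 16 = τ
  mem : ∀ x < S, s.mem x = M x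

theorem RowEnv.congr {M : ℕ → ℕ} {n W S row τ : ℕ} {s s' : RamState}
    (h : RowEnv M n W S row τ s) (hr : ∀ r < 17, s'.reg r = s.reg r)
    (hm : ∀ x < S, s'.mem x = s.mem x) : RowEnv M n W S row τ s' := by
  obtain ⟨h1, h2, h3, h4, h5, h6, h7, h8⟩ := h
  constructor <;> grind

theorem groupCode_congr {U U' row row' : ℕ → ℕ} {n τ W p : ℕ}
    (hU : ∀ x < p + n * W, U x = U' x) (hrow : ∀ j < n, row j = row' j) :
    groupCode U row n τ W p = groupCode U' row' n τ W p := by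
  unfold groupCode
  congr 1
  simp only [List.flatMap_def]
  congr 1
  refine List.map_congr_left fun j hj => ?_
  have hj : j < n := by simpa using hj
  have : hit U τ (2 * row j) W (p + j * W) ↔ hit U' τ (2 * row' j) W (p + j * W) := by
    unfold hit
    refine exists_congr fun t => and_congr_right fun ht => ?_
    rw [hrow j hj, hU]
    have : j * W + W ≤ n * W := by
      rw [← Nat.succ_mul]; exact Nat.mul_le_mul_right _ hj
    omega
  simp [this]

/-- Running the stack machine on a stack whose top entry is `ℓ` prints the tree of height `ℓ`,
and leaves the rest of the stack to the continuation. -/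
theorem runs_tree {M : ℕ → ℕ} {n W S row τ B D : ℕ} (hrow : row + n ≤ S)
    (hS : B + 2 ^ D * (n * W) ≤ S) {R : RamState → Prop} :
    ∀ (ℓ : ℕ) (s : RamState) (g σ T : ℕ), ℓ ≤ D → RowEnv M n W S row τ s → S ≤ σ →
      s.reg 18 = σ + 1 → s.mem σ = ℓ → s.reg 17 = B + g * (n * W) → g + 2 ^ ℓ ≤ 2 ^ D →
      (∀ s' : RamState, s'.reg 18 = σ → s'.reg 17 = B + (g + 2 ^ ℓ) * (n * W) →
        (∀ r < 17, s'.reg r = s.reg r) → (∀ x < σ, s'.mem x = s.mem x) → s'.pos = s.pos →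
        s'.out = s.out ++ treeCode (fun g => groupCode M (fun j => M (row + j)) n τ W
          (B + g * (n * W))) ℓ g → Runs ω (loop 9 18 treeStep) s' T R) →
      Runs ω (loop 9 18 treeStep) s
        (T + (2 ^ (ℓ + 1) - 1) * (n * (W * 7 + 15) + 3 * D + 12)) R := by
  intro ℓ
  induction ℓ with
  | zero =>
    intro s g σ T hℓ henv hσ h18 hmσ h17 hg hk
    refine Runs.time_le (runs_loop_step (T₁ := n * (W * 7 + 15) + 10) (T₂ := T)
      (by rw [henv.base]; omega) ?_) (by norm_num; omega)
    refine Runs.time_le (runs_sub_seq (runs_load_seq (runs_ite (T := n * (W * 7 + 15) + 7)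
      (fun hlt => ?_) fun hlt => ?_))) (le_refl _)
    · simp [henv.one, henv.zero, h18, hmσ] at hlt
    · refine (runs_writeGroup (W := W) (n := n) (p := B + g * (n * W)) (by simp [henv.one])
        (by simp [henv.width]) (by simp [henv.zero]) (by simp [henv.vars])
        (by simp [h17])).mono le_rfl ?_
      rintro s' ⟨g17, gf, gm, gp, go⟩
      have hle : B + g * (n * W) + n * W ≤ S := by
        refine le_trans ?_ hS
        have := Nat.mul_le_mul_right (n * W) hg
        rw [pow_zero, add_one_mul] at this
        omega
      refine hk s' ?_ ?_ ?_ ?_ ?_ ?_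
      · simp [gf 18, h18, henv.one]
      · simp [g17]; ring
      · intro r hr
        rw [gf r (by omega) (by omega)]
        simp; grind
      · simp [gm]
      · simp [gp]
      · simp only [treeCode, go]
        simp only [RamState.mem_setReg, RamState.out_setReg, RamState.reg_setReg]
        simp only [henv.row, henv.thr]
        norm_num [henv.row, henv.thr]
        exact groupCode_congr (fun x hx => henv.mem x (by omega))
          fun j hj => henv.mem _ (by omega)
  | succ ℓ ih =>
    intro s g σ T hℓ henv hσ h18 hmσ h17 hg hk
    have hpow : 2 ^ (ℓ + 1) = 2 ^ ℓ + 2 ^ ℓ := by rw [pow_succ]; omega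
    have hpos := Nat.one_le_two_pow (n := ℓ)
    obtain ⟨K, hK⟩ : ∃ K, K = n * (W * 7 + 15) + 3 * D + 12 := ⟨_, rfl⟩
    rw [← hK] at ih ⊢
    refine Runs.time_le (runs_loop_step (T₁ := 3 * D + 11)
      (T₂ := T + (2 ^ (ℓ + 1) - 1) * K + (2 ^ (ℓ + 1) - 1) * K)
      (by rw [henv.base]; omega) ?_) ?_
    swap
    · have : 2 ^ (ℓ + 1 + 1) - 1 = 1 + (2 ^ (ℓ + 1) - 1) + (2 ^ (ℓ + 1) - 1) := by
        rw [pow_succ 2 (ℓ + 1)]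
        have := Nat.one_le_two_pow (n := ℓ + 1)
        omega
      rw [this, add_mul, add_mul, one_mul]
      have : 3 * D + 12 ≤ K := by rw [hK]; omega
      omega
    refine Runs.time_le (T := 3 * (ℓ + 1) + 11) (runs_sub_seq (runs_load_seq (runs_ite
      (T := 3 * (ℓ + 1) + 8) (fun hlt => ?_) fun hlt => ?_))) (by omega)
    swap
    · simp [henv.one, henv.zero, h18, hmσ] at hlt
    refine runs_add_seq (Runs.seq (T₂ := 6) ((runs_parity ?_).time_le
      (T' := 3 * (ℓ + 1) + 1) ?_) ?_)
    · simp [henv.one]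
    · simp [henv.one, henv.zero, h18, hmσ]
    rintro s₁ ⟨h20, hf, hm, hp, ho⟩
    have e2 := hf 2 (by norm_num)
    have e18 := hf 18 (by norm_num)
    have e19 := hf 19 (by norm_num)
    have e17 := hf 17 (by norm_num)
    simp [henv.one, henv.zero, h18, hmσ] at h20 e2 e18 e19 e17 hm hp ho
    refine runs_write_seq (runs_sub_seq (runs_store_seq (runs_add_seq (runs_store_seq
      (runs_add ?_)))))
    simp [h20, e2, e18, e19, hm, hp, ho]
    refine ih _ g (σ + 1) _ (by omega) (henv.congr ?_ ?_) (by omega) ?_ ?_ ?_ (by omega) ?_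
    · intro r hr
      simp [show r ≠ 18 by omega, show r ≠ 19 by omega, hf r (by omega),
        show r ≠ 20 by omega]
    · intro x hx
      simp [show x ≠ σ by omega, show x ≠ σ + 1 by omega]
    · simp
    · simp
    · simp [e17, h17]
    intro s₂ h18' h17' hf' hm' hp' ho'
    refine ih s₂ (g + 2 ^ ℓ) σ _ (by omega) (henv.congr ?_ ?_) (by omega) ?_ ?_ ?_ (by omega) ?_
    · intro r hr
      rw [hf' r hr]
      simp [show r ≠ 18 by omega, show r ≠ 19 by omega, hf r (by omega),
        show r ≠ 20 by omega]
    · intro x hx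
      rw [hm' x (by omega)]
      simp [show x ≠ σ by omega, show x ≠ σ + 1 by omega]
    · exact h18'
    · rw [hm' _ (by omega)]; simp
    · rw [h17']
    intro s₃ h18'' h17'' hf'' hm'' hp'' ho''
    refine hk s₃ h18'' ?_ ?_ ?_ ?_ ?_
    · rw [h17'', hpow, add_assoc]
    · intro r hr
      rw [hf'' r hr, hf' r hr]
      simp [show r ≠ 18 by omega, show r ≠ 19 by omega, hf r (by omega),
        show r ≠ 20 by omega]
    · intro x hx
      rw [hm'' x hx, hm' x (by omega)]
      simp [show x ≠ σ by omega, show x ≠ σ + 1 by omega]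
    · rw [hp'', hp']; simp
    · rw [ho'', ho']; simp [treeCode]

end RamProg

/-! ### Searching the threshold, and printing all rows -/

/-- The least `τ` with `((Q - τ) / Q) ^ (2 * k - 1) ≤ (√5 - 1) / 2`. The condition is expressed
without division through `β * (β + 1) = 1`. -/
noncomputable def threshold (Q k : ℕ) : ℕ :=
  sInf {τ | ((Q - τ) ^ (2 * k - 1) + Q ^ (2 * k - 1)) * (Q - τ) ^ (2 * k - 1) ≤
    Q ^ (2 * k - 1) * Q ^ (2 * k - 1)}

theorem threshold_spec (Q : ℕ) {k : ℕ} (hk : 1 ≤ k) :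
    ((Q - threshold Q k) ^ (2 * k - 1) + Q ^ (2 * k - 1)) * (Q - threshold Q k) ^ (2 * k - 1) ≤
      Q ^ (2 * k - 1) * Q ^ (2 * k - 1) :=
  Nat.sInf_mem (s := {τ | ((Q - τ) ^ (2 * k - 1) + Q ^ (2 * k - 1)) * (Q - τ) ^ (2 * k - 1) ≤
    Q ^ (2 * k - 1) * Q ^ (2 * k - 1)}) ⟨Q, by simp [show 2 * k - 1 ≠ 0 by omega]⟩

theorem threshold_le (Q : ℕ) {k : ℕ} (hk : 1 ≤ k) : threshold Q k ≤ Q :=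
  Nat.sInf_le (by simp [show 2 * k - 1 ≠ 0 by omega])

namespace RamProg

variable {ω : ℕ → Bool}

/-- Stores `threshold Q k` in `R 16`. -/
def findThreshold : RamProg :=
  const 16 0 ;; const 17 0 ;;
    loop 17 2 (sub 18 6 16 ;; const 19 1 ;; const 20 1 ;; mulPow 19 18 15 ;; mulPow 20 6 15 ;;
      add 19 19 20 ;; mulPow 19 18 15 ;; mulPow 20 6 15 ;;
      ite 20 19 (add 16 16 2) (const 17 1))

theorem runs_findThreshold {s : RamState} {Q k : ℕ} (hk : 1 ≤ k) (h2 : s.reg 2 = 1)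
    (h6 : s.reg 6 = Q) (h10 : s.reg 10 = 0) (h15 : s.reg 15 = 2 * k - 1) :
    Runs ω findThreshold s ((Q + 1) * (4 * ((2 * k - 1) * (Q * 3 + 6)) + 15) + 3) (fun s' =>
      s'.reg 16 = threshold Q k ∧ (∀ r < 16, s'.reg r = s.reg r) ∧
      s'.mem = s.mem ∧ s'.pos = s.pos ∧ s'.out = s.out) := by
  unfold findThreshold
  have hτ := threshold_le Q hk
  refine Runs.time_le (runs_const_seq (runs_const_seq ((runs_loop
    (fun i s' => s'.reg 17 = (if i ≤ threshold Q k then 0 else 1) ∧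
      s'.reg 16 = min i (threshold Q k) ∧ (∀ r < 16, s'.reg r = s.reg r) ∧
      s'.mem = s.mem ∧ s'.pos = s.pos ∧ s'.out = s.out) (threshold Q k + 1)
      (4 * ((2 * k - 1) * (Q * 3 + 6)) + 14) ?_ ?_ ?_).mono le_rfl ?_))) ?_
  · rintro i s₁ hi ⟨h17, h16, hf, hm, hp, ho⟩
    have e2 := hf 2 (by norm_num)
    have e6 := hf 6 (by norm_num)
    have e10 := hf 10 (by norm_num)
    have e15 := hf 15 (by norm_num)
    rw [if_pos (by omega)] at h17
    rw [min_eq_left (by omega)] at h16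
    refine ⟨by omega, ?_⟩
    obtain ⟨c, hc⟩ : ∃ c, c = (2 * k - 1) * (Q * 3 + 6) + 2 := ⟨_, rfl⟩
    have hci : (2 * k - 1) * ((Q - i) * 3 + 6) + 2 ≤ c := by
      rw [hc]; gcongr; omega
    refine Runs.time_le (runs_sub_seq (runs_const_seq (runs_const_seq (Runs.seq
      (T₁ := c) (T₂ := c + c + c + 3)
      ((runs_mulPow (c := 19) (a := 18) (e := 15) ?_ ?_ ?_ ?_ ?_ ?_ ?_ ?_ ?_).time_le ?_)
      ?_)))) (by omega)
    any_goals norm_num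
    · omega
    · omega
    · simp [*]; rw [hc] at hci; omega
    simp only [e6, h6, h16, e15, h15]
    intro s₂ g19 gf gm gp go
    have f2 := gf 2 (by norm_num) (by norm_num)
    have f6 := gf 6 (by norm_num) (by norm_num)
    have f10 := gf 10 (by norm_num) (by norm_num)
    have f15 := gf 15 (by norm_num) (by norm_num)
    have f16 := gf 16 (by norm_num) (by norm_num)
    have f17 := gf 17 (by norm_num) (by norm_num)
    have f18 := gf 18 (by norm_num) (by norm_num)
    have f20 := gf 20 (by norm_num) (by norm_num)
    norm_num [h16, h17, e2, e6, e10, e15, h2, h6, h10, h15] at f2 f6 f10 f15 f16 f17 f18 f20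
    refine Runs.time_le (Runs.seq (T₁ := c) (T₂ := c + c + 3)
      ((runs_mulPow (c := 20) (a := 6) (e := 15) ?_ ?_ ?_ ?_ ?_ ?_ ?_ ?_ ?_).time_le ?_)
      ?_) (by omega)
    any_goals norm_num
    · omega
    · omega
    · rw [f6, f15, hc]
    simp only [f6, f15, f20]
    intro s₃ i20 jf jm jp jo
    have i2 := jf 2 (by norm_num) (by norm_num)
    have i6 := jf 6 (by norm_num) (by norm_num)
    have i10 := jf 10 (by norm_num) (by norm_num)
    have i15 := jf 15 (by norm_num) (by norm_num)
    have i16 := jf 16 (by norm_num) (by norm_num)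
    have i17 := jf 17 (by norm_num) (by norm_num)
    have i18 := jf 18 (by norm_num) (by norm_num)
    have i19 := jf 19 (by norm_num) (by norm_num)
    refine Runs.time_le (runs_add_seq (Runs.seq (T₁ := c) (T₂ := c + 2)
      ((runs_mulPow (c := 19) (a := 18) (e := 15) ?_ ?_ ?_ ?_ ?_ ?_ ?_ ?_ ?_).time_le ?_)
      ?_)) (by omega)
    any_goals norm_num
    · omega
    · omega
    · rw [i18, f18, i15, f15]; exact hci
    simp only [i19, i20, g19, i18, f18, i15, f15]
    intro s₄ j19 kf km kp ko
    have j2 := kf 2 (by norm_num) (by norm_num)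
    have j6 := kf 6 (by norm_num) (by norm_num)
    have j10 := kf 10 (by norm_num) (by norm_num)
    have j15 := kf 15 (by norm_num) (by norm_num)
    have j16 := kf 16 (by norm_num) (by norm_num)
    have j17 := kf 17 (by norm_num) (by norm_num)
    have j20 := kf 20 (by norm_num) (by norm_num)
    norm_num at j2 j6 j10 j15 j16 j17 j20
    refine Runs.time_le (Runs.seq (T₁ := c) (T₂ := 2)
      ((runs_mulPow (c := 20) (a := 6) (e := 15) ?_ ?_ ?_ ?_ ?_ ?_ ?_ ?_ ?_).time_le ?_)
      ?_) (by omega)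
    any_goals norm_num
    · omega
    · omega
    · rw [j6, i6, f6, j15, i15, f15, hc]
    simp only [j20, i20, j6, i6, f6, j15, i15, f15]
    intro s₅ k20 lf lm lp lo
    have k2 := lf 2 (by norm_num) (by norm_num)
    have k16 := lf 16 (by norm_num) (by norm_num)
    have k17 := lf 17 (by norm_num) (by norm_num)
    have k19 := lf 19 (by norm_num) (by norm_num)
    have hframe : ∀ r < 16, s₅.reg r = s.reg r := by
      intro r hr
      rw [lf r (by omega) (by omega), kf r (by omega) (by omega)]
      simp only [show r ≠ 19 by omega, if_false]
      rw [jf r (by omega) (by omega), gf r (by omega) (by omega)]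
      simp [show r ≠ 19 by omega, show r ≠ 18 by omega, show r ≠ 20 by omega, hf r hr]
    have hmem : s₅.mem = s.mem := by rw [lm, km, jm, gm, hm]
    have hpos : s₅.pos = s.pos := by rw [lp, kp, jp, gp, hp]
    have hout : s₅.out = s.out := by rw [lo, ko, jo, go, ho]
    replace k19 : s₅.reg 19 =
        ((Q - i) ^ (2 * k - 1) + Q ^ (2 * k - 1)) * (Q - i) ^ (2 * k - 1) := by
      rw [k19, j19]; simp
    rw [one_mul] at k20
    refine runs_ite (fun hlt => runs_add ?_) fun hlt => runs_const ?_
    · have hi' : i < threshold Q k := by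
        refine lt_of_le_of_ne (by omega) fun heq => ?_
        have := threshold_spec Q hk
        rw [← heq] at this
        rw [k19, k20] at hlt
        omega
      rw [if_pos (by omega), min_eq_left (by omega)]
      refine ⟨?_, ?_, ?_, ?_⟩
      · simp; omega
      · simp; omega
      · intro r hr; simp [show r ≠ 16 by omega, hframe r hr]
      · simp [*]
    · have hi' : i = threshold Q k := by
        refine le_antisymm (by omega) (Nat.sInf_le ?_)
        rw [k19, k20] at hlt
        simpa using hlt
      rw [if_neg (by omega), min_eq_right (by omega)]
      refine ⟨?_, ?_, ?_, ?_⟩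
      · simp
      · simp; omega
      · intro r hr; simp [show r ≠ 17 by omega, hframe r hr]
      · simp [*]
  · rintro s₁ ⟨h17, h16, hf, hm, hp, ho⟩
    have e2 := hf 2 (by norm_num)
    rw [h17, e2, h2, if_neg (by omega)]; norm_num
  · simp
    intro r hr
    simp [show r ≠ 16 by omega, show r ≠ 17 by omega]
  · rintro s₁ ⟨h17, h16, hf, hm, hp, ho⟩
    rw [min_eq_right (by omega)] at h16
    exact ⟨h16, hf, hm, hp, ho⟩
  · have : (threshold Q k + 1) * (4 * ((2 * k - 1) * (Q * 3 + 6)) + 14 + 1) ≤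
        (Q + 1) * (4 * ((2 * k - 1) * (Q * 3 + 6)) + 15) := by gcongr
    omega

/-- Prints the formula of the row whose entries start at address `R 12` and whose right-hand side
is at address `R 13`. -/
def writeRow : RamProg :=
  load 14 13 ;; add 15 14 14 ;; sub 15 15 2 ;; findThreshold ;;
    add 17 5 10 ;; store 9 8 ;; add 18 9 2 ;; loop 9 18 treeStep

end RamProg

/-- The code of the formula of a row with right-hand side `k`. -/
noncomputable def rowCode (U row : ℕ → ℕ) (n Q W D k : ℕ) : List ℕ :=
  treeCode (fun g => groupCode U row n (threshold Q k) W (g * (n * W))) D 0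

namespace RamProg

variable {ω : ℕ → Bool}

theorem groupCode_shift (M row : ℕ → ℕ) (n τ W B p : ℕ) :
    groupCode (fun x => M (B + x)) row n τ W p = groupCode M row n τ W (B + p) := by
  simp only [groupCode, hit, add_assoc]

/-- The global registers, together with the contents `M` of the memory below the stack. -/
structure GlobalEnv (M : ℕ → ℕ) (m n Δ Q D S : ℕ) (s : RamState) : Prop where
  rows : s.reg 0 = m
  cols : s.reg 1 = n
  one : s.reg 2 = 1
  rhs : s.reg 4 = m * n
  table : s.reg 5 = m * n + m
  scale : s.reg 6 = Q
  width : s.reg 7 = 2 * Δ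
  height : s.reg 8 = D
  base : s.reg 9 = S
  zero : s.reg 10 = 0
  vars : s.reg 11 = n + 3
  mem : ∀ x < S, s.mem x = M x

theorem GlobalEnv.congr {M : ℕ → ℕ} {m n Δ Q D S : ℕ} {s s' : RamState}
    (h : GlobalEnv M m n Δ Q D S s) (hr : ∀ r < 12, s'.reg r = s.reg r)
    (hm : ∀ x < S, s'.mem x = s.mem x) : GlobalEnv M m n Δ Q D S s' := by
  cases h
  constructor <;> grind

theorem runs_writeRow {M : ℕ → ℕ} {m n Δ Q D S i : ℕ} {s : RamState}
    (h : GlobalEnv M m n Δ Q D S s) (hS : S = m * n + m + 2 ^ D * (n * (2 * Δ)))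
    (hi : i < m) (h12 : s.reg 12 = i * n) (h13 : s.reg 13 = m * n + i)
    (hk : 1 ≤ M (m * n + i)) (hkΔ : M (m * n + i) ≤ Δ) :
    Runs ω writeRow s ((Q + 1) * (4 * ((2 * Δ - 1) * (Q * 3 + 6)) + 15) +
        2 ^ (D + 1) * (n * (2 * Δ * 7 + 15) + 3 * D + 12) + 11) (fun s' =>
      (∀ r < 14, s'.reg r = s.reg r) ∧ (∀ x < S, s'.mem x = s.mem x) ∧ s'.pos = s.pos ∧
      s'.out = s.out ++ rowCode (fun x => M (m * n + m + x)) (fun j => M (i * n + j)) n Q (2 * Δ) D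
        (M (m * n + i))) := by
  unfold writeRow
  have hk' : s.mem (m * n + i) = M (m * n + i) := h.mem _ (by omega)
  have hin : i * n + n ≤ m * n := by
    rw [← Nat.succ_mul]; exact Nat.mul_le_mul_right _ hi
  set k := M (m * n + i) with hkdef
  refine Runs.time_le (runs_load_seq (runs_add_seq (runs_sub_seq (Runs.seq
    (T₂ := 3 + (1 + (2 ^ (D + 1) - 1) * (n * (2 * Δ * 7 + 15) + 3 * D + 12)))
    (runs_findThreshold (Q := Q) (k := k) hk ?_ ?_ ?_ ?_) ?_)))) ?_
  · simp [h.one]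
  · simp [h.scale]
  · simp [h.zero]
  · simp [h.one, h13, hk']; omega
  · rintro s₁ ⟨h16, hf, hm, hp, ho⟩
    have e5 := hf 5 (by norm_num)
    have e8 := hf 8 (by norm_num)
    have e9 := hf 9 (by norm_num)
    have e2 := hf 2 (by norm_num)
    have e10 := hf 10 (by norm_num)
    simp at e5 e8 e9 e2 e10 hm hp ho
    have hf' : ∀ r < 14, s₁.reg r = s.reg r := by
      intro r hr
      rw [hf r (by omega)]
      simp [show r ≠ 14 by omega, show r ≠ 15 by omega]
    refine Runs.time_le (runs_add_seq (runs_store_seq (runs_add_seq (runs_tree (M := M) (n := n)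
      (W := 2 * Δ) (S := S) (row := i * n) (τ := threshold Q k) (B := m * n + m) (D := D)
      ?_ ?_ D _ 0 S 1 le_rfl ?_ le_rfl ?_ ?_ ?_ (by omega) ?_)))) (by omega)
    · omega
    · omega
    · constructor
      · simp [e2, h.one]
      · simp [hf', h.width]
      · simp [e9, h.base]
      · simp [e10, h.zero]
      · simp [hf', h.vars]
      · simp [hf', h12]
      · simp [h16]
      · intro x hx
        simp [e9, h.base, hx.ne, hm, h.mem x hx]
    · simp [e9, h.base, e2, h.one]
    · simp [e9, h.base, e8, h.height]
    · simp [e5, h.table, e10, h.zero]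
    · intro s₂ g18 g17 gf gm gp go
      refine runs_loop_stop ?_ ⟨?_, ?_, ?_, ?_⟩
      · rw [g18, gf 9 (by norm_num)]; simp [e9, h.base]
      · intro r hr
        rw [gf r (by omega)]
        simp [show r ≠ 17 by omega, show r ≠ 18 by omega, hf' r hr]
      · intro x hx
        rw [gm x hx]
        simp [e9, h.base, hx.ne, hm]
      · rw [gp]; simp [hp]
      · rw [go]; simp [ho, rowCode, groupCode_shift]
  · have h1 : (Q + 1) * (4 * ((2 * k - 1) * (Q * 3 + 6)) + 15) ≤
        (Q + 1) * (4 * ((2 * Δ - 1) * (Q * 3 + 6)) + 15) := by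
      gcongr
    have h2 : (2 ^ (D + 1) - 1) * (n * (2 * Δ * 7 + 15) + 3 * D + 12) ≤
        2 ^ (D + 1) * (n * (2 * Δ * 7 + 15) + 3 * D + 12) :=
      Nat.mul_le_mul_right _ (Nat.sub_le _ _)
    omega

/-- Prints the conjunction of the formulas of all rows, the `m - 1` conjunction symbols first. -/
def writeRows : RamProg :=
  const 12 1 ;; loop 12 0 (write 10 ;; add 12 12 2) ;; const 12 0 ;; add 13 4 10 ;;
    loop 13 5 (writeRow ;; add 13 13 2 ;; add 12 12 1)

theorem runs_writeRows {M : ℕ → ℕ} {m n Δ Q D S : ℕ} {s : RamState} (hm : 0 < m)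
    (h : GlobalEnv M m n Δ Q D S s) (hS : S = m * n + m + 2 ^ D * (n * (2 * Δ)))
    (hk : ∀ i < m, 1 ≤ M (m * n + i) ∧ M (m * n + i) ≤ Δ) (ho : s.out = []) :
    Runs ω writeRows s (m * ((Q + 1) * (4 * ((2 * Δ - 1) * (Q * 3 + 6)) + 15) +
        2 ^ (D + 1) * (n * (2 * Δ * 7 + 15) + 3 * D + 12) + 17) + 5) (fun s' =>
      s'.out = List.replicate (m - 1) 0 ++ (List.range m).flatMap fun i =>
        rowCode (fun x => M (m * n + m + x)) (fun j => M (i * n + j)) n Q (2 * Δ) D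
        (M (m * n + i))) := by
  unfold writeRows
  obtain ⟨K, hK⟩ : ∃ K, K = (Q + 1) * (4 * ((2 * Δ - 1) * (Q * 3 + 6)) + 15) +
        2 ^ (D + 1) * (n * (2 * Δ * 7 + 15) + 3 * D + 12) + 11 := ⟨_, rfl⟩
  refine Runs.time_le (runs_const_seq ((runs_loop (fun i s' => s'.reg 12 = i + 1 ∧
      (∀ r < 12, s'.reg r = s.reg r) ∧ s'.mem = s.mem ∧ s'.pos = s.pos ∧
      s'.out = List.replicate i 0) (m - 1) 2 ?_ ?_ ?_).seq fun s₁ hs₁ =>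
      runs_const_seq (runs_add_seq ((runs_loop (fun i s' => s'.reg 12 = i * n ∧
        s'.reg 13 = m * n + i ∧ GlobalEnv M m n Δ Q D S s' ∧
        s'.out = List.replicate (m - 1) 0 ++ (List.range i).flatMap fun i =>
        rowCode (fun x => M (m * n + m + x)) (fun j => M (i * n + j)) n Q (2 * Δ) D
        (M (m * n + i))) m (K + 2) ?_ ?_ ?_).mono le_rfl ?_)))) ?_
  · rintro i s₁ hi ⟨h12, hf, hmm, hp, ho⟩
    have e0 := hf 0 (by norm_num)
    have e2 := hf 2 (by norm_num)
    have e10 := hf 10 (by norm_num)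
    refine ⟨by rw [h12, e0, h.rows]; omega, runs_write_seq (runs_add ?_)⟩
    refine ⟨?_, ?_, ?_, ?_, ?_⟩
    · simp [h12, e2, h.one]
    · intro r hr; simp [show r ≠ 12 by omega, hf r hr]
    · simp [hmm]
    · simp [hp]
    · simp [ho, e10, h.zero, List.replicate_succ']
  · rintro s₁ ⟨h12, hf, hmm, hp, ho⟩
    rw [h12, hf 0 (by norm_num), h.rows]; omega
  · refine ⟨?_, ?_, ?_, ?_, ?_⟩
    · simp
    · intro r hr; simp [show r ≠ 12 by omega]
    · simp
    · simp
    · simp [ho]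
  · rintro i s₂ hi ⟨h12, h13, henv, ho⟩
    refine ⟨by rw [h13, henv.table]; omega, Runs.time_le ((runs_writeRow henv hS hi h12 h13
      (hk i hi).1 (hk i hi).2).seq (T₂ := 2) ?_) (by omega)⟩
    rintro s₃ ⟨gf, gm, gp, go⟩
    refine runs_add_seq (runs_add ⟨?_, ?_, ?_, ?_⟩)
    · simp [gf, h12, henv.cols]; ring
    · simp [gf, h13, henv.one]; ring
    · refine henv.congr ?_ ?_
      · intro r hr
        simp [show r ≠ 12 by omega, show r ≠ 13 by omega, gf r (by omega)]
      · simpa using gm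
    · simp [go, ho, List.range_succ]
  · rintro s₂ ⟨h12, h13, henv, ho⟩
    rw [h13, henv.table]; omega
  · obtain ⟨h12, hf, hmm, hp, ho⟩ := hs₁
    refine ⟨?_, ?_, ?_, ?_⟩
    · simp
    · simp [hf, h.rhs, h.zero]
    · refine h.congr ?_ ?_
      · intro r hr
        simp [show r ≠ 12 by omega, show r ≠ 13 by omega, hf r (by omega)]
      · simp [hmm]
    · simp [ho]
  · rintro s₂ ⟨h12, h13, henv, ho⟩
    exact ho
  · have : m * (K + 2 + 1) + m * 3 = m * (K + 6) := by ring
    rw [show (Q + 1) * (4 * ((2 * Δ - 1) * (Q * 3 + 6)) + 15) +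
        2 ^ (D + 1) * (n * (2 * Δ * 7 + 15) + 3 * D + 12) + 17 = K + 6 by omega]
    omega

end RamProg

/-! ### Parameters, and the program that computes them -/

/-- Half the number of bits of an entry of the random table. -/
def scaleExp (Δ : ℕ) : ℕ := Nat.clog 2 (8 * Δ)

/-- The number of rounds in which the distance to the fixed point grows by the factor `32 / 21`. -/
noncomputable def growthRounds (Δ : ℕ) : ℕ := sInf {i | 21 ^ i * Δ ≤ 32 ^ i}

/-- The number of binary digits needed for a position in a group. -/
def indexBits (n Δ : ℕ) : ℕ := Nat.clog 2 (n * (2 * Δ) + 1)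

/-- The number of rounds in which the error probability is squared. -/
def squaringRounds (n Δ : ℕ) : ℕ := Nat.clog 2 (indexBits n Δ * (4 * Δ))

/-- The height of the trees, when `c` rounds are spent on the middle part of the amplification. -/
noncomputable def treeHeight (c n Δ : ℕ) : ℕ :=
  2 * growthRounds Δ + 2 * squaringRounds n Δ + 2 * c

theorem exists_growthRounds (Δ : ℕ) : ∃ i ≤ 2 * Δ, 21 ^ i * Δ ≤ 32 ^ i := by
  refine ⟨2 * Δ, le_rfl, ?_⟩
  have h := one_add_mul_le_pow (R := ℝ) (a := 11 / 21) (by norm_num) (2 * Δ)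
  have h' : (Δ : ℝ) ≤ (32 / 21) ^ (2 * Δ) := by
    refine le_trans ?_ (h.trans (by norm_num))
    push_cast
    have : (0 : ℝ) ≤ Δ := Nat.cast_nonneg _
    linarith
  rw [div_pow, le_div_iff₀ (by positivity)] at h'
  have : (Δ : ℝ) * 21 ^ (2 * Δ) ≤ 32 ^ (2 * Δ) := h'
  rw [mul_comm]
  exact_mod_cast this

theorem growthRounds_spec (Δ : ℕ) : 21 ^ growthRounds Δ * Δ ≤ 32 ^ growthRounds Δ :=
  Nat.sInf_mem (s := {i | 21 ^ i * Δ ≤ 32 ^ i}) ((exists_growthRounds Δ).imp fun _ h => h.2)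

theorem lt_of_lt_growthRounds {Δ i : ℕ} (h : i < growthRounds Δ) : 32 ^ i < 21 ^ i * Δ := by
  by_contra hc
  exact absurd (Nat.sInf_le (s := {i | 21 ^ i * Δ ≤ 32 ^ i}) (not_lt.1 hc)) (not_le.2 h)

theorem growthRounds_le (Δ : ℕ) : growthRounds Δ ≤ 2 * Δ := by
  obtain ⟨i, hi, h⟩ := exists_growthRounds Δ
  exact (Nat.sInf_le (s := {i | 21 ^ i * Δ ≤ 32 ^ i}) h).trans hi

namespace RamProg

variable {ω : ℕ → Bool}

/-- `R 4 := m * n`, `R 5 := m * n + m`; the constants `1` and `0` are kept in `R 2` and `R 10`. In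
this and the following phases, the registers from `R 30` on are scratch. -/
def setupSizes : RamProg :=
  const 2 1 ;; const 10 0 ;; const 4 0 ;; const 30 0 ;;
    loop 30 0 (add 4 4 1 ;; add 30 30 2) ;; add 5 4 0

theorem runs_setupSizes {s : RamState} {m n : ℕ} (h0 : s.reg 0 = m) (h1 : s.reg 1 = n) :
    Runs ω setupSizes s (m * 3 + 6) (fun s' => s'.reg 2 = 1 ∧ s'.reg 10 = 0 ∧
      s'.reg 4 = m * n ∧ s'.reg 5 = m * n + m ∧ s'.reg 0 = m ∧ s'.reg 1 = n ∧
      s'.mem = s.mem ∧ s'.pos = s.pos ∧ s'.out = s.out) := by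
  unfold setupSizes
  refine Runs.time_le (runs_const_seq (runs_const_seq (runs_const_seq (runs_const_seq ((runs_loop
    (fun i s' => s'.reg 30 = i ∧ s'.reg 2 = 1 ∧ s'.reg 10 = 0 ∧
      s'.reg 4 = i * n ∧ s'.reg 0 = m ∧ s'.reg 1 = n ∧
      s'.mem = s.mem ∧ s'.pos = s.pos ∧ s'.out = s.out) m 2 ?_ ?_ ?_).seq
      fun s₁ hs => runs_add ?_))))) (by omega)
  · rintro i s₁ hi ⟨a1, a2, a3, a4, a5, a6, a7, a8, a9⟩
    exact ⟨by omega, runs_add_seq (runs_add (by simp [*, Nat.succ_mul]))⟩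
  · rintro s₁ ⟨a1, a2, a3, a4, a5, a6, a7, a8, a9⟩
    omega
  · simp [*]
  · obtain ⟨a1, a2, a3, a4, a5, a6, a7, a8, a9⟩ := hs
    simp [*]

/-- `R 3 :=` the largest entry of the input. -/
def setupMax : RamProg :=
  const 3 0 ;; const 30 0 ;;
    loop 30 5 (load 31 30 ;; ite 3 31 (add 3 31 10) skip ;; add 30 30 2)

theorem runs_setupMax {s : RamState} {B : ℕ} (h2 : s.reg 2 = 1) (h5 : s.reg 5 = B)
    (h10 : s.reg 10 = 0) :
    Runs ω setupMax s (B * 5 + 3) (fun s' => s'.reg 3 = (Finset.range B).sup s.mem ∧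
      (∀ r < 30, r ≠ 3 → s'.reg r = s.reg r) ∧
      s'.mem = s.mem ∧ s'.pos = s.pos ∧ s'.out = s.out) := by
  unfold setupMax
  refine Runs.time_le (runs_const_seq (runs_const_seq ((runs_loop
    (fun i s' => s'.reg 30 = i ∧ s'.reg 3 = (Finset.range i).sup s.mem ∧
      (∀ r < 30, r ≠ 3 → s'.reg r = s.reg r) ∧
      s'.mem = s.mem ∧ s'.pos = s.pos ∧ s'.out = s.out) B 4 ?_ ?_ ?_).mono le_rfl ?_))) (by omega)
  · rintro i s₁ hi ⟨h30, h3, hf, hm, hp, ho⟩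
    have e5 := hf 5 (by norm_num) (by norm_num)
    have e2 := hf 2 (by norm_num) (by norm_num)
    have e10 := hf 10 (by norm_num) (by norm_num)
    refine ⟨by omega, runs_load_seq (Runs.seq (T₁ := 2) (T₂ := 1)
      (R := fun s' => s'.reg 30 = i ∧ s'.reg 3 = (Finset.range (i + 1)).sup s.mem ∧
      (∀ r < 30, r ≠ 3 → s'.reg r = s.reg r) ∧
      s'.mem = s.mem ∧ s'.pos = s.pos ∧ s'.out = s.out)
      (runs_ite (fun hlt => runs_add ?_) fun hlt => runs_skip ?_) ?_)⟩
    · simp [h30, h3, hm] at hlt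
      simp [*, Finset.range_add_one]
      exact ⟨by simpa using hlt.le, by grind⟩
    · simp [h30, h3, hm] at hlt
      simp [*, Finset.range_add_one]
      grind
    · rintro s₂ ⟨g30, g3, gf, gm, gp, go⟩
      have e2 := gf 2 (by norm_num) (by norm_num)
      refine runs_add ?_
      simp [*]
      grind
  · rintro s₁ ⟨h30, h3, hf, hm, hp, ho⟩
    have e5 := hf 5 (by norm_num) (by norm_num)
    omega
  · simp
    grind
  · tauto

/-- `R 7 := 2 * Δ`, `R 12 := 4 * Δ`, `R 6 := 4 ^ scaleExp Δ`. -/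
def setupScale : RamProg :=
  add 7 3 3 ;; add 12 7 7 ;; add 30 12 12 ;; const 6 1 ;; const 31 1 ;;
    loop 31 30 (add 31 31 31 ;; add 6 6 6 ;; add 6 6 6)

theorem runs_setupScale {s : RamState} {Δ : ℕ} (h3 : s.reg 3 = Δ) :
    Runs ω setupScale s (scaleExp Δ * 4 + 6) (fun s' => s'.reg 7 = 2 * Δ ∧ s'.reg 12 = 4 * Δ ∧
      s'.reg 6 = 4 ^ scaleExp Δ ∧
      (∀ r < 30, r ≠ 6 → r ≠ 7 → r ≠ 12 → s'.reg r = s.reg r) ∧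
      s'.mem = s.mem ∧ s'.pos = s.pos ∧ s'.out = s.out) := by
  unfold setupScale
  refine Runs.time_le (runs_add_seq (runs_add_seq (runs_add_seq (runs_const_seq (runs_const_seq
    ((runs_loop (fun i s' => s'.reg 31 = 2 ^ i ∧ s'.reg 30 = 8 * Δ ∧ s'.reg 6 = 4 ^ i ∧
      s'.reg 7 = 2 * Δ ∧ s'.reg 12 = 4 * Δ ∧
      (∀ r < 30, r ≠ 6 → r ≠ 7 → r ≠ 12 → s'.reg r = s.reg r) ∧
      s'.mem = s.mem ∧ s'.pos = s.pos ∧ s'.out = s.out) (scaleExp Δ) 3 ?_ ?_ ?_).mono le_rfl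
      ?_)))))) (by omega)
  · rintro i s₁ hi ⟨h31, h30, h6, h7, h12, hf, hm, hp, ho⟩
    refine ⟨?_, runs_add_seq (runs_add_seq (runs_add ?_))⟩
    · rw [h31, h30]; exact (Nat.lt_clog_iff_pow_lt (by norm_num)).1 hi
    · simp [*, pow_succ]
      grind
  · rintro s₁ ⟨h31, h30, h6, h7, h12, hf, hm, hp, ho⟩
    rw [h31, h30, not_lt]
    exact Nat.le_pow_clog (by norm_num) _
  · simp [*]
    grind
  · tauto

/-- `R 8 := 2 * growthRounds Δ`. -/
def setupGrowth : RamProg :=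
  const 8 0 ;; add 30 3 10 ;; const 31 1 ;;
    loop 31 30 (add 31 31 31 ;; add 31 31 31 ;; add 31 31 31 ;; add 31 31 31 ;; add 31 31 31 ;;
      add 32 30 30 ;; add 32 32 32 ;; add 33 32 30 ;; add 32 32 32 ;; add 32 32 32 ;;
      add 30 33 32 ;; add 8 8 2 ;; add 8 8 2)

theorem runs_setupGrowth {s : RamState} {Δ : ℕ} (h2 : s.reg 2 = 1) (h3 : s.reg 3 = Δ)
    (h10 : s.reg 10 = 0) :
    Runs ω setupGrowth s (growthRounds Δ * 14 + 4) (fun s' => s'.reg 8 = 2 * growthRounds Δ ∧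
      (∀ r < 30, r ≠ 8 → s'.reg r = s.reg r) ∧
      s'.mem = s.mem ∧ s'.pos = s.pos ∧ s'.out = s.out) := by
  unfold setupGrowth
  refine Runs.time_le (runs_const_seq (runs_add_seq (runs_const_seq
    ((runs_loop (fun i s' => s'.reg 31 = 32 ^ i ∧ s'.reg 30 = 21 ^ i * Δ ∧ s'.reg 8 = 2 * i ∧
      (∀ r < 30, r ≠ 8 → s'.reg r = s.reg r) ∧
      s'.mem = s.mem ∧ s'.pos = s.pos ∧ s'.out = s.out) (growthRounds Δ) 13 ?_ ?_ ?_).mono le_rfl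
      ?_)))) (by omega)
  · rintro i s₁ hi ⟨h31, h30, h8, hf, hm, hp, ho⟩
    refine ⟨?_, ?_⟩
    · rw [h31, h30]; exact lt_of_lt_growthRounds hi
    · have e2 := hf 2 (by norm_num) (by norm_num)
      refine runs_add_seq (runs_add_seq (runs_add_seq (runs_add_seq (runs_add_seq (runs_add_seq
        (runs_add_seq (runs_add_seq (runs_add_seq (runs_add_seq (runs_add_seq (runs_add_seq
        (runs_add ⟨?_, ?_, ?_, ?_, ?_, ?_, ?_⟩))))))))))))
      · simp [h31, pow_succ]; ring
      · simp [h30, pow_succ]; ring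
      · simp [h8, e2, h2]; ring
      · intro r hr hr8
        simp [show r ≠ 30 by omega, show r ≠ 31 by omega, show r ≠ 32 by omega,
          show r ≠ 33 by omega, hr8, hf r hr hr8]
      · simp [hm]
      · simp [hp]
      · simp [ho]
  · rintro s₁ ⟨h31, h30, h8, hf, hm, hp, ho⟩
    rw [h31, h30, not_lt]
    exact growthRounds_spec Δ
  · simp [*]
    grind
  · tauto

/-- `R 13 := n * (2 * Δ)`, `R 15 := indexBits n Δ * (4 * Δ)`. -/
def setupIndex : RamProg :=
  const 13 0 ;; const 30 0 ;; loop 30 1 (add 13 13 7 ;; add 30 30 2) ;;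
    add 30 13 2 ;; const 31 1 ;; const 14 0 ;; loop 31 30 (add 31 31 31 ;; add 14 14 2) ;;
    const 15 0 ;; const 30 0 ;; loop 30 14 (add 15 15 12 ;; add 30 30 2)

theorem runs_setupIndex {s : RamState} {n Δ : ℕ} (h1 : s.reg 1 = n) (h2 : s.reg 2 = 1)
    (h7 : s.reg 7 = 2 * Δ) (h12 : s.reg 12 = 4 * Δ) :
    Runs ω setupIndex s (n * 3 + indexBits n Δ * 6 + 10) (fun s' =>
      s'.reg 13 = n * (2 * Δ) ∧ s'.reg 15 = indexBits n Δ * (4 * Δ) ∧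
      (∀ r < 13, s'.reg r = s.reg r) ∧
      s'.mem = s.mem ∧ s'.pos = s.pos ∧ s'.out = s.out) := by
  unfold setupIndex
  refine Runs.time_le (runs_const_seq (runs_const_seq
    ((runs_loop (fun i s' => s'.reg 30 = i ∧ s'.reg 13 = i * (2 * Δ) ∧
      (∀ r < 13, s'.reg r = s.reg r) ∧
      s'.mem = s.mem ∧ s'.pos = s.pos ∧ s'.out = s.out) n 2 ?_ ?_ ?_).seq
      fun s₁ hs₁ => runs_add_seq (runs_const_seq (runs_const_seq ((runs_loop
      (fun i s' => s'.reg 31 = 2 ^ i ∧ s'.reg 30 = n * (2 * Δ) + 1 ∧ s'.reg 14 = i ∧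
      s'.reg 13 = n * (2 * Δ) ∧ (∀ r < 13, s'.reg r = s.reg r) ∧
      s'.mem = s.mem ∧ s'.pos = s.pos ∧ s'.out = s.out) (indexBits n Δ) 2 ?_ ?_ ?_).seq
      fun s₂ hs₂ => runs_const_seq (runs_const_seq ((runs_loop (fun i s' => s'.reg 30 = i ∧
        s'.reg 15 = i * (4 * Δ) ∧ s'.reg 14 = indexBits n Δ ∧
      s'.reg 13 = n * (2 * Δ) ∧ (∀ r < 13, s'.reg r = s.reg r) ∧
      s'.mem = s.mem ∧ s'.pos = s.pos ∧ s'.out = s.out) (indexBits n Δ) 2 ?_ ?_ ?_).mono le_rfl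
      ?_)))))))) (by omega)
  · rintro i s₁ hi ⟨h30, h13, hf, hm, hp, ho⟩
    have e1 := hf 1 (by norm_num)
    have e2 := hf 2 (by norm_num)
    have e7 := hf 7 (by norm_num)
    refine ⟨by omega, runs_add_seq (runs_add ?_)⟩
    simp [*, add_one_mul]
    grind
  · rintro s₁ ⟨h30, h13, hf, hm, hp, ho⟩
    have e1 := hf 1 (by norm_num)
    omega
  · simp [*]
    grind
  · rintro i s₂ hi ⟨h31, h30, h14, h13, hf, hm, hp, ho⟩
    have e2 := hf 2 (by norm_num)
    refine ⟨?_, runs_add_seq (runs_add ?_)⟩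
    · rw [h31, h30]; exact (Nat.lt_clog_iff_pow_lt (by norm_num)).1 hi
    · simp [*, pow_succ]
      grind
  · rintro s₂ ⟨h31, h30, h14, h13, hf, hm, hp, ho⟩
    rw [h31, h30, not_lt]
    exact Nat.le_pow_clog (by norm_num) _
  · obtain ⟨h30, h13, hf, hm, hp, ho⟩ := hs₁
    have e2 := hf 2 (by norm_num)
    simp [*]
    grind
  · rintro i s₃ hi ⟨h30, h15, h14, h13, hf, hm, hp, ho⟩
    have e2 := hf 2 (by norm_num)
    have e12 := hf 12 (by norm_num)
    refine ⟨by omega, runs_add_seq (runs_add ?_)⟩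
    simp [*, add_one_mul]
    grind
  · rintro s₃ ⟨h30, h15, h14, h13, hf, hm, hp, ho⟩
    omega
  · obtain ⟨h31, h30, h14, h13, hf, hm, hp, ho⟩ := hs₂
    simp [*]
    grind
  · tauto

/-- Adds `2 * squaringRounds n Δ + 2 * c` to `R 8`, and stores the base of the stack in `R 9` and
`n + 3` in `R 11`. -/
def setupHeight (c : ℕ) : RamProg :=
  const 31 1 ;; loop 31 15 (add 31 31 31 ;; add 8 8 2 ;; add 8 8 2) ;; const 30 (2 * c) ;;
    add 8 8 30 ;; const 30 0 ;; loop 30 8 (add 13 13 13 ;; add 30 30 2) ;;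
    add 9 5 13 ;; const 11 3 ;; add 11 11 1

theorem runs_setupHeight {s : RamState} {c g n Δ : ℕ} (h1 : s.reg 1 = n) (h2 : s.reg 2 = 1)
    (h8 : s.reg 8 = 2 * g) (h13 : s.reg 13 = n * (2 * Δ))
    (h15 : s.reg 15 = indexBits n Δ * (4 * Δ)) :
    Runs ω (setupHeight c) s (squaringRounds n Δ * 4 +
        (2 * g + 2 * squaringRounds n Δ + 2 * c) * 3 + 9) (fun s' =>
      s'.reg 8 = 2 * g + 2 * squaringRounds n Δ + 2 * c ∧
      s'.reg 9 = s.reg 5 + 2 ^ (2 * g + 2 * squaringRounds n Δ + 2 * c) * (n * (2 * Δ)) ∧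
      s'.reg 11 = n + 3 ∧ (∀ r < 11, r ≠ 8 → r ≠ 9 → s'.reg r = s.reg r) ∧
      s'.mem = s.mem ∧ s'.pos = s.pos ∧ s'.out = s.out) := by
  unfold setupHeight
  obtain ⟨D, hD⟩ : ∃ D, D = 2 * g + 2 * squaringRounds n Δ + 2 * c := ⟨_, rfl⟩
  rw [← hD]
  refine Runs.time_le (runs_const_seq ((runs_loop (fun i s' => s'.reg 31 = 2 ^ i ∧
      s'.reg 8 = 2 * g + 2 * i ∧ s'.reg 13 = n * (2 * Δ) ∧
      s'.reg 15 = indexBits n Δ * (4 * Δ) ∧ (∀ r < 11, r ≠ 8 → s'.reg r = s.reg r) ∧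
      s'.mem = s.mem ∧ s'.pos = s.pos ∧ s'.out = s.out) (squaringRounds n Δ) 3 ?_ ?_ ?_).seq
      fun s₁ hs₁ => runs_const_seq (runs_add_seq (runs_const_seq ((runs_loop (fun i s' =>
        s'.reg 30 = i ∧ s'.reg 13 = 2 ^ i * (n * (2 * Δ)) ∧ s'.reg 8 = D ∧
        (∀ r < 11, r ≠ 8 → s'.reg r = s.reg r) ∧
        s'.mem = s.mem ∧ s'.pos = s.pos ∧ s'.out = s.out) D 2 ?_ ?_ ?_).seq fun s₂ hs₂ =>
        runs_add_seq (runs_const_seq (runs_add ?_)))))))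
        (by omega)
  · rintro i s₁ hi ⟨h31, h8, h13, h15, hf, hm, hp, ho⟩
    have e2 := hf 2 (by norm_num) (by norm_num)
    refine ⟨?_, runs_add_seq (runs_add_seq (runs_add ?_))⟩
    · rw [h31, h15]; exact (Nat.lt_clog_iff_pow_lt (by norm_num)).1 hi
    · simp [*, pow_succ]
      grind
  · rintro s₁ ⟨h31, h8, h13, h15, hf, hm, hp, ho⟩
    rw [h31, h15, not_lt]
    exact Nat.le_pow_clog (by norm_num) _
  · simp [*]
    grind
  · rintro i s₂ hi ⟨h30, h13, h8, hf, hm, hp, ho⟩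
    have e2 := hf 2 (by norm_num) (by norm_num)
    refine ⟨by omega, runs_add_seq (runs_add ?_)⟩
    simp [*, pow_succ]
    grind
  · rintro s₂ ⟨h30, h13, h8, hf, hm, hp, ho⟩
    omega
  · obtain ⟨h31, h8, h13, h15, hf, hm, hp, ho⟩ := hs₁
    simp [*]
    grind
  · obtain ⟨h30, h13, h8, hf, hm, hp, ho⟩ := hs₂
    have e1 := hf 1 (by norm_num) (by norm_num)
    have e5 := hf 5 (by norm_num) (by norm_num)
    simp [*]
    grind

end RamProg

/-- The number whose binary digits are the `s` bits of `ω` from position `p` on. -/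
def bitsVal (ω : ℕ → Bool) (p : ℕ) : ℕ → ℕ
  | 0 => 0
  | s + 1 => 2 * bitsVal ω p s + (ω (p + s)).toNat

/-- The `i`-th `s`-bit number on the tape `ω`. -/
def tableEntry (ω : ℕ → Bool) (s i : ℕ) : ℕ := bitsVal ω (i * s) s

/-- The memory that agrees with `mem` below `B` and holds the table `U` from `B` on. -/
def tableMem (mem : ℕ → ℕ) (B : ℕ) (U : ℕ → ℕ) (x : ℕ) : ℕ := if x < B then mem x else U (x - B)

namespace RamProg

variable {ω : ℕ → Bool}

/-- Fills the memory from address `R 5` up to `R 9` with random numbers below `R 6`. -/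
def fillTable : RamProg :=
  add 12 5 10 ;;
    loop 12 9 (const 30 0 ;; const 31 1 ;;
      loop 31 6 (coin 32 ;; add 30 30 30 ;; add 30 30 32 ;; add 31 31 31) ;;
      store 12 30 ;; add 12 12 2)

theorem runs_fillTable {s : RamState} {B L σ : ℕ} (h2 : s.reg 2 = 1) (h5 : s.reg 5 = B)
    (h6 : s.reg 6 = 2 ^ σ) (h9 : s.reg 9 = B + L) (h10 : s.reg 10 = 0) (hpos : s.pos = 0) :
    Runs ω fillTable s (L * (σ * 5 + 6) + 2) (fun s' => (∀ r < 12, s'.reg r = s.reg r) ∧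
      (∀ x < B + L, s'.mem x = tableMem s.mem B (tableEntry ω σ) x) ∧ s'.out = s.out) := by
  unfold fillTable
  refine Runs.time_le (runs_add_seq ((runs_loop (fun i s' => s'.reg 12 = B + i ∧
    (∀ r < 12, s'.reg r = s.reg r) ∧ s'.pos = i * σ ∧
    (∀ x < B + i, s'.mem x = tableMem s.mem B (tableEntry ω σ) x) ∧
    (∀ x < B, s'.mem x = s.mem x) ∧ s'.out = s.out) L
    (σ * 5 + 5) ?_ ?_ ?_).mono le_rfl ?_)) (le_of_eq (by ring))
  · rintro i s₁ hi ⟨h12, hf, hp, hm, hm', ho⟩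
    have e9 := hf 9 (by norm_num)
    have e2 := hf 2 (by norm_num)
    have e6 := hf 6 (by norm_num)
    refine ⟨by omega, Runs.time_le (runs_const_seq (runs_const_seq ((runs_loop (fun j s' =>
      s'.reg 30 = bitsVal ω (i * σ) j ∧ s'.reg 31 = 2 ^ j ∧
      (∀ r < 13, s'.reg r = s₁.reg r) ∧ s'.pos = i * σ + j ∧ s'.mem = s₁.mem ∧
      s'.out = s.out) σ 4 ?_ ?_ ?_).seq fun s₂ hs₂ =>
      runs_store_seq (runs_add ?_)))) (le_of_eq (by ring))⟩
    · rintro j s₂ hj ⟨g30, g31, gf, gp, gm, go⟩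
      have k6 := gf 6 (by norm_num)
      refine ⟨?_, runs_coin_seq (runs_add_seq (runs_add_seq (runs_add ?_)))⟩
      · rw [g31, k6, e6, h6]; exact Nat.pow_lt_pow_right (by norm_num) hj
      · simp [*, bitsVal, pow_succ]
        grind
    · rintro s₂ ⟨g30, g31, gf, gp, gm, go⟩
      rw [g31, gf 6 (by norm_num), e6, h6]; omega
    · simp [*, bitsVal]
      grind
    · obtain ⟨g30, g31, gf, gp, gm, go⟩ := hs₂
      have k2 := gf 2 (by norm_num)
      have k12 := gf 12 (by norm_num)
      refine ⟨?_, ?_, ?_, ?_, ?_, ?_⟩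
      · simp [*]; ring
      · intro r hr
        simp [show r ≠ 12 by omega, gf r (by omega), hf r hr]
      · simp [gp]; ring
      · intro x hx
        by_cases hxi : x = B + i
        · simp [hxi, k12, h12, g30, tableMem, tableEntry]
        · simp [k12, h12, hxi, gm, hm x (by omega)]
      · intro x hx
        simp [k12, h12, show x ≠ B + i by omega, gm, hm' x hx]
      · simp [go]
  · rintro s₁ ⟨h12, hf, hp, hm, hm', ho⟩
    have e9 := hf 9 (by norm_num)
    omega
  · refine ⟨?_, ?_, ?_, ?_, ?_, ?_⟩
    · simp [h5, h10]
    · intro r hr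
      simp [show r ≠ 12 by omega]
    · simp [hpos]
    · intro x hx
      simp [tableMem, show x < B by omega]
    · simp
    · simp
  · rintro s₁ ⟨h12, hf, hp, hm, hm', ho⟩
    exact ⟨hf, hm, ho⟩

/-- The deterministic part of the program: all parameters are computed from the input. -/
def setup (c : ℕ) : RamProg :=
  setupSizes ;; setupMax ;; setupScale ;; setupGrowth ;; setupIndex ;; setupHeight c

/-- A bound for the running time of `setup`. -/
noncomputable def setupTime (c m n Δ : ℕ) : ℕ :=
  m * 3 + 6 + ((m * n + m) * 5 + 3 + (scaleExp Δ * 4 + 6 + (growthRounds Δ * 14 + 4 +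
    (n * 3 + indexBits n Δ * 6 + 10 +
      (squaringRounds n Δ * 4 + (2 * growthRounds Δ + 2 * squaringRounds n Δ + 2 * c) * 3 + 9)))))

theorem runs_setup {s : RamState} {c m n Δ : ℕ} (h0 : s.reg 0 = m) (h1 : s.reg 1 = n)
    (hΔ : Δ = (Finset.range (m * n + m)).sup s.mem) :
    Runs ω (setup c) s (setupTime c m n Δ) (fun s' =>
      GlobalEnv s.mem m n Δ (4 ^ scaleExp Δ) (treeHeight c n Δ)
        (m * n + m + 2 ^ treeHeight c n Δ * (n * (2 * Δ))) s' ∧ s'.mem = s.mem ∧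
      s'.pos = s.pos ∧ s'.out = s.out) := by
  unfold setup setupTime
  refine (runs_setupSizes h0 h1).seq ?_
  rintro s₁ ⟨a2, a10, a4, a5, a0, a1, am, ap, ao⟩
  refine (runs_setupMax a2 a5 a10).seq ?_
  rintro s₂ ⟨b3, bf, bm, bp, bo⟩
  rw [am, ← hΔ] at b3
  refine (runs_setupScale b3).seq ?_
  rintro s₃ ⟨c7, c12, c6, cf, cm, cp, co⟩
  refine (runs_setupGrowth (Δ := Δ) ?_ ?_ ?_).seq ?_
  · rw [cf 2 (by norm_num) (by norm_num) (by norm_num) (by norm_num),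
      bf 2 (by norm_num) (by norm_num), a2]
  · rw [cf 3 (by norm_num) (by norm_num) (by norm_num) (by norm_num), b3]
  · rw [cf 10 (by norm_num) (by norm_num) (by norm_num) (by norm_num),
      bf 10 (by norm_num) (by norm_num), a10]
  rintro s₄ ⟨d8, df, dm, dp, d_o⟩
  refine (runs_setupIndex (n := n) (Δ := Δ) ?_ ?_ ?_ ?_).seq ?_
  · rw [df 1 (by norm_num) (by norm_num),
      cf 1 (by norm_num) (by norm_num) (by norm_num) (by norm_num),
      bf 1 (by norm_num) (by norm_num), a1]
  · rw [df 2 (by norm_num) (by norm_num),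
      cf 2 (by norm_num) (by norm_num) (by norm_num) (by norm_num),
      bf 2 (by norm_num) (by norm_num), a2]
  · rw [df 7 (by norm_num) (by norm_num), c7]
  · rw [df 12 (by norm_num) (by norm_num), c12]
  rintro s₅ ⟨e13, e15, ef, em, ep, eo⟩
  refine (runs_setupHeight (g := growthRounds Δ) (n := n) (Δ := Δ) ?_ ?_ ?_ e13 e15).mono
    le_rfl ?_
  · rw [ef 1 (by norm_num), df 1 (by norm_num) (by norm_num),
      cf 1 (by norm_num) (by norm_num) (by norm_num) (by norm_num),
      bf 1 (by norm_num) (by norm_num), a1]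
  · rw [ef 2 (by norm_num), df 2 (by norm_num) (by norm_num),
      cf 2 (by norm_num) (by norm_num) (by norm_num) (by norm_num),
      bf 2 (by norm_num) (by norm_num), a2]
  · rw [ef 8 (by norm_num), d8]
  rintro s₆ ⟨f8, f9, f11, ff, fm, fp, fo⟩
  refine ⟨⟨?_, ?_, ?_, ?_, ?_, ?_, ?_, f8, ?_, ?_, f11, ?_⟩, ?_, ?_, ?_⟩
  · rw [ff 0 (by norm_num) (by norm_num) (by norm_num), ef 0 (by norm_num),
      df 0 (by norm_num) (by norm_num),
      cf 0 (by norm_num) (by norm_num) (by norm_num) (by norm_num),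
      bf 0 (by norm_num) (by norm_num), a0]
  · rw [ff 1 (by norm_num) (by norm_num) (by norm_num), ef 1 (by norm_num),
      df 1 (by norm_num) (by norm_num),
      cf 1 (by norm_num) (by norm_num) (by norm_num) (by norm_num),
      bf 1 (by norm_num) (by norm_num), a1]
  · rw [ff 2 (by norm_num) (by norm_num) (by norm_num), ef 2 (by norm_num),
      df 2 (by norm_num) (by norm_num),
      cf 2 (by norm_num) (by norm_num) (by norm_num) (by norm_num),
      bf 2 (by norm_num) (by norm_num), a2]
  · rw [ff 4 (by norm_num) (by norm_num) (by norm_num), ef 4 (by norm_num),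
      df 4 (by norm_num) (by norm_num),
      cf 4 (by norm_num) (by norm_num) (by norm_num) (by norm_num),
      bf 4 (by norm_num) (by norm_num), a4]
  · rw [ff 5 (by norm_num) (by norm_num) (by norm_num), ef 5 (by norm_num),
      df 5 (by norm_num) (by norm_num),
      cf 5 (by norm_num) (by norm_num) (by norm_num) (by norm_num),
      bf 5 (by norm_num) (by norm_num), a5]
  · rw [ff 6 (by norm_num) (by norm_num) (by norm_num), ef 6 (by norm_num),
      df 6 (by norm_num) (by norm_num), c6]
  · rw [ff 7 (by norm_num) (by norm_num) (by norm_num), ef 7 (by norm_num),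
      df 7 (by norm_num) (by norm_num), c7]
  · rw [f9, ef 5 (by norm_num),
      df 5 (by norm_num) (by norm_num),
      cf 5 (by norm_num) (by norm_num) (by norm_num) (by norm_num),
      bf 5 (by norm_num) (by norm_num), a5]
    rfl
  · rw [ff 10 (by norm_num) (by norm_num) (by norm_num), ef 10 (by norm_num),
      df 10 (by norm_num) (by norm_num),
      cf 10 (by norm_num) (by norm_num) (by norm_num) (by norm_num),
      bf 10 (by norm_num) (by norm_num), a10]
  · simp [fm, em, dm, cm, bm, am]
  · rw [fm, em, dm, cm, bm, am]
  · rw [fp, ep, dp, cp, bp, ap]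
  · rw [fo, eo, d_o, co, bo, ao]

/-- The algorithm: a single variable is printed if there is only one, and otherwise the random
formula. -/
def coveringProg (c : ℕ) : RamProg :=
  const 2 2 ;; ite 1 2 (const 3 3 ;; write 3) (setup c ;; fillTable ;; writeRows)

/-- A bound for the running time of `coveringProg`. -/
noncomputable def runTime (c m n Δ : ℕ) : ℕ :=
  setupTime c m n Δ + (2 ^ treeHeight c n Δ * (n * (2 * Δ)) * (2 * scaleExp Δ * 5 + 6) + 2 +
    (m * ((4 ^ scaleExp Δ + 1) * (4 * ((2 * Δ - 1) * (4 ^ scaleExp Δ * 3 + 6)) + 15) +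
      2 ^ (treeHeight c n Δ + 1) * (n * (2 * Δ * 7 + 15) + 3 * treeHeight c n Δ + 12) + 17)
      + 5)) + 4

theorem runs_coveringProg {s : RamState} {c m n Δ : ℕ} (h0 : s.reg 0 = m) (h1 : s.reg 1 = n)
    (hn : 2 ≤ n) (hm : 0 < m) (hΔ : Δ = (Finset.range (m * n + m)).sup s.mem)
    (hb : ∀ i < m, 1 ≤ s.mem (m * n + i)) (hpos : s.pos = 0) (hout : s.out = []) :
    Runs ω (coveringProg c) s (runTime c m n Δ) (fun s' =>
      s'.out = List.replicate (m - 1) 0 ++ (List.range m).flatMap fun i =>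
        rowCode (tableEntry ω (2 * scaleExp Δ))
          (fun j => tableMem s.mem (m * n + m) (tableEntry ω (2 * scaleExp Δ)) (i * n + j)) n
          (4 ^ scaleExp Δ) (2 * Δ) (treeHeight c n Δ) (s.mem (m * n + i))) := by
  unfold coveringProg runTime
  obtain ⟨K, hK⟩ : ∃ K, K = 2 ^ treeHeight c n Δ * (n * (2 * Δ)) * (2 * scaleExp Δ * 5 + 6) + 2 +
    (m * ((4 ^ scaleExp Δ + 1) * (4 * ((2 * Δ - 1) * (4 ^ scaleExp Δ * 3 + 6)) + 15) +
      2 ^ (treeHeight c n Δ + 1) * (n * (2 * Δ * 7 + 15) + 3 * treeHeight c n Δ + 12) + 17)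
      + 5) := ⟨_, rfl⟩
  rw [← hK]
  refine Runs.time_le (runs_const_seq (runs_ite (T := setupTime c m n Δ + K) (fun hlt => ?_)
    fun hlt => (runs_setup (s := s.setReg 2 2) (m := m) (n := n) ?_ ?_ hΔ).seq ?_)) (by omega)
  · simp [h1] at hlt; omega
  · simpa using h0
  · simpa using h1
  rintro s₁ ⟨henv, hmem, hp, ho⟩
  refine ((runs_fillTable (σ := 2 * scaleExp Δ) henv.one henv.table ?_ henv.base henv.zero
    ?_).seq (T₂ := m * ((4 ^ scaleExp Δ + 1) * (4 * ((2 * Δ - 1) * (4 ^ scaleExp Δ * 3 + 6)) + 15) +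
      2 ^ (treeHeight c n Δ + 1) * (n * (2 * Δ * 7 + 15) + 3 * treeHeight c n Δ + 12) + 17)
      + 5) ?_).time_le hK.ge
  · rw [henv.scale, pow_mul]; norm_num
  · rw [hp]; simpa using hpos
  rintro s₂ ⟨gf, gm, go⟩
  have hmem' : s₁.mem = s.mem := by simpa using hmem
  rw [hmem'] at gm
  have hval : ∀ i < m, tableMem s.mem (m * n + m) (tableEntry ω (2 * scaleExp Δ)) (m * n + i) =
      s.mem (m * n + i) := fun i hi => by simp [tableMem, hi]
  refine (runs_writeRows (M := tableMem s.mem (m * n + m) (tableEntry ω (2 * scaleExp Δ))) hm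
    (n := n) (Δ := Δ) (Q := 4 ^ scaleExp Δ) (D := treeHeight c n Δ) ?_ rfl ?_ ?_).mono le_rfl ?_
  · obtain ⟨k1, k2, k3, k4, k5, k6, k7, k8, k9, k10, k11, k12⟩ := henv
    constructor
    · rw [gf 0 (by norm_num), k1]
    · rw [gf 1 (by norm_num), k2]
    · rw [gf 2 (by norm_num), k3]
    · rw [gf 4 (by norm_num), k4]
    · rw [gf 5 (by norm_num), k5]
    · rw [gf 6 (by norm_num), k6]
    · rw [gf 7 (by norm_num), k7]
    · rw [gf 8 (by norm_num), k8]
    · rw [gf 9 (by norm_num), k9]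
    · rw [gf 10 (by norm_num), k10]
    · rw [gf 11 (by norm_num), k11]
    · exact gm
  · intro i hi
    rw [hval i hi]
    refine ⟨hb i hi, ?_⟩
    rw [hΔ]
    exact Finset.le_sup (by simpa using hi)
  · rw [go, ho]; simpa using hout
  · intro s₃ h₃
    rw [h₃]
    congr 1
    simp only [List.flatMap_def]
    congr 1
    refine List.map_congr_left fun i hi => ?_
    rw [hval i (by simpa using hi)]
    simp [tableMem]

theorem runs_coveringProg_of_lt {s : RamState} {c : ℕ} (h1 : s.reg 1 < 2) (hout : s.out = []) :
    Runs ω (coveringProg c) s 4 (fun s' => s'.out = [3]) := by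
  unfold coveringProg
  refine runs_const_seq (runs_ite (T := 2) (fun hlt => runs_const_seq (runs_write ?_))
    fun hlt => ?_)
  · simp [hout]
  · simp [h1] at hlt

end RamProg

/-! ### The formulas that are printed -/

namespace BoolFormula

variable {n : ℕ}

/-- The conjunction of all variables. -/
def allVars (hn : 0 < n) : BoolFormula n :=
  (List.finRange n).foldr (fun j φ => and (var j) φ) (var ⟨0, hn⟩)

/-- The disjunction of the variables in `H` and of `allVars`. -/
def group (hn : 0 < n) (H : Fin n → Prop) [DecidablePred H] : BoolFormula n :=
  (List.finRange n).foldr (fun j φ => if H j then or (var j) φ else φ) (allVars hn)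

/-- The complete binary tree of height `ℓ` over the leaves `g, …, g + 2 ^ ℓ - 1`, whose odd levels
are disjunctions and whose even levels are conjunctions. -/
def tree (leaf : ℕ → BoolFormula n) : ℕ → ℕ → BoolFormula n
  | 0, g => leaf g
  | ℓ + 1, g => if (ℓ + 1) % 2 = 1 then or (tree leaf ℓ g) (tree leaf ℓ (g + 2 ^ ℓ))
      else and (tree leaf ℓ g) (tree leaf ℓ (g + 2 ^ ℓ))

/-- The conjunction `f 0 ∧ … ∧ f i`, nested to the left. -/
def andChain (f : ℕ → BoolFormula n) : ℕ → BoolFormula n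
  | 0 => f 0
  | i + 1 => and (andChain f i) (f (i + 1))

/-! #### Codes -/

theorem code_allVars (hn : 0 < n) :
    (allVars hn).code = ((List.range n).flatMap fun j => [0, j + 3]) ++ [3] := by
  have : ∀ l : List (Fin n), (l.foldr (fun j φ => and (var j) φ) (var ⟨0, hn⟩)).code =
      ((l.map Fin.val).flatMap fun j => [0, j + 3]) ++ [3] := by
    intro l
    induction l with
    | nil => simp [code]
    | cons j l ih => simp [code, ih]
  rw [allVars, this, show (List.finRange n).map Fin.val = List.range n from by
    apply List.ext_getElem <;> simp]

theorem code_group (hn : 0 < n) (H : Fin n → Prop) [DecidablePred H] (H' : ℕ → Prop)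
    [DecidablePred H'] (hH : ∀ j : Fin n, H j ↔ H' j) :
    (group hn H).code = ((List.range n).flatMap fun j => if H' j then [1, j + 3] else []) ++
      (((List.range n).flatMap fun j => [0, j + 3]) ++ [3]) := by
  have : ∀ l : List (Fin n), (l.foldr (fun j φ => if H j then or (var j) φ else φ)
      (allVars hn)).code =
      ((l.map Fin.val).flatMap fun j => if H' j then [1, j + 3] else []) ++ (allVars hn).code := by
    intro l
    induction l with
    | nil => simp
    | cons j l ih =>
      by_cases h : H j
      · simp [code, ih, h, (hH j).1 h]
      · simp [ih, h, (hH j).not.1 h]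
  rw [group, this, code_allVars, show (List.finRange n).map Fin.val = List.range n from by
    apply List.ext_getElem <;> simp]

theorem code_tree (leaf : ℕ → BoolFormula n) (ℓ g : ℕ) :
    (tree leaf ℓ g).code = treeCode (fun g => (leaf g).code) ℓ g := by
  induction ℓ generalizing g with
  | zero => rfl
  | succ ℓ ih =>
    rcases Nat.mod_two_eq_zero_or_one (ℓ + 1) with h | h <;>
      simp [tree, treeCode, code, h, ih]

theorem code_andChain (f : ℕ → BoolFormula n) (i : ℕ) :
    (andChain f i).code =
      List.replicate i 0 ++ (List.range (i + 1)).flatMap fun i => (f i).code := by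
  induction i with
  | zero => simp [andChain]
  | succ i ih =>
    rw [andChain, code, ih, List.range_succ (n := i + 1), List.replicate_succ]
    simp

/-! #### Sizes -/

theorem size_allVars (hn : 0 < n) : (allVars hn).size = n + 1 := by
  have : ∀ l : List (Fin n), (l.foldr (fun j φ => and (var j) φ) (var ⟨0, hn⟩)).size =
      l.length + 1 := by
    intro l
    induction l with
    | nil => simp [size]
    | cons j l ih => simp [size, ih]; ring
  rw [allVars, this, List.length_finRange]

theorem size_group_le (hn : 0 < n) (H : Fin n → Prop) [DecidablePred H] :
    (group hn H).size ≤ 2 * n + 1 := by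
  have : ∀ l : List (Fin n), (l.foldr (fun j φ => if H j then or (var j) φ else φ)
      (allVars hn)).size ≤ l.length + (n + 1) := by
    intro l
    induction l with
    | nil => simp [size_allVars]
    | cons j l ih =>
      by_cases h : H j
      · simp [size, h]; omega
      · simp [h]; omega
  refine (this _).trans ?_
  rw [List.length_finRange]; omega

theorem size_tree_le (leaf : ℕ → BoolFormula n) (K : ℕ) (h : ∀ g, (leaf g).size ≤ K) (ℓ g : ℕ) :
    (tree leaf ℓ g).size ≤ 2 ^ ℓ * K := by
  induction ℓ generalizing g with
  | zero => simpa [tree] using h g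
  | succ ℓ ih =>
    have h1 := ih g
    have h2 := ih (g + 2 ^ ℓ)
    rw [pow_succ, mul_assoc, mul_left_comm]
    unfold tree
    split_ifs <;> simp only [size] <;> omega

theorem size_andChain_le (f : ℕ → BoolFormula n) (K : ℕ) (h : ∀ i, (f i).size ≤ K) (i : ℕ) :
    (andChain f i).size ≤ (i + 1) * K := by
  induction i with
  | zero => simpa [andChain] using h 0
  | succ i ih =>
    have := h (i + 1)
    rw [andChain, size, add_one_mul]
    omega

/-! #### Monotonicity -/

theorem isMonotone_allVars (hn : 0 < n) : (allVars hn).IsMonotone := by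
  unfold allVars
  induction List.finRange n with
  | nil => trivial
  | cons j l ih => exact ⟨trivial, ih⟩

theorem isMonotone_group (hn : 0 < n) (H : Fin n → Prop) [DecidablePred H] :
    (group hn H).IsMonotone := by
  unfold group
  induction List.finRange n with
  | nil => exact isMonotone_allVars hn
  | cons j l ih =>
    rw [List.foldr_cons]
    split_ifs
    · exact ⟨trivial, ih⟩
    · exact ih

theorem isMonotone_tree (leaf : ℕ → BoolFormula n) (h : ∀ g, (leaf g).IsMonotone) (ℓ g : ℕ) :
    (tree leaf ℓ g).IsMonotone := by
  induction ℓ generalizing g with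
  | zero => exact h g
  | succ ℓ ih =>
    unfold tree
    split_ifs <;> exact ⟨ih _, ih _⟩

theorem isMonotone_andChain (f : ℕ → BoolFormula n) (h : ∀ i, (f i).IsMonotone) (i : ℕ) :
    (andChain f i).IsMonotone := by
  induction i with
  | zero => exact h 0
  | succ i ih => exact ⟨ih, h _⟩

/-! #### Values -/

theorem eval_allVars (hn : 0 < n) (x : Fin n → Bool) :
    (allVars hn).eval x = true ↔ ∀ j, x j = true := by
  have : ∀ l : List (Fin n), (l.foldr (fun j φ => and (var j) φ) (var ⟨0, hn⟩)).eval x = true ↔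
      (∀ j ∈ l, x j = true) ∧ x ⟨0, hn⟩ = true := by
    intro l
    induction l with
    | nil => simp [eval]
    | cons j l ih => simp [eval, ih, and_assoc]
  rw [allVars, this]
  simp only [List.mem_finRange, true_implies]
  exact ⟨fun h => h.1, fun h => ⟨h, h _⟩⟩

theorem eval_group (hn : 0 < n) (H : Fin n → Prop) [DecidablePred H] (x : Fin n → Bool) :
    (group hn H).eval x = true ↔ (∃ j, H j ∧ x j = true) ∨ ∀ j, x j = true := by
  have : ∀ l : List (Fin n), (l.foldr (fun j φ => if H j then or (var j) φ else φ)
      (allVars hn)).eval x = true ↔ (∃ j ∈ l, H j ∧ x j = true) ∨ ∀ j, x j = true := by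
    intro l
    induction l with
    | nil => simp [eval_allVars]
    | cons j l ih =>
      by_cases h : H j
      · simp [eval, h, ih, or_assoc]
      · simp [h, ih]
  simp [group, this]

theorem eval_andChain (f : ℕ → BoolFormula n) (x : Fin n → Bool) (i : ℕ) :
    (andChain f i).eval x = true ↔ ∀ j ≤ i, (f j).eval x = true := by
  induction i with
  | zero => simp [andChain]
  | succ i ih =>
    simp only [andChain, eval, Bool.and_eq_true, ih]
    constructor
    · rintro ⟨h1, h2⟩ j hj
      rcases Nat.le_or_eq_of_le_succ hj with h | rfl
      exacts [h1 j h, h2]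
    · exact fun h => ⟨fun j hj => h j (by omega), h _ le_rfl⟩

end BoolFormula

/-- The value of the tree of height `ℓ` whose leaves `g, …, g + 2 ^ ℓ - 1` have the values `leaf`:
odd levels are disjunctions, even levels conjunctions. -/
def treeVal (leaf : ℕ → Prop) : ℕ → ℕ → Prop
  | 0, g => leaf g
  | ℓ + 1, g => if (ℓ + 1) % 2 = 1 then treeVal leaf ℓ g ∨ treeVal leaf ℓ (g + 2 ^ ℓ)
      else treeVal leaf ℓ g ∧ treeVal leaf ℓ (g + 2 ^ ℓ)

theorem treeVal_mono {leaf leaf' : ℕ → Prop} (h : ∀ g, leaf g → leaf' g) (ℓ g : ℕ) :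
    treeVal leaf ℓ g → treeVal leaf' ℓ g := by
  induction ℓ generalizing g with
  | zero => exact h g
  | succ ℓ ih =>
    unfold treeVal
    split_ifs
    · exact Or.imp (ih _) (ih _)
    · exact And.imp (ih _) (ih _)

theorem treeVal_of_forall {leaf : ℕ → Prop} (h : ∀ g, leaf g) (ℓ g : ℕ) : treeVal leaf ℓ g := by
  induction ℓ generalizing g with
  | zero => exact h g
  | succ ℓ ih =>
    unfold treeVal
    split_ifs
    · exact Or.inl (ih _)
    · exact ⟨ih _, ih _⟩

theorem BoolFormula.eval_tree {n : ℕ} (leaf : ℕ → BoolFormula n) (x : Fin n → Bool) (ℓ g : ℕ) :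
    (tree leaf ℓ g).eval x = true ↔ treeVal (fun g => (leaf g).eval x = true) ℓ g := by
  induction ℓ generalizing g with
  | zero => rfl
  | succ ℓ ih =>
    rcases Nat.mod_two_eq_zero_or_one (ℓ + 1) with h | h <;>
      simp [tree, treeVal, eval, h, ih]

/-- The value of the random tree with threshold `τ` at the point `y` of `{0,1}^N` (given as a set of
indices): a leaf is true if one of the indices in `y` is drawn in its group. -/
def sampleVal (U : ℕ → ℕ) (N D τ : ℕ) (y : Finset ℕ) : Prop :=
  treeVal (fun g => ∃ c ∈ y, U (g * N + c) < τ) D 0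

/-- The table `U` is good if, for every `k` up to `Δ`, the tree computes the threshold function
that separates the weights `≤ 2 * k - 2` from the weights `≥ 2 * k`. -/
def GoodTable (U : ℕ → ℕ) (N Δ Q D : ℕ) : Prop :=
  ∀ k, 1 ≤ k → k ≤ Δ → ∀ y : Finset ℕ, y ⊆ Finset.range N →
    (2 * k ≤ y.card → sampleVal U N D (threshold Q k) y) ∧
    (y.card ≤ 2 * k - 2 → ¬ sampleVal U N D (threshold Q k) y)

/-- The doubled row `a`, restricted to `x`, as a set of indices: the `j`-th block of length `W`
contains `2 * a j` of them if `x j` holds. -/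
def blockSet {n : ℕ} (W : ℕ) (a : Fin n → ℕ) (x : Fin n → Bool) : Finset ℕ :=
  Finset.univ.biUnion fun j : Fin n =>
    if x j then (Finset.range (2 * a j)).image (fun t => j * W + t) else ∅

theorem mem_blockSet {n W : ℕ} {a : Fin n → ℕ} {x : Fin n → Bool} {c : ℕ} :
    c ∈ blockSet W a x ↔ ∃ j : Fin n, x j = true ∧ ∃ t < 2 * a j, j * W + t = c := by
  unfold blockSet
  simp only [Finset.mem_biUnion, Finset.mem_univ, true_and]
  refine exists_congr fun j => ?_
  by_cases h : x j = true <;> simp [h]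

theorem blockSet_subset {n W : ℕ} {a : Fin n → ℕ} {x : Fin n → Bool} (ha : ∀ j, 2 * a j ≤ W) :
    blockSet W a x ⊆ Finset.range (n * W) := by
  intro c hc
  obtain ⟨j, -, t, ht, rfl⟩ := mem_blockSet.1 hc
  have : (j : ℕ) * W + W ≤ n * W := by
    rw [← Nat.succ_mul]; exact Nat.mul_le_mul_right _ j.2
  have := ha j
  simp only [Finset.mem_range]
  omega

theorem card_blockSet {n W : ℕ} {a : Fin n → ℕ} {x : Fin n → Bool} (ha : ∀ j, 2 * a j ≤ W) :
    (blockSet W a x).card = 2 * ∑ j, a j * (x j).toNat := by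
  unfold blockSet
  rw [Finset.card_biUnion, Finset.mul_sum]
  · refine Finset.sum_congr rfl fun j _ => ?_
    by_cases h : x j = true
    · rw [if_pos h, Finset.card_image_of_injective _ (add_right_injective _), Finset.card_range]
      simp [h]
    · simp [h]
  · intro i _ j _ hij
    rw [Function.onFun, Finset.disjoint_left]
    intro c hi hj
    split_ifs at hi hj <;> simp only [Finset.mem_image, Finset.mem_range, Finset.notMem_empty]
      at hi hj
    obtain ⟨t, ht, rfl⟩ := hi
    obtain ⟨u, hu, h⟩ := hj
    have := ha i
    have := ha j
    apply hij
    ext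
    rcases lt_trichotomy (i : ℕ) j with h' | h' | h'
    · have : (i : ℕ) * W + W ≤ j * W := by
        rw [← Nat.succ_mul]; exact Nat.mul_le_mul_right _ h'
      omega
    · exact h'
    · have : (j : ℕ) * W + W ≤ i * W := by
        rw [← Nat.succ_mul]; exact Nat.mul_le_mul_right _ h'
      omega

/-- The formula of one row. -/
noncomputable def rowFormula {n : ℕ} (hn : 0 < n) (U row : ℕ → ℕ) (Q W D k : ℕ) : BoolFormula n :=
  BoolFormula.tree (fun g => BoolFormula.group hn fun j =>
    hit U (threshold Q k) (2 * row j) W (g * (n * W) + j * W)) D 0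

theorem code_rowFormula {n : ℕ} (hn : 0 < n) (U row : ℕ → ℕ) (Q W D k : ℕ) :
    (rowFormula hn U row Q W D k).code = rowCode U row n Q W D k := by
  unfold rowFormula rowCode
  rw [BoolFormula.code_tree]
  congr 1
  funext g
  exact BoolFormula.code_group hn _ (fun j => hit U (threshold Q k) (2 * row j) W
    (g * (n * W) + j * W)) fun j => Iff.rfl

theorem eval_rowFormula {n : ℕ} (hn : 0 < n) {U row : ℕ → ℕ} {Q D k Δ : ℕ} {x : Fin n → Bool}
    (hU : GoodTable U (n * (2 * Δ)) Δ Q D) (hrow : ∀ j : Fin n, row j ≤ Δ) (hk : 1 ≤ k)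
    (hkΔ : k ≤ Δ) (hfeas : k ≤ ∑ j : Fin n, row j) :
    (rowFormula hn U row Q (2 * Δ) D k).eval x = true ↔
      k ≤ ∑ j : Fin n, row j * (x j).toNat := by
  unfold rowFormula
  rw [BoolFormula.eval_tree]
  by_cases hx : ∀ j, x j = true
  · simp only [hx, Bool.toNat_true, mul_one]
    refine iff_of_true (treeVal_of_forall (fun g => ?_) _ _) hfeas
    exact (BoolFormula.eval_group hn _ x).2 (Or.inr hx)
  · have hsub : ∀ j : Fin n, 2 * row j ≤ 2 * Δ := fun j => Nat.mul_le_mul_left _ (hrow j)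
    set y := blockSet (2 * Δ) (fun j : Fin n => row j) x with hy
    have hcard : y.card = 2 * ∑ j : Fin n, row j * (x j).toNat := card_blockSet hsub
    have hval : treeVal (fun g => (BoolFormula.group hn fun j : Fin n =>
        hit U (threshold Q k) (2 * row j) (2 * Δ) (g * (n * (2 * Δ)) + j * (2 * Δ))).eval x = true)
        D 0 ↔ sampleVal U (n * (2 * Δ)) D (threshold Q k) y := by
      unfold sampleVal
      refine Eq.to_iff (congrArg (fun f => treeVal f D 0) (funext fun g => propext ?_))
      rw [BoolFormula.eval_group, or_iff_left hx]
      constructor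
      · rintro ⟨j, ⟨t, ht, h1, h2⟩, hxj⟩
        exact ⟨_, mem_blockSet.2 ⟨j, hxj, t, h2, rfl⟩, by rwa [← add_assoc]⟩
      · rintro ⟨c, hc, h⟩
        obtain ⟨j, hxj, t, ht, rfl⟩ := mem_blockSet.1 hc
        exact ⟨j, ⟨t, ht.trans_le (hsub j), by rwa [add_assoc], ht⟩, hxj⟩
    rw [hval]
    obtain ⟨h1, h2⟩ := hU k hk hkΔ y (blockSet_subset hsub)
    constructor
    · intro h
      by_contra hc
      exact h2 (by omega) h
    · intro h
      exact h1 (by omega)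

/-- With a good table, the conjunction of the row formulas is a monotone formula for the covering
set. -/
theorem exists_formula_of_goodTable {m n Δ Q D : ℕ} (A : Matrix (Fin m) (Fin n) ℕ)
    (b : Fin m → ℕ) (hm : 0 < m) (hn : 0 < n) (hA : ∀ i j, A i j ≤ Δ)
    (hb : ∀ i, 1 ≤ b i ∧ b i ≤ Δ) (hne : (coveringSet A b).Nonempty) {U : ℕ → ℕ}
    (hU : GoodTable U (n * (2 * Δ)) Δ Q D) (row : ℕ → ℕ → ℕ) (rhs : ℕ → ℕ)
    (hrow : ∀ (i : Fin m) (j : Fin n), row i j = A i j) (hrhs : ∀ i : Fin m, rhs i = b i) :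
    ∃ φ : BoolFormula n, φ.code = List.replicate (m - 1) 0 ++
        ((List.range m).flatMap fun i => rowCode U (row i) n Q (2 * Δ) D (rhs i)) ∧
      φ.IsMonotone ∧ φ.definedSet = coveringSet A b ∧ φ.size ≤ m * (2 ^ D * (2 * n + 1)) := by
  refine ⟨BoolFormula.andChain (fun i => rowFormula hn U (row i) Q (2 * Δ) D (rhs i)) (m - 1),
    ?_, ?_, ?_, ?_⟩
  · rw [BoolFormula.code_andChain, Nat.sub_add_cancel hm]
    simp only [code_rowFormula]
  · exact BoolFormula.isMonotone_andChain _ (fun i => BoolFormula.isMonotone_tree _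
      (fun g => BoolFormula.isMonotone_group _ _) _ _) _
  · ext x
    obtain ⟨z, hz⟩ := hne
    simp only [BoolFormula.definedSet, coveringSet, Set.mem_ofPred_eq, BoolFormula.eval_andChain]
    have key : ∀ i : Fin m, (rowFormula hn U (row i) Q (2 * Δ) D (rhs i)).eval x = true ↔
        b i ≤ A.mulVec (fun j => (x j).toNat) i := by
      intro i
      rw [hrhs, eval_rowFormula hn hU (fun j => by rw [hrow]; exact hA i j) (hb i).1 (hb i).2]
      · simp only [Matrix.mulVec, dotProduct, hrow]
      · refine (hz i).trans ?_
        simp only [Matrix.mulVec, dotProduct, hrow]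
        refine Finset.sum_le_sum fun j _ => ?_
        exact (Nat.mul_le_mul_left _ (Bool.toNat_le _)).trans (mul_one _).le
    constructor
    · intro h i
      exact (key i).1 (h i (by omega))
    · intro h i hi
      exact (key ⟨i, by omega⟩).2 (h _)
  · refine (BoolFormula.size_andChain_le _ (2 ^ D * (2 * n + 1)) (fun i =>
      BoolFormula.size_tree_le _ _ (fun g => BoolFormula.size_group_le _ _) _ _) _).trans ?_
    rw [Nat.sub_add_cancel hm]

/-! ### Probabilities over the random tape -/

/-- The probability of the event `p` if the first `T` bits of the tape are fair and independent and
all others are `0`. -/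
noncomputable def prob (T : ℕ) (p : (ℕ → Bool) → Prop) : ℝ :=
  ({r : Fin T → Bool | p (RamProg.tape r)}.ncard : ℝ) / 2 ^ T

/-- The event `p` depends only on the bits in `S`. -/
def DependsOnBits (p : (ℕ → Bool) → Prop) (S : Set ℕ) : Prop :=
  ∀ ω ω' : ℕ → Bool, (∀ i ∈ S, ω i = ω' i) → (p ω ↔ p ω')

theorem DependsOnBits.mono {p : (ℕ → Bool) → Prop} {S S' : Set ℕ} (h : DependsOnBits p S)
    (hS : S ⊆ S') : DependsOnBits p S' :=
  fun ω ω' hω => h ω ω' fun i hi => hω i (hS hi)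

theorem DependsOnBits.not {p : (ℕ → Bool) → Prop} {S : Set ℕ} (h : DependsOnBits p S) :
    DependsOnBits (fun ω => ¬ p ω) S :=
  fun ω ω' hω => (h ω ω' hω).not

theorem DependsOnBits.and {p q : (ℕ → Bool) → Prop} {S : Set ℕ} (hp : DependsOnBits p S)
    (hq : DependsOnBits q S) : DependsOnBits (fun ω => p ω ∧ q ω) S :=
  fun ω ω' hω => and_congr (hp ω ω' hω) (hq ω ω' hω)

theorem DependsOnBits.or {p q : (ℕ → Bool) → Prop} {S : Set ℕ} (hp : DependsOnBits p S)
    (hq : DependsOnBits q S) : DependsOnBits (fun ω => p ω ∨ q ω) S :=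
  fun ω ω' hω => or_congr (hp ω ω' hω) (hq ω ω' hω)

section prob

variable {T : ℕ} {p q : (ℕ → Bool) → Prop}

theorem prob_mono (h : ∀ ω, p ω → q ω) : prob T p ≤ prob T q := by
  unfold prob
  gcongr
  · exact Set.toFinite _
  · exact h _

theorem prob_true : prob T (fun _ => True) = 1 := by
  simp [prob, Set.ncard_univ]

theorem prob_not : prob T (fun ω => ¬ p ω) = 1 - prob T p := by
  unfold prob
  have h := Set.ncard_add_ncard_compl {r : Fin T → Bool | p (RamProg.tape r)}
  have hc : {r : Fin T → Bool | p (RamProg.tape r)}ᶜ = {r | ¬ p (RamProg.tape r)} := rfl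
  have hcard : (Nat.card (Fin T → Bool) : ℝ) = 2 ^ T := by simp
  rw [hc] at h
  rw [eq_sub_iff_add_eq, ← add_div, div_eq_one_iff_eq (by positivity), ← hcard, ← h]
  push_cast
  ring

theorem prob_or_le : prob T (fun ω => p ω ∨ q ω) ≤ prob T p + prob T q := by
  unfold prob
  rw [← add_div]
  gcongr
  exact_mod_cast Set.ncard_union_le {r : Fin T → Bool | p (RamProg.tape r)} {r | q (RamProg.tape r)}

theorem prob_or (h : ∀ ω, p ω → ¬ q ω) :
    prob T (fun ω => p ω ∨ q ω) = prob T p + prob T q := by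
  unfold prob
  rw [← add_div]
  congr 1
  exact_mod_cast Set.ncard_union_eq (s := {r : Fin T → Bool | p (RamProg.tape r)})
    (t := {r | q (RamProg.tape r)}) (Set.disjoint_left.2 fun r hr hr' => h _ hr hr')

theorem prob_exists_le {ι : Type*} (F : Finset ι) (p : ι → (ℕ → Bool) → Prop) (ε : ℝ)
    (h : ∀ i ∈ F, prob T (p i) ≤ ε) : prob T (fun ω => ∃ i ∈ F, p i ω) ≤ F.card * ε := by
  classical
  induction F using Finset.induction_on with
  | empty => simp [prob]
  | insert a F ha ih =>
    have h1 : (fun ω => ∃ i ∈ insert a F, p i ω) = fun ω => p a ω ∨ ∃ i ∈ F, p i ω := by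
      funext ω; simp
    rw [h1, Finset.card_insert_of_notMem ha]
    refine prob_or_le.trans ?_
    have h2 := ih fun i hi => h i (Finset.mem_insert_of_mem hi)
    have h3 := h a (Finset.mem_insert_self _ _)
    push_cast
    linarith

/-- Events that depend on disjoint sets of bits are independent. The proof exchanges the bits
outside of `S` between two tapes. -/
theorem prob_and {S S' : Set ℕ} (hS : Disjoint S S') (hp : DependsOnBits p S)
    (hq : DependsOnBits q S') : prob T (fun ω => p ω ∧ q ω) = prob T p * prob T q := by
  classical
  let mix : (Fin T → Bool) → (Fin T → Bool) → Fin T → Bool :=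
    fun r r' i => if (i : ℕ) ∈ S then r i else r' i
  have hinv : Function.Involutive fun z : (Fin T → Bool) × (Fin T → Bool) =>
      (mix z.1 z.2, mix z.2 z.1) := by
    rintro ⟨r, r'⟩
    refine Prod.ext ?_ ?_ <;> funext i <;> simp only [mix] <;> split_ifs <;> rfl
  let e := hinv.toPerm
  have hpm : ∀ r r', p (RamProg.tape (mix r r')) ↔ p (RamProg.tape r) := fun r r' =>
    hp _ _ fun i hi => by simp [RamProg.tape, mix, hi]
  have hqm : ∀ r r', q (RamProg.tape (mix r' r)) ↔ q (RamProg.tape r) := fun r r' =>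
    hq _ _ fun i hi => by
      simp [RamProg.tape, mix, Set.disjoint_right.1 hS hi]
  have himg : e '' ({r | p (RamProg.tape r) ∧ q (RamProg.tape r)} ×ˢ Set.univ) =
      {r | p (RamProg.tape r)} ×ˢ {r | q (RamProg.tape r)} := by
    ext ⟨r, r'⟩
    constructor
    · rintro ⟨⟨u, v⟩, ⟨⟨h1, h2⟩, -⟩, h⟩
      obtain ⟨rfl, rfl⟩ := Prod.ext_iff.1 h
      exact ⟨(hpm u v).2 h1, (hqm u v).2 h2⟩
    · rintro ⟨h1, h2⟩
      refine ⟨(mix r r', mix r' r), ⟨⟨(hpm r r').2 h1, (hqm r' r).2 h2⟩, trivial⟩, hinv (r, r')⟩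
  have hcard := Set.ncard_image_of_injective
    ({r | p (RamProg.tape r) ∧ q (RamProg.tape r)} ×ˢ (Set.univ : Set (Fin T → Bool))) e.injective
  rw [himg, Set.ncard_prod, Set.ncard_prod, Set.ncard_univ] at hcard
  have hcard' : (Nat.card (Fin T → Bool) : ℝ) = 2 ^ T := by simp
  unfold prob
  rw [div_mul_div_comm, div_eq_div_iff (by positivity) (by positivity), ← hcard']
  have : (({r : Fin T → Bool | p (RamProg.tape r)}.ncard *
    {r : Fin T → Bool | q (RamProg.tape r)}.ncard : ℕ) : ℝ) = _ := congrArg Nat.cast hcard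
  push_cast at this
  rw [this]
  ring

theorem prob_bit {i : ℕ} (hi : i < T) (v : Bool) : prob T (fun ω => ω i = v) = 1 / 2 := by
  have hflip : ∀ v, prob T (fun ω => ω i = v) = prob T (fun ω => ω i = !v) := by
    intro v
    have hinv : Function.Involutive fun r : Fin T → Bool =>
        Function.update r ⟨i, hi⟩ (!(r ⟨i, hi⟩)) := by
      intro r
      simp
    unfold prob
    congr 2
    rw [← Set.ncard_image_of_injective _ hinv.injective]
    congr 1
    ext r
    constructor
    · rintro ⟨u, hu, rfl⟩
      simpa [RamProg.tape, hi] using hu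
    · intro hr
      refine ⟨_, ?_, hinv r⟩
      have : r ⟨i, hi⟩ = !v := by simpa [RamProg.tape, hi] using hr
      simp [RamProg.tape, hi, this]
  have h1 := hflip v
  have h2 : prob T (fun ω => ω i = !v) = 1 - prob T (fun ω => ω i = v) := by
    rw [← prob_not]
    congr 1
    funext ω
    cases ω i <;> cases v <;> simp
  linarith

end prob

theorem bitsVal_congr {ω ω' : ℕ → Bool} {p s : ℕ} (h : ∀ i, p ≤ i → i < p + s → ω i = ω' i) :
    bitsVal ω p s = bitsVal ω' p s := by
  induction s with
  | zero => rfl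
  | succ s ih =>
    rw [bitsVal, bitsVal, ih fun i h1 h2 => h i h1 (by omega), h (p + s) (by omega) (by omega)]

theorem prob_bitsVal_eq {T p s v : ℕ} (hT : p + s ≤ T) (hv : v < 2 ^ s) :
    prob T (fun ω => bitsVal ω p s = v) = 1 / 2 ^ s := by
  induction s generalizing v with
  | zero =>
    obtain rfl : v = 0 := by simpa using hv
    simpa [bitsVal] using prob_true
  | succ s ih =>
    have hv' : v / 2 < 2 ^ s := by rw [pow_succ] at hv; omega
    have h : (fun ω => bitsVal ω p (s + 1) = v) =
        fun ω => bitsVal ω p s = v / 2 ∧ ω (p + s) = decide (v % 2 = 1) := by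
      funext ω
      rw [bitsVal]
      rcases Nat.mod_two_eq_zero_or_one v with h | h <;> cases ω (p + s) <;> simp [h] <;> omega
    rw [h, prob_and (S := {i | p ≤ i ∧ i < p + s}) (S' := {p + s}), ih (by omega) hv',
      prob_bit (by omega), pow_succ]
    · field_simp
    · rw [Set.disjoint_singleton_right]
      simp
    · intro ω ω' hω
      beta_reduce
      rw [bitsVal_congr fun i h1 h2 => hω i ⟨h1, h2⟩]
    · intro ω ω' hω
      beta_reduce
      rw [hω _ rfl]

theorem prob_bitsVal_lt {T p s τ : ℕ} (hT : p + s ≤ T) (hτ : τ ≤ 2 ^ s) :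
    prob T (fun ω => bitsVal ω p s < τ) = τ / 2 ^ s := by
  induction τ with
  | zero => simp [prob]
  | succ τ ih =>
    have h : (fun ω => bitsVal ω p s < τ + 1) =
        fun ω => bitsVal ω p s < τ ∨ bitsVal ω p s = τ := by
      funext ω; rw [Nat.lt_succ_iff_lt_or_eq]
    rw [h, prob_or (fun ω h1 h2 => by omega), ih (by omega), prob_bitsVal_eq hT (by omega)]
    push_cast
    ring

/-- The bits of the table entries with index in `I`. -/
def entryBits (s : ℕ) (I : Set ℕ) : Set ℕ := (· / s) ⁻¹' I

theorem dependsOnBits_entry {s i τ : ℕ} :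
    DependsOnBits (fun ω => tableEntry ω s i < τ) (entryBits s {i}) := by
  intro ω ω' hω
  unfold tableEntry
  beta_reduce
  rw [bitsVal_congr fun b h1 h2 => hω b ?_]
  exact Nat.div_eq_of_lt_le h1 (by rwa [add_one_mul])

/-- The probability that no index in `y` is drawn in the group `g` is an exact power. -/
theorem prob_group_miss {T s N g τ : ℕ} (hτ : τ ≤ 2 ^ s) (hT : (g + 1) * N * s ≤ T)
    (y : Finset ℕ) (hy : y ⊆ Finset.range N) :
    prob T (fun ω => ¬ ∃ c ∈ y, tableEntry ω s (g * N + c) < τ) =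
      (1 - τ / 2 ^ s : ℝ) ^ y.card := by
  classical
  induction y using Finset.induction_on with
  | empty => simpa using prob_true
  | insert a y ha ih =>
    rw [Finset.insert_subset_iff] at hy
    have h : (fun ω => ¬ ∃ c ∈ insert a y, tableEntry ω s (g * N + c) < τ) =
        fun ω => (¬ tableEntry ω s (g * N + a) < τ) ∧
          ¬ ∃ c ∈ y, tableEntry ω s (g * N + c) < τ := by
      funext ω; simp
    have ha' : a < N := Finset.mem_range.1 hy.1
    have hbound : (g * N + a) * s + s ≤ T := by
      refine le_trans ?_ hT
      rw [← add_one_mul, add_one_mul g N]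
      exact Nat.mul_le_mul_right _ (by omega)
    rw [h, prob_and (S := entryBits s {g * N + a}) (S' := entryBits s {i | ∃ c ∈ y, i = g * N + c}),
      ih hy.2, Finset.card_insert_of_notMem ha, pow_succ', prob_not]
    · congr 2
      exact prob_bitsVal_lt hbound hτ
    · refine Disjoint.preimage _ ?_
      rw [Set.disjoint_singleton_left]
      rintro ⟨c, hc, h⟩
      exact ha (by rwa [show a = c by omega])
    · exact dependsOnBits_entry.not
    · intro ω ω' hω
      refine not_congr (exists_congr fun c => and_congr_right fun hc => ?_)
      refine dependsOnBits_entry ω ω' fun b hb => hω b ?_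
      exact ⟨c, hc, hb⟩

/-- The probability that the tree of height `ℓ` is false if each leaf is false with probability
`x`. -/
def treeMiss (x : ℝ) : ℕ → ℝ
  | 0 => x
  | ℓ + 1 => if (ℓ + 1) % 2 = 1 then treeMiss x ℓ ^ 2 else 1 - (1 - treeMiss x ℓ) ^ 2

theorem dependsOnBits_treeVal {s N τ : ℕ} (y : Finset ℕ) (hy : y ⊆ Finset.range N) (ℓ g : ℕ) :
    DependsOnBits (fun ω => treeVal (fun g => ∃ c ∈ y, tableEntry ω s (g * N + c) < τ) ℓ g)
      (entryBits s ((· / N) ⁻¹' {g' | g ≤ g' ∧ g' < g + 2 ^ ℓ})) := by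
  induction ℓ generalizing g with
  | zero =>
    intro ω ω' hω
    refine exists_congr fun c => and_congr_right fun hc => ?_
    refine dependsOnBits_entry ω ω' fun b hb => hω b ?_
    have hb : b / s = g * N + c := hb
    have hc := Finset.mem_range.1 (hy hc)
    have : b / s / N = g := by
      rw [hb]; exact Nat.div_eq_of_lt_le (by omega) (by rw [add_one_mul]; omega)
    simp only [entryBits, Set.mem_preimage, Set.mem_ofPred_eq]
    omega
  | succ ℓ ih =>
    have h1 := (ih g).mono (S' := entryBits s ((· / N) ⁻¹' {g' | g ≤ g' ∧ g' < g + 2 ^ (ℓ + 1)}))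
      (Set.preimage_mono (Set.preimage_mono fun i hi => ⟨hi.1, hi.2.trans_le (by
        rw [pow_succ]; omega)⟩))
    have h2 := (ih (g + 2 ^ ℓ)).mono
      (S' := entryBits s ((· / N) ⁻¹' {g' | g ≤ g' ∧ g' < g + 2 ^ (ℓ + 1)}))
      (Set.preimage_mono (Set.preimage_mono fun i hi => ⟨le_trans (Nat.le_add_right _ _) hi.1,
        hi.2.trans_le (by rw [pow_succ]; omega)⟩))
    unfold treeVal
    split_ifs
    · exact h1.or h2
    · exact h1.and h2

/-- Since the two subtrees of a node read disjoint parts of the table, the failure probabilities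
obey an exact recursion. -/
theorem prob_tree_miss {T s N τ : ℕ} (hτ : τ ≤ 2 ^ s) (y : Finset ℕ) (hy : y ⊆ Finset.range N)
    (ℓ g : ℕ) (hT : (g + 2 ^ ℓ) * N * s ≤ T) :
    prob T (fun ω => ¬ treeVal (fun g => ∃ c ∈ y, tableEntry ω s (g * N + c) < τ) ℓ g) =
      treeMiss ((1 - τ / 2 ^ s : ℝ) ^ y.card) ℓ := by
  induction ℓ generalizing g with
  | zero => exact prob_group_miss hτ (by simpa using hT) y hy
  | succ ℓ ih =>
    have hg : g + 2 ^ ℓ + 2 ^ ℓ = g + 2 ^ (ℓ + 1) := by rw [pow_succ]; omega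
    have h1 := ih g (le_trans (by gcongr <;> omega) hT)
    have h2 := ih (g + 2 ^ ℓ) (le_trans (by rw [hg]) hT)
    have d1 := dependsOnBits_treeVal (s := s) (τ := τ) y hy ℓ g
    have d2 := dependsOnBits_treeVal (s := s) (τ := τ) y hy ℓ (g + 2 ^ ℓ)
    have hdisj : Disjoint (entryBits s ((· / N) ⁻¹' {g' | g ≤ g' ∧ g' < g + 2 ^ ℓ}))
        (entryBits s ((· / N) ⁻¹' {g' | g + 2 ^ ℓ ≤ g' ∧ g' < g + 2 ^ ℓ + 2 ^ ℓ})) := by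
      refine Disjoint.preimage _ (Disjoint.preimage _ (Set.disjoint_left.2 ?_))
      rintro i ⟨-, hi⟩ ⟨hi', -⟩
      omega
    unfold treeVal treeMiss
    split_ifs
    · simp only [not_or]
      rw [prob_and hdisj d1.not d2.not, h1, h2, sq]
    · rw [prob_not, prob_and hdisj d1 d2]
      rw [prob_not] at h1 h2
      rw [← h1] at h2 ⊢
      rw [show prob T _ = prob T _ from sub_right_injective h2]
      ring

/-! ### Amplification -/

/-- The inverse of the golden ratio, the unstable fixed point of `amp`. -/
noncomputable def fixPt : ℝ := (√5 - 1) / 2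

theorem fixPt_sq : fixPt ^ 2 = 1 - fixPt := by
  have h : √5 ^ 2 = 5 := Real.sq_sqrt (by norm_num)
  unfold fixPt
  linear_combination h / 4

theorem lt_fixPt : 0.61803 < fixPt := by
  have : 2.23606 < √5 := Real.lt_sqrt_of_sq_lt (by norm_num)
  unfold fixPt
  norm_num at this ⊢
  linarith

theorem fixPt_lt : fixPt < 0.61804 := by
  have : √5 < 2.23608 := (Real.sqrt_lt' (by norm_num)).2 (by norm_num)
  unfold fixPt
  norm_num at this ⊢
  linarith

/-- The effect of two levels of the tree on the probability of the value false. -/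
def amp (x : ℝ) : ℝ := 1 - (1 - x ^ 2) ^ 2

theorem treeMiss_two_mul (x : ℝ) (d : ℕ) : treeMiss x (2 * d) = amp^[d] x := by
  induction d with
  | zero => rfl
  | succ d ih =>
    rw [Function.iterate_succ_apply', ← ih, show 2 * (d + 1) = 2 * d + 1 + 1 by ring]
    rw [treeMiss, if_neg (by omega), treeMiss, if_pos (by omega), amp]

theorem amp_mono {x y : ℝ} (hx : 0 ≤ x) (hxy : x ≤ y) (hy : y ≤ 1) : amp x ≤ amp y := by
  unfold amp
  gcongr
  nlinarith

theorem amp_nonneg {x : ℝ} (hx : 0 ≤ x) (hx' : x ≤ 1) : 0 ≤ amp x := by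
  have : x ^ 2 ≤ 1 := by nlinarith
  unfold amp
  nlinarith [sq_nonneg x]

theorem amp_le_one (x : ℝ) : amp x ≤ 1 := by
  unfold amp
  nlinarith [sq_nonneg (1 - x ^ 2)]

theorem iterate_amp_mem {x : ℝ} (hx : 0 ≤ x) (hx' : x ≤ 1) (t : ℕ) :
    0 ≤ amp^[t] x ∧ amp^[t] x ≤ 1 := by
  induction t with
  | zero => exact ⟨hx, hx'⟩
  | succ t ih =>
    rw [Function.iterate_succ_apply']
    exact ⟨amp_nonneg ih.1 ih.2, amp_le_one _⟩

theorem amp_fixPt_add (δ : ℝ) : amp (fixPt + δ) =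
    fixPt + (4 - 4 * fixPt) * δ + (6 * fixPt - 4) * δ ^ 2 - 4 * fixPt * δ ^ 3 - δ ^ 4 := by
  have h := fixPt_sq
  unfold amp
  linear_combination (-fixPt ^ 2 + fixPt - 4 * δ * (fixPt - 1) - 6 * δ ^ 2) * h

theorem amp_fixPt_sub_le {δ : ℝ} (h0 : 0 ≤ δ) (h1 : δ ≤ 1 / 100) :
    amp (fixPt - δ) ≤ fixPt - 32 / 21 * δ := by
  rw [sub_eq_add_neg, amp_fixPt_add]
  have hl := lt_fixPt
  have hu := fixPt_lt
  have h2 : 0 ≤ δ ^ 2 := by positivity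
  have h3 : δ ^ 3 ≤ δ ^ 2 * (1 / 100) := by
    rw [pow_succ]; gcongr
  have h4 : fixPt * δ ^ 3 ≤ 1 * (δ ^ 2 * (1 / 100)) := by gcongr; linarith
  have h5 : fixPt * δ ≤ 0.61804 * δ := by gcongr
  have h6 : fixPt * δ ^ 2 ≤ 0.61804 * δ ^ 2 := by gcongr
  have h7 : 0 ≤ δ ^ 4 := by positivity
  norm_num at h5 h6
  nlinarith

theorem le_amp_fixPt_add {δ : ℝ} (h0 : 0 ≤ δ) (h1 : δ ≤ 1 / 100) :
    fixPt + 32 / 21 * δ ≤ amp (fixPt + δ) := by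
  rw [amp_fixPt_add]
  have hl := lt_fixPt
  have hu := fixPt_lt
  have h2 : δ ^ 2 ≤ δ * (1 / 100) := by rw [sq]; gcongr
  have h3 : δ ^ 3 ≤ δ * (1 / 100) ^ 2 := by
    rw [pow_succ']; gcongr
  have h4 : δ ^ 4 ≤ δ * (1 / 100) ^ 3 := by
    rw [pow_succ']; gcongr
  have h5 : fixPt * δ ^ 3 ≤ 0.61804 * (δ * (1 / 100) ^ 2) := by gcongr
  have h6 : fixPt * δ ≤ 0.61804 * δ := by gcongr
  have h7 : 0.61803 * δ ^ 2 ≤ fixPt * δ ^ 2 := by gcongr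
  norm_num at h2 h3 h4 h5 h6 h7
  nlinarith

theorem iterate_amp_le_sub {x δ : ℝ} (hx : 0 ≤ x) (hδ : 0 ≤ δ) (h : x ≤ fixPt - δ) (t : ℕ) :
    amp^[t] x ≤ fixPt - min ((32 / 21) ^ t * δ) (1 / 100) := by
  have hl := lt_fixPt
  have hu := fixPt_lt
  norm_num at hl hu
  induction t with
  | zero =>
    have := min_le_left δ (1 / 100)
    simp only [pow_zero, one_mul, Function.iterate_zero, id]
    linarith
  | succ t ih =>
    rw [Function.iterate_succ_apply']
    set g := min ((32 / 21) ^ t * δ) (1 / 100) with hg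
    have hg0 : 0 ≤ g := le_min (by positivity) (by norm_num)
    have hg1 : g ≤ 1 / 100 := min_le_right _ _
    have hx0 := (iterate_amp_mem hx (by linarith) t).1
    refine (amp_mono hx0 ih (by linarith)).trans ((amp_fixPt_sub_le hg0 hg1).trans ?_)
    have : min ((32 / 21) ^ (t + 1) * δ) (1 / 100) ≤ 32 / 21 * g := by
      rw [hg, mul_min_of_nonneg _ _ (by norm_num)]
      refine min_le_min (le_of_eq (by ring)) (by norm_num)
    linarith

theorem le_iterate_amp_add {x δ : ℝ} (hx : x ≤ 1) (hδ : 0 ≤ δ) (h : fixPt + δ ≤ x) (t : ℕ) :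
    fixPt + min ((32 / 21) ^ t * δ) (1 / 100) ≤ amp^[t] x := by
  have hl := lt_fixPt
  have hu := fixPt_lt
  norm_num at hl hu
  induction t with
  | zero =>
    have := min_le_left δ (1 / 100)
    simp only [pow_zero, one_mul, Function.iterate_zero, id]
    linarith
  | succ t ih =>
    rw [Function.iterate_succ_apply']
    set g := min ((32 / 21) ^ t * δ) (1 / 100) with hg
    have hg0 : 0 ≤ g := le_min (by positivity) (by norm_num)
    have hg1 : g ≤ 1 / 100 := min_le_right _ _
    have hx1 := (iterate_amp_mem (by linarith) hx t).2
    refine le_trans ?_ ((le_amp_fixPt_add hg0 hg1).trans (amp_mono (by linarith) ih hx1))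
    have : min ((32 / 21) ^ (t + 1) * δ) (1 / 100) ≤ 32 / 21 * g := by
      rw [hg, mul_min_of_nonneg _ _ (by norm_num)]
      refine min_le_min (le_of_eq (by ring)) (by norm_num)
    linarith

/-- Away from the fixed points `0`, `fixPt` and `1`, every step of `amp` moves by a constant. -/
theorem iterate_amp_le_max {x : ℝ} (hx : 0 ≤ x) (h : x ≤ fixPt - 1 / 100) (t : ℕ) :
    amp^[t] x ≤ max (1 / 16) (fixPt - 1 / 100 - t / 2000) := by
  have hl := lt_fixPt
  have hu := fixPt_lt
  norm_num at hl hu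
  induction t with
  | zero => simpa using Or.inr h
  | succ t ih =>
    rw [Function.iterate_succ_apply']
    have hx0 := (iterate_amp_mem hx (by linarith) t).1
    set M := max (1 / 16 : ℝ) (fixPt - 1 / 100 - t / 2000) with hM
    have h1 : 1 / 16 ≤ M := le_max_left _ _
    have h2 : M ≤ fixPt - 1 / 100 := by
      refine max_le (by linarith) ?_
      have : (0 : ℝ) ≤ t := Nat.cast_nonneg _
      linarith
    have h3 : amp M ≤ M - 1 / 2000 := by
      have e : M - amp M = M * (1 - M) * (1 - M - M ^ 2) := by unfold amp; ring
      have e1 : 1 / 50 ≤ 1 - M - M ^ 2 := by nlinarith [fixPt_sq]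
      have e2 : 1 / 40 ≤ M * (1 - M) := by nlinarith
      nlinarith
    refine (amp_mono hx0 ih (by linarith)).trans (h3.trans ?_)
    rcases le_total (1 / 16 : ℝ) (fixPt - 1 / 100 - t / 2000) with h4 | h4
    · rw [hM, max_eq_right h4]
      refine le_trans ?_ (le_max_right _ _)
      push_cast
      linarith
    · rw [hM, max_eq_left h4]
      refine le_trans ?_ (le_max_left _ _)
      norm_num

theorem min_le_iterate_amp {x : ℝ} (hx : x ≤ 1) (h : fixPt + 1 / 100 ≤ x) (t : ℕ) :
    min (15 / 16) (fixPt + 1 / 100 + t / 2000) ≤ amp^[t] x := by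
  have hl := lt_fixPt
  have hu := fixPt_lt
  norm_num at hl hu
  induction t with
  | zero => simpa using Or.inr h
  | succ t ih =>
    rw [Function.iterate_succ_apply']
    have hx1 := (iterate_amp_mem (by linarith) hx t).2
    set M := min (15 / 16 : ℝ) (fixPt + 1 / 100 + t / 2000) with hM
    have h1 : M ≤ 15 / 16 := min_le_left _ _
    have h2 : fixPt + 1 / 100 ≤ M := by
      refine le_min (by linarith) ?_
      have : (0 : ℝ) ≤ t := Nat.cast_nonneg _
      linarith
    have h3 : M + 1 / 2000 ≤ amp M := by
      have e : amp M - M = M * (1 - M) * (M ^ 2 + M - 1) := by unfold amp; ring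
      have e1 : 1 / 50 ≤ M ^ 2 + M - 1 := by nlinarith [fixPt_sq]
      have e2 : 1 / 40 ≤ M * (1 - M) := by nlinarith
      nlinarith
    refine le_trans ?_ (h3.trans (amp_mono (by linarith) ih hx1))
    rcases le_total (15 / 16 : ℝ) (fixPt + 1 / 100 + t / 2000) with h4 | h4
    · rw [hM, min_eq_left h4]
      refine (min_le_left _ _).trans ?_
      norm_num
    · rw [hM, min_eq_right h4]
      refine (min_le_right _ _).trans ?_
      push_cast
      linarith

theorem iterate_amp_le_pow {x : ℝ} (hx : 0 ≤ x) (h : x ≤ 1 / 16) (t : ℕ) :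
    2 * amp^[t] x ≤ (1 / 4) ^ 2 ^ t := by
  induction t with
  | zero => simp only [pow_zero, pow_one, Function.iterate_zero, id]; linarith
  | succ t ih =>
    rw [Function.iterate_succ_apply', pow_succ 2, pow_mul]
    have h0 := (iterate_amp_mem hx (by linarith) t).1
    set y := amp^[t] x
    have h1 : amp y ≤ 2 * y ^ 2 := by unfold amp; nlinarith [sq_nonneg (y ^ 2)]
    calc 2 * amp y ≤ (2 * y) ^ 2 := by linarith
      _ ≤ _ := by gcongr

theorem one_sub_iterate_amp_le_pow {x : ℝ} (hx : x ≤ 1) (h : 15 / 16 ≤ x) (t : ℕ) :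
    4 * (1 - amp^[t] x) ≤ (1 / 4) ^ 2 ^ t := by
  induction t with
  | zero => simp only [pow_zero, pow_one, Function.iterate_zero, id]; linarith
  | succ t ih =>
    rw [Function.iterate_succ_apply', pow_succ 2, pow_mul]
    have h0 := iterate_amp_mem (by linarith) hx t
    set y := amp^[t] x
    have h1 : 1 - amp y ≤ 4 * (1 - y) ^ 2 := by
      have : 1 - amp y = (1 - y) ^ 2 * (1 + y) ^ 2 := by unfold amp; ring
      rw [this, mul_comm (4 : ℝ)]
      gcongr
      nlinarith
    calc 4 * (1 - amp y) ≤ (4 * (1 - y)) ^ 2 := by linarith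
      _ ≤ _ := by
        have : 0 ≤ 1 - y := by linarith
        gcongr

/-- The number of rounds that lead from distance `1 / 100` of the fixed point to distance `1 / 16`
of `0` or `1`. -/
def middleRounds : ℕ := 2000

theorem le_growth (Δ : ℕ) (hΔ : 1 ≤ Δ) :
    1 / 100 ≤ (32 / 21 : ℝ) ^ growthRounds Δ * (1 / (12 * Δ)) := by
  have h : ((21 ^ growthRounds Δ * Δ : ℕ) : ℝ) ≤ (32 ^ growthRounds Δ : ℕ) :=
    Nat.cast_le.2 (growthRounds_spec Δ)
  push_cast at h
  have h' : (Δ : ℝ) ≤ (32 / 21) ^ growthRounds Δ := by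
    rw [div_pow, le_div_iff₀ (by positivity)]; linarith
  have hΔ' : (0 : ℝ) < Δ := by exact_mod_cast hΔ
  rw [mul_one_div, le_div_iff₀ (by positivity)]
  linarith

theorem treeMiss_treeHeight (x : ℝ) (n Δ : ℕ) : treeMiss x (treeHeight middleRounds n Δ) =
    amp^[squaringRounds n Δ] (amp^[middleRounds] (amp^[growthRounds Δ] x)) := by
  rw [← Function.iterate_add_apply, ← Function.iterate_add_apply, ← treeMiss_two_mul]
  congr 1
  unfold treeHeight
  ring

theorem treeMiss_le {x : ℝ} {n Δ : ℕ} (hΔ : 1 ≤ Δ) (hx : 0 ≤ x)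
    (h : x ≤ fixPt - 1 / (12 * Δ)) :
    treeMiss x (treeHeight middleRounds n Δ) ≤ (1 / 4) ^ 2 ^ squaringRounds n Δ := by
  have hl := lt_fixPt
  have hu := fixPt_lt
  norm_num at hl hu
  have hΔ' : (0 : ℝ) ≤ 1 / (12 * Δ) := by positivity
  have hx1 : x ≤ 1 := by linarith
  rw [treeMiss_treeHeight]
  have h1 := iterate_amp_le_sub hx hΔ' h (growthRounds Δ)
  rw [min_eq_right (le_growth Δ hΔ)] at h1
  have m1 := iterate_amp_mem hx hx1 (growthRounds Δ)
  have h2 := iterate_amp_le_max m1.1 h1 middleRounds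
  rw [max_eq_left (by unfold middleRounds; push_cast; linarith)] at h2
  have m2 := iterate_amp_mem m1.1 m1.2 middleRounds
  have h3 := iterate_amp_le_pow m2.1 h2 (squaringRounds n Δ)
  have m3 := iterate_amp_mem m2.1 m2.2 (squaringRounds n Δ)
  linarith

theorem one_sub_treeMiss_le {x : ℝ} {n Δ : ℕ} (hΔ : 1 ≤ Δ) (hx : x ≤ 1)
    (h : fixPt + 1 / (12 * Δ) ≤ x) :
    1 - treeMiss x (treeHeight middleRounds n Δ) ≤ (1 / 4) ^ 2 ^ squaringRounds n Δ := by
  have hl := lt_fixPt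
  have hu := fixPt_lt
  norm_num at hl hu
  have hΔ' : (0 : ℝ) ≤ 1 / (12 * Δ) := by positivity
  have hx0 : 0 ≤ x := by linarith
  rw [treeMiss_treeHeight]
  have h1 := le_iterate_amp_add hx hΔ' h (growthRounds Δ)
  rw [min_eq_right (le_growth Δ hΔ)] at h1
  have m1 := iterate_amp_mem hx0 hx (growthRounds Δ)
  have h2 := min_le_iterate_amp m1.2 h1 middleRounds
  rw [min_eq_left (by unfold middleRounds; push_cast; linarith)] at h2
  have m2 := iterate_amp_mem m1.1 m1.2 middleRounds
  have h3 := one_sub_iterate_amp_le_pow m2.2 h2 (squaringRounds n Δ)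
  have m3 := iterate_amp_mem m2.1 m2.2 (squaringRounds n Δ)
  linarith

/-! ### The choice of the threshold -/

theorem pow_le_pow_add_mul_sub {a b : ℝ} (hb : 0 ≤ b) (hab : b ≤ a) (ha : a ≤ 1) (t : ℕ) :
    a ^ t ≤ b ^ t + t * (a - b) := by
  induction t with
  | zero => simp
  | succ t ih =>
    have h1 : b ^ t ≤ 1 := pow_le_one₀ hb (hab.trans ha)
    have h2 : a * a ^ t ≤ a * (b ^ t + t * (a - b)) := mul_le_mul_of_nonneg_left ih (hb.trans hab)
    have h3 : a * (t * (a - b)) ≤ 1 * (t * (a - b)) := by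
      have : 0 ≤ a - b := by linarith
      gcongr
    have h4 : (a - b) * b ^ t ≤ (a - b) * 1 := mul_le_mul_of_nonneg_left h1 (by linarith)
    rw [pow_succ', pow_succ']
    push_cast
    linarith

theorem le_fixPt_iff {z : ℝ} (hz : 0 ≤ z) : z ≤ fixPt ↔ (z + 1) * z ≤ 1 := by
  have h := fixPt_sq
  have hl := lt_fixPt
  norm_num at hl
  constructor
  · intro hle; nlinarith
  · intro hle
    by_contra hc
    nlinarith

theorem scale_ge (Δ : ℕ) : 64 * (Δ : ℝ) ^ 2 ≤ 4 ^ scaleExp Δ := by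
  have h : ((8 * Δ : ℕ) : ℝ) ≤ (2 ^ scaleExp Δ : ℕ) :=
    Nat.cast_le.2 (Nat.le_pow_clog (by norm_num) _)
  push_cast at h
  calc 64 * (Δ : ℝ) ^ 2 = (8 * Δ) ^ 2 := by ring
    _ ≤ (2 ^ scaleExp Δ) ^ 2 := by gcongr
    _ = 4 ^ scaleExp Δ := by rw [← pow_mul, mul_comm, pow_mul]; norm_num

theorem pow_test_iff {Q a e : ℕ} (hQ : 0 < Q) :
    (a ^ e + Q ^ e) * a ^ e ≤ Q ^ e * Q ^ e ↔ ((a : ℝ) / Q) ^ e ≤ fixPt := by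
  have hQ' : (0 : ℝ) < (Q : ℝ) ^ e := by positivity
  rw [le_fixPt_iff (by positivity), div_pow, div_add_one hQ'.ne', div_mul_div_comm,
    div_le_one (by positivity)]
  exact_mod_cast Iff.rfl

/-- The probability that a single index is not drawn. -/
noncomputable def missRatio (Δ k : ℕ) : ℝ := 1 - threshold (4 ^ scaleExp Δ) k / 4 ^ scaleExp Δ

theorem missRatio_eq {Δ k : ℕ} (hk : 1 ≤ k) : missRatio Δ k =
    ((4 ^ scaleExp Δ - threshold (4 ^ scaleExp Δ) k : ℕ) : ℝ) / (4 ^ scaleExp Δ : ℕ) := by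
  rw [Nat.cast_sub (threshold_le _ hk), missRatio]
  push_cast
  field_simp

theorem missRatio_nonneg {Δ k : ℕ} (hk : 1 ≤ k) : 0 ≤ missRatio Δ k := by
  rw [missRatio_eq hk]; positivity

theorem missRatio_le_one (Δ k : ℕ) : missRatio Δ k ≤ 1 := by
  have : (0 : ℝ) ≤ threshold (4 ^ scaleExp Δ) k / 4 ^ scaleExp Δ := by positivity
  unfold missRatio
  linarith

theorem missRatio_pow_le {Δ k : ℕ} (hk : 1 ≤ k) : missRatio Δ k ^ (2 * k - 1) ≤ fixPt := by
  rw [missRatio_eq hk]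
  exact (pow_test_iff (by positivity)).1 (threshold_spec _ hk)

theorem missRatio_le {Δ k : ℕ} (hk : 1 ≤ k) :
    missRatio Δ k ≤ 1 - (1 - fixPt) / (2 * k - 1 : ℕ) := by
  have hl := lt_fixPt
  have hu := fixPt_lt
  norm_num at hl hu
  have he : (1 : ℝ) ≤ (2 * k - 1 : ℕ) := by exact_mod_cast (by omega : 1 ≤ 2 * k - 1)
  have hd : (1 - fixPt) / (2 * k - 1 : ℕ) ≤ 1 := by
    rw [div_le_one (by linarith)]; linarith
  by_contra hc
  have h1 := one_add_mul_le_pow (a := -((1 - fixPt) / (2 * k - 1 : ℕ))) (by linarith) (2 * k - 1)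
  have h2 : (1 - (1 - fixPt) / (2 * k - 1 : ℕ)) ^ (2 * k - 1) < missRatio Δ k ^ (2 * k - 1) :=
    pow_lt_pow_left₀ (not_le.1 hc) (by linarith) (by omega)
  have h3 := missRatio_pow_le (Δ := Δ) hk
  have h4 : ((2 * k - 1 : ℕ) : ℝ) * -((1 - fixPt) / (2 * k - 1 : ℕ)) = -(1 - fixPt) := by
    field_simp
  rw [h4, ← sub_eq_add_neg, ← sub_eq_add_neg] at h1
  linarith

/-- By minimality of the threshold, a slightly larger ratio already exceeds the fixed point. -/
theorem lt_missRatio_add_pow {Δ k : ℕ} (hk : 1 ≤ k) :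
    fixPt < (missRatio Δ k + 1 / 4 ^ scaleExp Δ) ^ (2 * k - 1) ∧
      missRatio Δ k + 1 / 4 ^ scaleExp Δ ≤ 1 := by
  have hu := fixPt_lt
  norm_num at hu
  set Q := 4 ^ scaleExp Δ with hQ
  have hQ0 : 0 < Q := by positivity
  have hτ : threshold Q k ≠ 0 := by
    intro h0
    have := missRatio_pow_le (Δ := Δ) hk
    rw [missRatio, ← hQ, h0] at this
    simp at this
    linarith
  have h1 : missRatio Δ k + 1 / 4 ^ scaleExp Δ =
      ((Q - (threshold Q k - 1) : ℕ) : ℝ) / Q := by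
    have h2 := threshold_le Q hk
    rw [missRatio, ← hQ, Nat.cast_sub (by omega), Nat.cast_sub (by omega)]
    have : (Q : ℝ) = 4 ^ scaleExp Δ := by rw [hQ]; push_cast; rfl
    rw [← this]
    field_simp
    push_cast
    ring
  rw [h1]
  refine ⟨?_, ?_⟩
  · by_contra hc
    have h2 := (pow_test_iff hQ0).2 (not_lt.1 hc)
    have h3 : threshold Q k ≤ threshold Q k - 1 := Nat.sInf_le h2
    omega
  · rw [div_le_one (by positivity)]
    exact_mod_cast Nat.sub_le _ _

theorem missRatio_pow_le_sub {Δ k w : ℕ} (hk : 1 ≤ k) (hkΔ : k ≤ Δ) (hw : 2 * k ≤ w) :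
    missRatio Δ k ^ w ≤ fixPt - 1 / (12 * Δ) := by
  have hl := lt_fixPt
  have hu := fixPt_lt
  norm_num at hl hu
  have hΔ : (1 : ℝ) ≤ Δ := by exact_mod_cast hk.trans hkΔ
  have he : (1 : ℝ) ≤ (2 * k - 1 : ℕ) := by exact_mod_cast (by omega : 1 ≤ 2 * k - 1)
  have he' : ((2 * k - 1 : ℕ) : ℝ) ≤ 2 * Δ := by exact_mod_cast (by omega : 2 * k - 1 ≤ 2 * Δ)
  have h0 := missRatio_nonneg (Δ := Δ) hk
  have h1 := missRatio_le (Δ := Δ) hk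
  have h2 := missRatio_pow_le (Δ := Δ) hk
  calc missRatio Δ k ^ w ≤ missRatio Δ k ^ (2 * k - 1 + 1) :=
        pow_le_pow_of_le_one h0 (missRatio_le_one _ _) (by omega)
    _ = missRatio Δ k ^ (2 * k - 1) * missRatio Δ k := pow_succ _ _
    _ ≤ fixPt * (1 - (1 - fixPt) / (2 * k - 1 : ℕ)) :=
        mul_le_mul h2 h1 h0 (by linarith)
    _ ≤ fixPt * (1 - (1 - fixPt) / (2 * Δ)) := by gcongr; linarith
    _ ≤ fixPt - 1 / (12 * Δ) := by
        have : fixPt * (1 - fixPt) / (2 * Δ) ≥ 1 / (12 * Δ) := by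
          have hβ : 0.2 ≤ fixPt * (1 - fixPt) := by norm_num; nlinarith
          norm_num at hβ
          rw [ge_iff_le, div_le_div_iff₀ (by positivity) (by positivity)]
          nlinarith
        have e : fixPt * (1 - (1 - fixPt) / (2 * Δ)) =
          fixPt - fixPt * (1 - fixPt) / (2 * Δ) := by ring
        linarith

theorem add_le_missRatio_pow {Δ k w : ℕ} (hk : 1 ≤ k) (hkΔ : k ≤ Δ) (hw : w ≤ 2 * k - 2) :
    fixPt + 1 / (12 * Δ) ≤ missRatio Δ k ^ w := by
  have hl := lt_fixPt
  have hu := fixPt_lt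
  norm_num at hl hu
  have hΔ : (1 : ℝ) ≤ Δ := by exact_mod_cast hk.trans hkΔ
  have he : (1 : ℝ) ≤ (2 * k - 1 : ℕ) := by exact_mod_cast (by omega : 1 ≤ 2 * k - 1)
  have he' : ((2 * k - 1 : ℕ) : ℝ) ≤ 2 * Δ := by exact_mod_cast (by omega : 2 * k - 1 ≤ 2 * Δ)
  have h0 := missRatio_nonneg (Δ := Δ) hk
  have h1 := missRatio_le (Δ := Δ) hk
  obtain ⟨h2, h3⟩ := lt_missRatio_add_pow (Δ := Δ) hk
  have hQ := scale_ge Δ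
  set h := missRatio Δ k with hh
  set ε : ℝ := 1 / 4 ^ scaleExp Δ with hε
  have hε0 : 0 < ε := by positivity
  have hεle : ε ≤ 1 / (64 * Δ ^ 2) := one_div_le_one_div_of_le (by positivity) hQ
  have hw' : h ^ (2 * k - 2) ≤ h ^ w := pow_le_pow_of_le_one h0 (missRatio_le_one _ _) hw
  have h4 := pow_le_pow_add_mul_sub h0 (by linarith : h ≤ h + ε) h3 (2 * k - 2)
  rw [add_sub_cancel_left] at h4
  rw [show 2 * k - 1 = 2 * k - 2 + 1 by omega, pow_succ] at h2
  set p := (h + ε) ^ (2 * k - 2) with hp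
  have hp0 : 0 ≤ p := by positivity
  set e : ℝ := ((2 * k - 1 : ℕ) : ℝ) with hedef
  have hcast : ((2 * k - 2 : ℕ) : ℝ) = e - 1 := by
    rw [hedef, show 2 * k - 1 = 2 * k - 2 + 1 by omega]; push_cast; ring
  rw [hcast] at h4
  -- `p` exceeds the fixed point by its relative distance to `p * (h + ε)`
  have h5 : fixPt ≤ p := by nlinarith
  have h6 : p * (h + ε) ≤ p * (1 - ((1 - fixPt) / e - ε)) := by
    refine mul_le_mul_of_nonneg_left ?_ hp0
    linarith
  have hu0 : ε ≤ (1 - fixPt) / e := by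
    refine hεle.trans ?_
    rw [div_le_div_iff₀ (by positivity) (by positivity)]
    nlinarith
  have h7 : fixPt * ((1 - fixPt) / e - ε) ≤ p * ((1 - fixPt) / e - ε) :=
    mul_le_mul_of_nonneg_right h5 (by linarith)
  have h8 : fixPt + fixPt * ((1 - fixPt) / e) - e * ε ≤ h ^ (2 * k - 2) := by nlinarith
  have h9 : e * ε ≤ 1 / (32 * Δ) := by
    calc e * ε ≤ 2 * Δ * (1 / (64 * Δ ^ 2)) := by gcongr
      _ = 1 / (32 * Δ) := by field_simp; norm_num
  have h10 : 0.236 / (2 * Δ) ≤ fixPt * ((1 - fixPt) / e) := by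
    rw [mul_div_assoc']
    exact div_le_div₀ (by nlinarith) (by norm_num; nlinarith) (by linarith) he'
  have h11 : (1 : ℝ) / (12 * Δ) + 1 / (32 * Δ) ≤ 0.236 / (2 * Δ) := by
    rw [div_add_div _ _ (by positivity) (by positivity), div_le_div_iff₀ (by positivity)
      (by positivity)]
    norm_num
    nlinarith [pow_pos (by linarith : (0 : ℝ) < Δ) 2, pow_pos (by linarith : (0 : ℝ) < Δ) 3]
  linarith

/-! ### The union bound -/

theorem prob_sampleVal_false {T n Δ D k : ℕ} (hk : 1 ≤ k)
    (hT : 2 ^ D * (n * (2 * Δ)) * (2 * scaleExp Δ) ≤ T) (y : Finset ℕ)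
    (hy : y ⊆ Finset.range (n * (2 * Δ))) :
    prob T (fun ω => ¬ sampleVal (tableEntry ω (2 * scaleExp Δ)) (n * (2 * Δ)) D
      (threshold (4 ^ scaleExp Δ) k) y) = treeMiss (missRatio Δ k ^ y.card) D := by
  have h4 : 4 ^ scaleExp Δ = 2 ^ (2 * scaleExp Δ) := by rw [pow_mul]; norm_num
  have h4' : (4 : ℝ) ^ scaleExp Δ = 2 ^ (2 * scaleExp Δ) := by rw [pow_mul]; norm_num
  rw [missRatio, h4']
  exact prob_tree_miss ((threshold_le _ hk).trans h4.le) y hy D 0 (by rwa [zero_add])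

/-- Finitely many sets that include all subsets of `range N` with at most `r` elements. -/
def smallSets (N r : ℕ) : Finset (Finset ℕ) :=
  (Fintype.piFinset fun _ : Fin r => Finset.range (N + 1)).image
    fun f => (Finset.univ.image f).erase N

theorem card_smallSets_le (N r : ℕ) : (smallSets N r).card ≤ (N + 1) ^ r :=
  Finset.card_image_le.trans (by simp)

theorem mem_smallSets {N r : ℕ} {y : Finset ℕ} (hy : y ⊆ Finset.range N) (hr : y.card ≤ r) :
    y ∈ smallSets N r := by
  refine Finset.mem_image.2 ⟨fun i => if h : (i : ℕ) < y.card then y.orderEmbOfFin rfl ⟨i, h⟩ else N,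
    ?_, ?_⟩
  · rw [Fintype.mem_piFinset]
    intro i
    split_ifs with h
    · have := Finset.mem_range.1 (hy (y.orderEmbOfFin_mem rfl ⟨i, h⟩))
      rw [Finset.mem_range]; omega
    · simp
  · ext c
    simp only [Finset.mem_erase, Finset.mem_image, Finset.mem_univ, true_and]
    constructor
    · rintro ⟨hc, i, hi⟩
      split_ifs at hi with h
      · rw [← hi]; exact y.orderEmbOfFin_mem rfl _
      · exact absurd hi.symm hc
    · intro hc
      refine ⟨(Finset.mem_range.1 (hy hc)).ne, ?_⟩
      have : c ∈ Set.range (y.orderEmbOfFin rfl) := by rw [Finset.range_orderEmbOfFin]; exact hc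
      obtain ⟨j, hj⟩ := this
      exact ⟨⟨j, j.2.trans_le hr⟩, by simp [hj]⟩

theorem sampleVal_mono {U : ℕ → ℕ} {N D τ : ℕ} {y y' : Finset ℕ} (h : y ⊆ y')
    (hv : sampleVal U N D τ y) : sampleVal U N D τ y' :=
  treeVal_mono (fun _ ⟨c, hc, hlt⟩ => ⟨c, h hc, hlt⟩) _ _ hv

/-- It suffices to check small sets, since the trees are monotone. -/
theorem exists_bad_of_not_goodTable {U : ℕ → ℕ} {N Δ Q D : ℕ} (h : ¬ GoodTable U N Δ Q D) :
    ∃ z ∈ Finset.Icc 1 Δ ×ˢ (smallSets N (2 * Δ)).filter (· ⊆ Finset.range N),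
      (2 * z.1 ≤ z.2.card ∧ ¬ sampleVal U N D (threshold Q z.1) z.2) ∨
      (z.2.card ≤ 2 * z.1 - 2 ∧ sampleVal U N D (threshold Q z.1) z.2) := by
  unfold GoodTable at h
  push Not at h
  obtain ⟨k, hk, hkΔ, y, hy, h⟩ := h
  by_cases h1 : 2 * k ≤ y.card ∧ ¬ sampleVal U N D (threshold Q k) y
  · obtain ⟨y', hy', hcard⟩ := Finset.exists_subset_card_eq h1.1
    refine ⟨(k, y'), ?_, Or.inl ⟨hcard.ge, fun hv => h1.2 (sampleVal_mono hy' hv)⟩⟩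
    simp only [Finset.mem_product, Finset.mem_Icc, Finset.mem_filter]
    exact ⟨⟨hk, hkΔ⟩, mem_smallSets (hy'.trans hy) (by omega), hy'.trans hy⟩
  · have h2 := h fun h3 => by
      by_contra h4
      exact h1 ⟨h3, h4⟩
    refine ⟨(k, y), ?_, Or.inr h2⟩
    simp only [Finset.mem_product, Finset.mem_Icc, Finset.mem_filter]
    exact ⟨⟨hk, hkΔ⟩, mem_smallSets hy (by omega), hy⟩

theorem union_bound {n Δ : ℕ} (hn : 1 ≤ n) (hΔ : 1 ≤ Δ) :
    (Δ : ℝ) * (n * (2 * Δ) + 1 : ℕ) ^ (2 * Δ) * (1 / 4) ^ 2 ^ squaringRounds n Δ ≤ 1 / 3 := by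
  set b := indexBits n Δ with hb
  have hN : n * (2 * Δ) + 1 ≤ 2 ^ b := Nat.le_pow_clog (by norm_num) _
  have hΔN : Δ ≤ n * (2 * Δ) + 1 := by nlinarith
  have hb1 : 1 ≤ b := Nat.clog_pos (by norm_num) (by nlinarith)
  have hsq : b * (4 * Δ) ≤ 2 ^ squaringRounds n Δ := Nat.le_pow_clog (by norm_num) _
  have h1 : 3 * (Δ * (n * (2 * Δ) + 1) ^ (2 * Δ)) ≤ 4 ^ 2 ^ squaringRounds n Δ := by
    calc 3 * (Δ * (n * (2 * Δ) + 1) ^ (2 * Δ)) ≤ 2 ^ 2 * (2 ^ b * (2 ^ b) ^ (2 * Δ)) := by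
          gcongr
          · norm_num
          · exact hΔN.trans hN
      _ = 2 ^ (2 + (b + b * (2 * Δ))) := by rw [pow_add, pow_add, pow_mul 2 b]
      _ ≤ 2 ^ (2 * (b * (4 * Δ))) := Nat.pow_le_pow_right (by norm_num) (by nlinarith)
      _ = 4 ^ (b * (4 * Δ)) := by rw [pow_mul]; norm_num
      _ ≤ _ := Nat.pow_le_pow_right (by norm_num) hsq
  have h2 : (3 : ℝ) * (Δ * (n * (2 * Δ) + 1 : ℕ) ^ (2 * Δ)) ≤ 4 ^ 2 ^ squaringRounds n Δ := by
    exact_mod_cast h1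
  rw [one_div_pow, mul_one_div, div_le_div_iff₀ (by positivity) (by norm_num)]
  linarith

theorem prob_goodTable {T n Δ : ℕ} (hn : 1 ≤ n) (hΔ : 1 ≤ Δ)
    (hT : 2 ^ treeHeight middleRounds n Δ * (n * (2 * Δ)) * (2 * scaleExp Δ) ≤ T) :
    2 / 3 ≤ prob T (fun ω => GoodTable (tableEntry ω (2 * scaleExp Δ)) (n * (2 * Δ)) Δ
      (4 ^ scaleExp Δ) (treeHeight middleRounds n Δ)) := by
  set D := treeHeight middleRounds n Δ with hD
  set N := n * (2 * Δ) with hN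
  have hbad : prob T (fun ω => ¬ GoodTable (tableEntry ω (2 * scaleExp Δ)) N Δ
      (4 ^ scaleExp Δ) D) ≤ 1 / 3 := by
    refine (prob_mono fun ω h => exists_bad_of_not_goodTable h).trans ?_
    refine (prob_exists_le _ (fun (z : ℕ × Finset ℕ) ω =>
      (2 * z.1 ≤ z.2.card ∧ ¬ sampleVal (tableEntry ω (2 * scaleExp Δ)) N D
        (threshold (4 ^ scaleExp Δ) z.1) z.2) ∨
      (z.2.card ≤ 2 * z.1 - 2 ∧ sampleVal (tableEntry ω (2 * scaleExp Δ)) N D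
        (threshold (4 ^ scaleExp Δ) z.1) z.2))
      ((1 / 4) ^ 2 ^ squaringRounds n Δ) ?_).trans ?_
    · rintro ⟨k, y⟩ hz
      simp only [Finset.mem_product, Finset.mem_Icc, Finset.mem_filter] at hz
      obtain ⟨⟨hk, hkΔ⟩, -, hy⟩ := hz
      have hmiss := prob_sampleVal_false hk hT y hy
      by_cases hc : 2 * k ≤ y.card
      · refine (prob_mono (q := fun ω => ¬ sampleVal (tableEntry ω (2 * scaleExp Δ)) N D
          (threshold (4 ^ scaleExp Δ) k) y) fun ω h => ?_).trans (hmiss.trans_le ?_)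
        · rcases h with h | h
          · exact h.2
          · have h' : y.card ≤ 2 * k - 2 := h.1
            omega
        · exact treeMiss_le hΔ (pow_nonneg (missRatio_nonneg hk) _) (missRatio_pow_le_sub hk hkΔ hc)
      · by_cases hc' : y.card ≤ 2 * k - 2
        · rw [prob_not] at hmiss
          refine (prob_mono (q := fun ω => sampleVal (tableEntry ω (2 * scaleExp Δ)) N D
            (threshold (4 ^ scaleExp Δ) k) y) fun ω h => ?_).trans ?_
          · rcases h with h | h
            · exact absurd h.1 hc
            · exact h.2
          · have := one_sub_treeMiss_le (n := n) hΔ (pow_le_one₀ (n := y.card)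
              (missRatio_nonneg (Δ := Δ) hk) (missRatio_le_one _ _))
              (add_le_missRatio_pow hk hkΔ hc')
            rw [← hD] at this
            linarith
        · refine le_trans (le_of_eq ?_) (by positivity : (0 : ℝ) ≤ _)
          simp [prob, hc, hc']
    · refine le_trans ?_ (union_bound hn hΔ)
      gcongr
      rw [Finset.card_product, Nat.card_Icc, Nat.add_sub_cancel]
      push_cast
      gcongr
      exact_mod_cast (Finset.card_filter_le _ _).trans (card_smallSets_le _ _)
  rw [prob_not] at hbad
  linarith

/-! ### Bounds for the parameters -/

theorem two_pow_clog_le {x : ℕ} (hx : 1 ≤ x) : 2 ^ Nat.clog 2 x ≤ 2 * x := by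
  rcases hx.eq_or_lt with rfl | hx
  · simp
  · have h := Nat.pow_pred_clog_lt_self (b := 2) (by norm_num) hx
    have h1 : 0 < Nat.clog 2 x := Nat.clog_pos (by norm_num) hx
    rw [show Nat.clog 2 x = (Nat.clog 2 x).pred + 1 by
      rw [Nat.pred_eq_sub_one]; omega, pow_succ]
    omega

theorem clog_two_le (x : ℕ) : Nat.clog 2 x ≤ x :=
  Nat.clog_le_of_le_pow Nat.lt_two_pow_self.le

theorem growth_pow_le {Δ : ℕ} (hΔ : 1 ≤ Δ) :
    (32 / 21 : ℝ) ^ growthRounds Δ ≤ 32 / 21 * Δ := by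
  have hΔ' : (1 : ℝ) ≤ Δ := by exact_mod_cast hΔ
  rcases Nat.eq_zero_or_pos (growthRounds Δ) with h | h
  · rw [h, pow_zero]; linarith
  · obtain ⟨t, ht⟩ : ∃ t, growthRounds Δ = t + 1 := ⟨growthRounds Δ - 1, by omega⟩
    have h1 : ((32 ^ t : ℕ) : ℝ) < (21 ^ t * Δ : ℕ) :=
      Nat.cast_lt.2 (lt_of_lt_growthRounds (by omega))
    push_cast at h1
    have h2 : (32 / 21 : ℝ) ^ t ≤ Δ := by
      rw [div_pow, div_le_iff₀ (by positivity)]; linarith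
    rw [ht, pow_succ']
    gcongr

set_option exponentiation.threshold 1000 in
/-- Four copies are needed for a factor of `32 / 21`, so a gap of `1 / Δ` costs a factor
of about `Δ ^ (log 4 / log (32 / 21))`. -/
theorem four_le_rpow : (4 : ℝ) ≤ (32 / 21) ^ (3.295 : ℝ) := by
  have h : (4 : ℝ) ^ 200 ≤ (32 / 21) ^ 659 := by norm_num
  have h' : (4 : ℝ) ^ 200 ≤ ((32 / 21 : ℝ) ^ (3.295 : ℝ)) ^ 200 := by
    rw [← Real.rpow_natCast ((32 / 21 : ℝ) ^ (3.295 : ℝ)), ← Real.rpow_mul (by norm_num)]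
    refine h.trans (le_of_eq ?_)
    rw [← Real.rpow_natCast]
    norm_num
  exact le_of_pow_le_pow_left₀ (by norm_num) (by positivity) h'

theorem four_pow_growth_le {Δ : ℕ} (hΔ : 1 ≤ Δ) :
    (4 : ℝ) ^ growthRounds Δ ≤ 6 * (Δ : ℝ) ^ (3.295 : ℝ) := by
  calc (4 : ℝ) ^ growthRounds Δ ≤ ((32 / 21 : ℝ) ^ (3.295 : ℝ)) ^ growthRounds Δ := by
        gcongr; exact four_le_rpow
    _ = ((32 / 21 : ℝ) ^ growthRounds Δ) ^ (3.295 : ℝ) := by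
        rw [← Real.rpow_natCast, ← Real.rpow_mul (by norm_num), mul_comm, Real.rpow_mul (by norm_num),
          Real.rpow_natCast]
    _ ≤ (32 / 21 * Δ) ^ (3.295 : ℝ) :=
        Real.rpow_le_rpow (by positivity) (growth_pow_le hΔ) (by norm_num)
    _ = (32 / 21) ^ (3.295 : ℝ) * (Δ : ℝ) ^ (3.295 : ℝ) :=
        Real.mul_rpow (by norm_num) (by positivity)
    _ ≤ 6 * (Δ : ℝ) ^ (3.295 : ℝ) := by
        gcongr
        calc (32 / 21 : ℝ) ^ (3.295 : ℝ) ≤ (32 / 21) ^ (4 : ℝ) :=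
              Real.rpow_le_rpow_of_exponent_le (by norm_num) (by norm_num)
          _ ≤ 6 := by norm_num

theorem indexBits_pos {n Δ : ℕ} (hn : 1 ≤ n) (hΔ : 1 ≤ Δ) : 1 ≤ indexBits n Δ :=
  Nat.clog_pos (by norm_num) (by nlinarith)

theorem two_pow_squaringRounds_le {n Δ : ℕ} (hn : 1 ≤ n) (hΔ : 1 ≤ Δ) :
    2 ^ squaringRounds n Δ ≤ 8 * indexBits n Δ * Δ := by
  refine (two_pow_clog_le ?_).trans (by nlinarith)
  have := indexBits_pos hn hΔ
  nlinarith

theorem two_pow_treeHeight (c n Δ : ℕ) : 2 ^ treeHeight c n Δ =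
    4 ^ growthRounds Δ * (2 ^ squaringRounds n Δ) ^ 2 * 4 ^ c := by
  rw [treeHeight, pow_add, pow_add, pow_mul, pow_mul 2 2 c, mul_comm 2 (squaringRounds n Δ),
    pow_mul 2 _ 2]
  norm_num

/-! ### The running time is polynomial -/

/-- `f` is bounded by a polynomial in `m + n + Δ`, for positive `n` and `Δ`. The bound is required
at every upper bound of `m + n + Δ`. -/
def PolyBounded (f : ℕ → ℕ → ℕ → ℕ) : Prop :=
  ∃ p : Polynomial ℕ, ∀ m n Δ X, 1 ≤ n → 1 ≤ Δ → m + n + Δ ≤ X → f m n Δ ≤ p.eval X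

namespace PolyBounded

variable {f g : ℕ → ℕ → ℕ → ℕ}

theorem const (c : ℕ) : PolyBounded fun _ _ _ => c :=
  ⟨Polynomial.C c, fun m n Δ X _ _ h => by simp⟩

theorem fst : PolyBounded fun m _ _ => m :=
  ⟨Polynomial.X, fun m n Δ X _ _ h => by simp; omega⟩

theorem snd : PolyBounded fun _ n _ => n :=
  ⟨Polynomial.X, fun m n Δ X _ _ h => by simp; omega⟩

theorem thd : PolyBounded fun _ _ Δ => Δ :=
  ⟨Polynomial.X, fun m n Δ X _ _ h => by simp; omega⟩

theorem add (hf : PolyBounded f) (hg : PolyBounded g) :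
    PolyBounded fun m n Δ => f m n Δ + g m n Δ := by
  obtain ⟨p, hp⟩ := hf
  obtain ⟨q, hq⟩ := hg
  refine ⟨p + q, fun m n Δ X h1 h2 h => ?_⟩
  rw [Polynomial.eval_add]
  exact add_le_add (hp m n Δ X h1 h2 h) (hq m n Δ X h1 h2 h)

theorem mul (hf : PolyBounded f) (hg : PolyBounded g) :
    PolyBounded fun m n Δ => f m n Δ * g m n Δ := by
  obtain ⟨p, hp⟩ := hf
  obtain ⟨q, hq⟩ := hg
  refine ⟨p * q, fun m n Δ X h1 h2 h => ?_⟩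
  rw [Polynomial.eval_mul]
  exact Nat.mul_le_mul (hp m n Δ X h1 h2 h) (hq m n Δ X h1 h2 h)

theorem mono (hg : PolyBounded g) (h : ∀ m n Δ, 1 ≤ n → 1 ≤ Δ → f m n Δ ≤ g m n Δ) :
    PolyBounded f := by
  obtain ⟨p, hp⟩ := hg
  exact ⟨p, fun m n Δ X h1 h2 hX => (h m n Δ h1 h2).trans (hp m n Δ X h1 h2 hX)⟩

end PolyBounded

open PolyBounded in
theorem polyBounded_scaleExp : PolyBounded fun _ _ Δ => scaleExp Δ :=
  ((const 8).mul thd).mono fun _ _ _ _ _ => clog_two_le _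

open PolyBounded in
theorem polyBounded_scale : PolyBounded fun _ _ Δ => 4 ^ scaleExp Δ :=
  (((const 16).mul thd).mul ((const 16).mul thd)).mono fun _ _ Δ _ hΔ => by
    have h : 2 ^ scaleExp Δ ≤ 16 * Δ := (two_pow_clog_le (by omega)).trans (by omega)
    calc 4 ^ scaleExp Δ = 2 ^ scaleExp Δ * 2 ^ scaleExp Δ := by
          rw [← mul_pow]; norm_num
      _ ≤ _ := Nat.mul_le_mul h h

open PolyBounded in
theorem polyBounded_indexBits : PolyBounded fun _ n Δ => indexBits n Δ :=
  ((snd.mul ((const 2).mul thd)).add (const 1)).mono fun _ _ _ _ _ => clog_two_le _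

open PolyBounded in
theorem polyBounded_two_pow_squaringRounds : PolyBounded fun _ n Δ => 2 ^ squaringRounds n Δ :=
  (((const 8).mul polyBounded_indexBits).mul thd).mono fun _ _ _ hn hΔ =>
    two_pow_squaringRounds_le hn hΔ

theorem polyBounded_squaringRounds : PolyBounded fun _ n Δ => squaringRounds n Δ :=
  polyBounded_two_pow_squaringRounds.mono fun _ _ _ _ _ => Nat.lt_two_pow_self.le

open PolyBounded in
theorem polyBounded_growthRounds : PolyBounded fun _ _ Δ => growthRounds Δ :=
  ((const 2).mul thd).mono fun _ _ Δ _ _ => growthRounds_le Δ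

open PolyBounded in
theorem polyBounded_four_pow_growthRounds : PolyBounded fun _ _ Δ => 4 ^ growthRounds Δ :=
  ((const 6).mul (thd.mul (thd.mul (thd.mul thd)))).mono fun _ _ Δ _ hΔ => by
    have hΔ' : (1 : ℝ) ≤ Δ := by exact_mod_cast hΔ
    have h : (4 : ℝ) ^ growthRounds Δ ≤ 6 * (Δ : ℝ) ^ 4 := by
      refine (four_pow_growth_le hΔ).trans ?_
      rw [← Real.rpow_natCast]
      gcongr
      norm_num
    have h' : 4 ^ growthRounds Δ ≤ 6 * Δ ^ 4 := by exact_mod_cast h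
    exact h'.trans (le_of_eq (by ring))

open PolyBounded in
theorem polyBounded_two_pow_treeHeight (c : ℕ) :
    PolyBounded fun _ n Δ => 2 ^ treeHeight c n Δ :=
  ((polyBounded_four_pow_growthRounds.mul (polyBounded_two_pow_squaringRounds.mul
    polyBounded_two_pow_squaringRounds)).mul (const (4 ^ c))).mono fun _ n Δ _ _ => by
      rw [two_pow_treeHeight, sq]

open PolyBounded in
theorem polyBounded_treeHeight (c : ℕ) : PolyBounded fun _ n Δ => treeHeight c n Δ :=
  (((const 2).mul polyBounded_growthRounds).add ((const 2).mul polyBounded_squaringRounds)).add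
    (const (2 * c))

open PolyBounded in
theorem polyBounded_setupTime (c : ℕ) : PolyBounded (RamProg.setupTime c) :=
  ((fst.mul (const 3)).add (const 6)).add
    (((((fst.mul snd).add fst).mul (const 5)).add (const 3)).add
    (((polyBounded_scaleExp.mul (const 4)).add (const 6)).add
    (((polyBounded_growthRounds.mul (const 14)).add (const 4)).add
    ((((snd.mul (const 3)).add (polyBounded_indexBits.mul (const 6))).add (const 10)).add
    (((polyBounded_squaringRounds.mul (const 4)).add
      ((polyBounded_treeHeight c).mul (const 3))).add (const 9))))))

open PolyBounded in
theorem polyBounded_runTime (c : ℕ) : PolyBounded (RamProg.runTime c) := by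
  have hΔ : PolyBounded fun _ _ Δ => 2 * Δ - 1 :=
    ((const 2).mul thd).mono fun _ _ _ _ _ => Nat.sub_le _ _
  have hpow : PolyBounded fun _ n Δ => 2 ^ (treeHeight c n Δ + 1) :=
    ((polyBounded_two_pow_treeHeight c).mul (const 2)).mono fun _ _ _ _ _ => (pow_succ _ _).le
  exact ((polyBounded_setupTime c).add (((((polyBounded_two_pow_treeHeight c).mul
    (snd.mul ((const 2).mul thd))).mul ((((const 2).mul polyBounded_scaleExp).mul (const 5)).add
    (const 6))).add (const 2)).add ((fst.mul ((((polyBounded_scale.add (const 1)).mul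
    (((const 4).mul (hΔ.mul ((polyBounded_scale.mul (const 3)).add (const 6)))).add
    (const 15))).add (hpow.mul (((snd.mul ((((const 2).mul thd).mul (const 7)).add
    (const 15))).add ((const 3).mul (polyBounded_treeHeight c))).add (const 12)))).add
    (const 17))).add (const 5)))).add (const 4)

open PolyBounded in
/-- The number of random bits that are used. -/
theorem polyBounded_randomBits (c : ℕ) :
    PolyBounded fun _ n Δ => 2 ^ treeHeight c n Δ * (n * (2 * Δ)) * (2 * scaleExp Δ) :=
  ((polyBounded_two_pow_treeHeight c).mul (snd.mul ((const 2).mul thd))).mul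
    ((const 2).mul polyBounded_scaleExp)

/-! ### The size of the formula -/

theorem three_halves_le_logb {n : ℕ} (hn : 2 ≤ n) : 3 / 2 ≤ Real.logb 2 (n + 1) := by
  have hn' : (2 : ℝ) ≤ n := by exact_mod_cast hn
  rw [Real.le_logb_iff_rpow_le (by norm_num) (by linarith)]
  have h : ((2 : ℝ) ^ (3 / 2 : ℝ)) ^ 2 ≤ 3 ^ 2 := by
    rw [← Real.rpow_natCast ((2 : ℝ) ^ (3 / 2 : ℝ)), ← Real.rpow_mul (by norm_num)]
    norm_num
  have := le_of_pow_le_pow_left₀ (by norm_num) (by norm_num) h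
  linarith

theorem indexBits_le {n Δ : ℕ} (hn : 2 ≤ n) (hΔ : 1 ≤ Δ) :
    (indexBits n Δ : ℝ) ≤ 803 * (Δ : ℝ) ^ (0.0025 : ℝ) * Real.logb 2 (n + 1) := by
  have hℓ := three_halves_le_logb hn
  have hΔ' : (1 : ℝ) ≤ Δ := by exact_mod_cast hΔ
  have h1 : (indexBits n Δ : ℝ) ≤ Real.logb 2 (4 * Δ * (n + 1)) := by
    rw [Real.le_logb_iff_rpow_le (by norm_num) (by positivity), Real.rpow_natCast]
    have h : 2 ^ indexBits n Δ ≤ 4 * Δ * (n + 1) :=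
      (two_pow_clog_le (by omega)).trans (by nlinarith)
    exact_mod_cast h
  have h2 : Real.logb 2 (4 * Δ * (n + 1)) =
      2 + Real.logb 2 Δ + Real.logb 2 (n + 1) := by
    rw [Real.logb_mul (by positivity) (by positivity), Real.logb_mul (by norm_num) (by positivity),
      show (4 : ℝ) = 2 ^ (2 : ℝ) by norm_num, Real.logb_rpow (by norm_num) (by norm_num)]
  have h3 : Real.logb 2 Δ ≤ 800 * (Δ : ℝ) ^ (0.0025 : ℝ) := by
    have h := Real.log_le_rpow_div (x := (Δ : ℝ)) (by positivity) (ε := 0.0025) (by norm_num)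
    have hl := Real.log_two_gt_d9
    rw [Real.logb, div_le_iff₀ (by positivity)]
    have hp : 0 ≤ (Δ : ℝ) ^ (0.0025 : ℝ) := by positivity
    rw [div_eq_mul_inv] at h
    norm_num at h ⊢
    nlinarith
  have h4 : 1 ≤ (Δ : ℝ) ^ (0.0025 : ℝ) := Real.one_le_rpow hΔ' (by norm_num)
  rw [h2] at h1
  norm_num at h1 h3 h4 ⊢
  nlinarith

theorem exists_size_bound : ∃ C : ℕ, ∀ m n Δ : ℕ, 2 ≤ n → 1 ≤ Δ →
    ((m * (2 ^ treeHeight middleRounds n Δ * (2 * n + 1)) : ℕ) : ℝ) ≤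
      (Δ : ℝ) ^ (5.3 : ℝ) * m * n * Real.logb 2 (n + 1) ^ C := by
  obtain ⟨C, hC⟩ := pow_unbounded_of_one_lt
    (6 * (8 * 803) ^ 2 * 4 ^ middleRounds * 3 : ℝ) (by norm_num : (1 : ℝ) < 3 / 2)
  refine ⟨C + 2, fun m n Δ hn hΔ => ?_⟩
  have hΔ' : (1 : ℝ) ≤ Δ := by exact_mod_cast hΔ
  have hn' : (2 : ℝ) ≤ n := by exact_mod_cast hn
  have hℓ := three_halves_le_logb hn
  set ℓ := Real.logb 2 (n + 1)
  have hb := indexBits_le hn hΔ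
  have h1 : ((2 ^ squaringRounds n Δ : ℕ) : ℝ) ≤ (8 * indexBits n Δ * Δ : ℕ) :=
    Nat.cast_le.2 (two_pow_squaringRounds_le (by omega) hΔ)
  push_cast at h1
  have h2 : (2 : ℝ) ^ squaringRounds n Δ ≤
      8 * 803 * ((Δ : ℝ) ^ (0.0025 : ℝ) * Δ) * ℓ := by
    refine h1.trans ?_
    calc 8 * (indexBits n Δ : ℝ) * Δ ≤ 8 * (803 * (Δ : ℝ) ^ (0.0025 : ℝ) * ℓ) * Δ := by gcongr
      _ = _ := by ring
  have h3 := four_pow_growth_le hΔ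
  have hpow : (Δ : ℝ) ^ (3.295 : ℝ) * ((Δ : ℝ) ^ (0.0025 : ℝ) * Δ) ^ 2 = (Δ : ℝ) ^ (5.3 : ℝ) := by
    have hpos : (0 : ℝ) < Δ := by linarith
    rw [← Real.rpow_add_one hpos.ne', ← Real.rpow_natCast, ← Real.rpow_mul hpos.le,
      ← Real.rpow_add hpos]
    norm_num
  have hK : (6 * (8 * 803) ^ 2 * 4 ^ middleRounds * 3 : ℝ) ≤ ℓ ^ C :=
    hC.le.trans (by gcongr)
  rw [two_pow_treeHeight]
  push_cast
  calc (m : ℝ) * (4 ^ growthRounds Δ * (2 ^ squaringRounds n Δ) ^ 2 * 4 ^ middleRounds *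
        (2 * n + 1))
      ≤ m * (6 * (Δ : ℝ) ^ (3.295 : ℝ) * (8 * 803 * ((Δ : ℝ) ^ (0.0025 : ℝ) * Δ) * ℓ) ^ 2 *
          4 ^ middleRounds * (3 * n)) := by
        gcongr
        linarith
    _ = (Δ : ℝ) ^ (3.295 : ℝ) * ((Δ : ℝ) ^ (0.0025 : ℝ) * Δ) ^ 2 * m * n *
          ((6 * (8 * 803) ^ 2 * 4 ^ middleRounds * 3) * ℓ ^ 2) := by ring
    _ ≤ (Δ : ℝ) ^ (5.3 : ℝ) * m * n * (ℓ ^ C * ℓ ^ 2) := by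
        rw [hpow]; gcongr
    _ = _ := by rw [pow_add]

/-! ### The input in memory -/

section input

variable {m n : ℕ} (A : Matrix (Fin m) (Fin n) ℕ) (b : Fin m → ℕ)

theorem RamState.flatten_matrix : (List.ofFn fun i => List.ofFn fun j => A i j).flatten =
    List.ofFn fun k : Fin (m * n) => A (finProdFinEquiv.symm k).1 (finProdFinEquiv.symm k).2 := by
  rw [List.ofFn_mul]
  congr 2
  funext i
  congr 1
  funext j
  have h : ∀ hlt, (⟨i * n + j, hlt⟩ : Fin (m * n)) = finProdFinEquiv (i, j) := by
    intro hlt; ext; simp [finProdFinEquiv]; ring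
  rw [h, Equiv.symm_apply_apply]

theorem RamState.init_mem_matrix (i : Fin m) (j : Fin n) :
    (RamState.init A b).mem (i * n + j) = A i j := by
  have hlt : (i : ℕ) * n + j < m * n := by
    have : (i : ℕ) * n + n ≤ m * n := by
      rw [← Nat.succ_mul]; exact Nat.mul_le_mul_right _ i.2
    omega
  have h : (⟨i * n + j, hlt⟩ : Fin (m * n)) = finProdFinEquiv (i, j) := by
    ext; simp [finProdFinEquiv]; ring
  simp only [RamState.init, flatten_matrix]
  rw [List.getD_append _ _ _ _ (by simpa using hlt), List.getD_eq_getElem _ _ (by simpa using hlt),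
    List.getElem_ofFn, h, Equiv.symm_apply_apply]

theorem RamState.init_mem_rhs (i : Fin m) : (RamState.init A b).mem (m * n + i) = b i := by
  simp only [RamState.init, flatten_matrix]
  rw [List.getD_append_right _ _ _ _ (by simp), List.length_ofFn, Nat.add_sub_cancel_left,
    List.getD_eq_getElem _ _ (by simp), List.getElem_ofFn]

/-- The largest entry of the input. -/
def maxEntry : ℕ := (Finset.range (m * n + m)).sup (RamState.init A b).mem

theorem le_maxEntry (i : Fin m) (j : Fin n) : A i j ≤ maxEntry A b := by
  rw [← RamState.init_mem_matrix A b]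
  refine Finset.le_sup ?_
  have : (i : ℕ) * n + n ≤ m * n := by
    rw [← Nat.succ_mul]; exact Nat.mul_le_mul_right _ i.2
  rw [Finset.mem_range]
  omega

theorem rhs_le_maxEntry (i : Fin m) : b i ≤ maxEntry A b := by
  rw [← RamState.init_mem_rhs A b]
  exact Finset.le_sup (by simp)

theorem maxEntry_le {Δ : ℕ} (hA : ∀ i j, A i j ≤ Δ) (hb : ∀ i, b i ≤ Δ) : maxEntry A b ≤ Δ := by
  refine Finset.sup_le fun x hx => ?_
  rw [Finset.mem_range] at hx
  by_cases h : x < m * n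
  · have e := RamState.init_mem_matrix A b (finProdFinEquiv.symm ⟨x, h⟩).1
      (finProdFinEquiv.symm ⟨x, h⟩).2
    have hx' : ((finProdFinEquiv.symm ⟨x, h⟩).1 : ℕ) * n + (finProdFinEquiv.symm ⟨x, h⟩).2 = x := by
      have := congrArg Fin.val (finProdFinEquiv.apply_symm_apply (⟨x, h⟩ : Fin (m * n)))
      rw [finProdFinEquiv_apply_val] at this
      rw [mul_comm, add_comm]
      exact this
    rw [hx'] at e
    rw [e]
    exact hA _ _
  · have e := RamState.init_mem_rhs A b ⟨x - m * n, by omega⟩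
    simp only [Nat.add_sub_cancel' (not_lt.1 h)] at e
    rw [e]
    exact hb _

end input

/-- If the output is a function `w` of the tape, then the success probability is at least the
probability that `w` is good. -/
theorem successProb_ge {P : RamProg} {s : RamState} {T : ℕ} {good : Set (List ℕ)}
    {w : (ℕ → Bool) → List ℕ} (h : ∀ ω, P.Runs ω s T fun s' => s'.out = w ω) {ε : ℝ}
    (hε : ε ≤ prob T fun ω => w ω ∈ good) : ε ≤ P.successProb s T good := by
  refine hε.trans ?_
  unfold prob RamProg.successProb
  gcongr
  · exact Set.toFinite _
  · obtain ⟨s', t, h1, h2, h3⟩ := h (RamProg.tape ‹_›)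
    intro hw
    exact ⟨s', t, h1, h2, by rwa [h3]⟩

/-! ### Correctness of the program -/

/-- With a single variable `x`, the formula `x` works. -/
theorem isMonotoneFormulaFor_var {m Δ : ℕ} (A : Matrix (Fin m) (Fin 1) ℕ) (b : Fin m → ℕ) (C : ℕ)
    (hm : 0 < m) (hb : ∀ i, 1 ≤ b i ∧ b i ≤ Δ) (hne : (coveringSet A b).Nonempty) :
    IsMonotoneFormulaFor A b
      ((Δ : ℝ) ^ (5.3 : ℝ) * m * (1 : ℕ) * Real.logb 2 ((1 : ℕ) + 1) ^ C) (.var 0) := by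
  obtain ⟨z, hz⟩ := hne
  have key : ∀ x ∈ coveringSet A b, x 0 = true := by
    intro x hx
    have h1 := hx ⟨0, hm⟩
    have h2 := (hb ⟨0, hm⟩).1
    by_contra hc
    simp [Matrix.mulVec, dotProduct, Bool.not_eq_true _ ▸ hc] at h1
    omega
  refine ⟨trivial, ?_, ?_⟩
  · ext x
    refine ⟨fun h => ?_, key x⟩
    have hxz : x = z := by
      funext j
      rw [Subsingleton.elim j 0, key z hz]
      exact h
    rwa [hxz]
  · have hΔ : (1 : ℝ) ≤ Δ := by exact_mod_cast (hb ⟨0, hm⟩).1.trans (hb ⟨0, hm⟩).2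
    have hm' : (1 : ℝ) ≤ m := by exact_mod_cast hm
    have h1 : 1 ≤ (Δ : ℝ) ^ (5.3 : ℝ) := Real.one_le_rpow hΔ (by norm_num)
    have h2 : Real.logb 2 ((1 : ℕ) + 1) = 1 := by norm_num
    rw [h2]
    simp only [BoolFormula.size]
    simp only [Nat.cast_one, mul_one, one_pow]
    exact one_le_mul_of_one_le_of_one_le h1 hm'

/-- The algorithmic half of the result. -/
theorem exists_coveringProg : ∃ C : ℕ, ∃ (P : RamProg) (p : Polynomial ℕ),
    ∀ (m n Δ : ℕ) (A : Matrix (Fin m) (Fin n) ℕ) (b : Fin m → ℕ),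
      0 < m → (∀ i j, A i j ≤ Δ) → (∀ i, 1 ≤ b i ∧ b i ≤ Δ) → (coveringSet A b).Nonempty →
      P.HaltsWithin (RamState.init A b) (p.eval (m + n + Δ)) ∧
      2 / 3 ≤ P.successProb (RamState.init A b) (p.eval (m + n + Δ))
        {w | ∃ φ : BoolFormula n, w = φ.code ∧ IsMonotoneFormulaFor A b
          ((Δ : ℝ) ^ (5.3 : ℝ) * m * n * Real.logb 2 (n + 1) ^ C) φ} := by
  obtain ⟨C, hC⟩ := exists_size_bound
  obtain ⟨p, hp⟩ := ((polyBounded_runTime middleRounds).add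
    (polyBounded_randomBits middleRounds)).add (PolyBounded.const 4)
  refine ⟨C, RamProg.coveringProg middleRounds, p, fun m n Δ A b hm hA hb hne => ?_⟩
  suffices H : ∃ w : (ℕ → Bool) → List ℕ,
      (∀ ω, (RamProg.coveringProg middleRounds).Runs ω (RamState.init A b) (p.eval (m + n + Δ))
        fun s' => s'.out = w ω) ∧
      2 / 3 ≤ prob (p.eval (m + n + Δ)) fun ω => w ω ∈ {w | ∃ φ : BoolFormula n, w = φ.code ∧
        IsMonotoneFormulaFor A b
          ((Δ : ℝ) ^ (5.3 : ℝ) * m * n * Real.logb 2 (n + 1) ^ C) φ} by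
    obtain ⟨w, h1, h2⟩ := H
    refine ⟨fun ω => ?_, successProb_ge h1 h2⟩
    obtain ⟨s', t, h3, h4, -⟩ := h1 ω
    exact ⟨s', t, h3, h4⟩
  have hbΔ := hb ⟨0, hm⟩
  have hn : 1 ≤ n := by
    by_contra h0
    obtain rfl : n = 0 := by omega
    obtain ⟨z, hz⟩ := hne
    have := hz ⟨0, hm⟩
    simp [Matrix.mulVec, dotProduct] at this
    omega
  rcases hn.eq_or_lt with rfl | hn2
  · refine ⟨fun _ => [3], fun ω => (RamProg.runs_coveringProg_of_lt (by simp [RamState.init])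
      rfl).time_le ((Nat.le_add_left _ _).trans (hp m 1 Δ _ le_rfl (by omega) le_rfl)), ?_⟩
    have hgood := isMonotoneFormulaFor_var A b C hm hb hne
    have : (fun _ : ℕ → Bool => [3] ∈ {w | ∃ φ : BoolFormula 1, w = φ.code ∧
        IsMonotoneFormulaFor A b ((Δ : ℝ) ^ (5.3 : ℝ) * m * (1 : ℕ) *
          Real.logb 2 ((1 : ℕ) + 1) ^ C) φ}) = fun _ => True := by
      funext ω
      exact eq_true ⟨_, rfl, hgood⟩
    rw [this, prob_true]
    norm_num
  -- the program uses the actual maximum of the entries, which may be smaller than `Δ`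
  obtain ⟨δ, hδ⟩ : ∃ δ, δ = maxEntry A b := ⟨_, rfl⟩
  have hδΔ : δ ≤ Δ := hδ ▸ maxEntry_le A b hA fun i => (hb i).2
  have hAδ : ∀ i j, A i j ≤ δ := fun i j => hδ ▸ le_maxEntry A b i j
  have hbδ : ∀ i, 1 ≤ b i ∧ b i ≤ δ := fun i => ⟨(hb i).1, hδ ▸ rhs_le_maxEntry A b i⟩
  have hδ1 : 1 ≤ δ := (hbδ ⟨0, hm⟩).1.trans (hbδ ⟨0, hm⟩).2
  have hT := hp m n δ (m + n + Δ) hn hδ1 (by omega)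
  beta_reduce at hT
  refine ⟨_, fun ω => (RamProg.runs_coveringProg (c := middleRounds) (m := m) (n := n) (Δ := δ)
    (by simp [RamState.init]) (by simp [RamState.init]) hn2 hm hδ (fun i hi => ?_) rfl rfl).time_le
    (by omega), ?_⟩
  · have := RamState.init_mem_rhs A b ⟨i, hi⟩
    rw [show (RamState.init A b).mem (m * n + i) = b ⟨i, hi⟩ from this]
    exact (hb _).1
  refine (prob_goodTable hn hδ1 (T := p.eval (m + n + Δ)) (by omega)).trans
    (prob_mono fun ω hgood => ?_)
  have hrow : ∀ (i : Fin m) (j : Fin n), tableMem (RamState.init A b).mem (m * n + m)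
      (tableEntry ω (2 * scaleExp δ)) (i * n + j) = A i j := by
    intro i j
    have : (i : ℕ) * n + n ≤ m * n := by
      rw [← Nat.succ_mul]; exact Nat.mul_le_mul_right _ i.2
    rw [tableMem, if_pos (by omega)]
    exact RamState.init_mem_matrix A b i j
  obtain ⟨φ, h1, h2, h3, h4⟩ := exists_formula_of_goodTable A b hm hn hAδ hbδ hne hgood
    (fun i j => tableMem (RamState.init A b).mem (m * n + m)
      (tableEntry ω (2 * scaleExp δ)) (i * n + j))
    (fun i => (RamState.init A b).mem (m * n + i)) hrow (RamState.init_mem_rhs A b)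
  refine ⟨φ, h1.symm, h2, h3, ?_⟩
  have h5 : (φ.size : ℝ) ≤ (δ : ℝ) ^ (5.3 : ℝ) * m * n * Real.logb 2 (n + 1) ^ C :=
    (Nat.cast_le.2 h4).trans (hC m n δ hn2 hδ1)
  have hℓ := three_halves_le_logb hn2
  refine h5.trans ?_
  gcongr

theorem mainTheorem7 :
    ∃ C : ℕ,
      (∀ (m n Δ : ℕ) (A : Matrix (Fin m) (Fin n) ℕ) (b : Fin m → ℕ),
        0 < m → (∀ i j, A i j ≤ Δ) → (∀ i, 1 ≤ b i ∧ b i ≤ Δ) → (coveringSet A b).Nonempty →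
        ∃ φ : BoolFormula n, IsMonotoneFormulaFor A b
          ((Δ : ℝ) ^ (5.3 : ℝ) * m * n * Real.logb 2 (n + 1) ^ C) φ) ∧
      ∃ (P : RamProg) (p : Polynomial ℕ),
        ∀ (m n Δ : ℕ) (A : Matrix (Fin m) (Fin n) ℕ) (b : Fin m → ℕ),
          0 < m → (∀ i j, A i j ≤ Δ) → (∀ i, 1 ≤ b i ∧ b i ≤ Δ) → (coveringSet A b).Nonempty →
          P.HaltsWithin (RamState.init A b) (p.eval (m + n + Δ)) ∧
          2 / 3 ≤ P.successProb (RamState.init A b) (p.eval (m + n + Δ))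
            {w | ∃ φ : BoolFormula n, w = φ.code ∧ IsMonotoneFormulaFor A b
              ((Δ : ℝ) ^ (5.3 : ℝ) * m * n * Real.logb 2 (n + 1) ^ C) φ} := by
  obtain ⟨C, P, p, h⟩ := exists_coveringProg
  refine ⟨C, fun m n Δ A b hm hA hb hne => ?_, P, p, h⟩
  -- an event of positive probability is not empty
  by_contra hc
  have h2 := (h m n Δ A b hm hA hb hne).2
  have hempty : {w | ∃ φ : BoolFormula n, w = φ.code ∧ IsMonotoneFormulaFor A b
      ((Δ : ℝ) ^ (5.3 : ℝ) * m * n * Real.logb 2 (n + 1) ^ C) φ} = ∅ :=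
    Set.eq_empty_of_forall_notMem fun w hw => hc (hw.imp fun _ h => h.2)
  rw [hempty] at h2
  simp [RamProg.successProb] at h2
  norm_num at h2
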